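/- Let $S\subseteq\mathbb R^n$ carry a finite nonzero measure $\nu$. On a probability space with expectation $E$ let, for every $N\ge1$, $H_N=(H_N(\sigma))_{\sigma\in S^N}$ be a Gaussian process, jointly measurable in $\sigma$ and the disorder, with mean $b_N(\sigma)$ and covariance $c_N(\sigma,\sigma')$. Let $k\in\mathbb N$, let $g,f:\mathbb R^k\to\mathbb R$ be of class $C^1$ with $f$ convex, let $M,C,C'$ be constants, and let $m_N=(m_N^{(1)},\dots,m_N^{(k)})$ and $Q_N=(Q_N^{(1)},\dots,Q_N^{(k)})$ be measurable functions on $S^N$ and $S^N\times S^N$ such that for all $N\ge 1$, all $i$ and all $\sigma,\sigma'\in S^N$ - $\left|\frac{b_N(\sigma)}N-g(m_N(\sigma))\right|\le \frac{C'}N$ and $|m^{(i)}_N(\sigma)|\le M$; - $\left|\frac{c_N(\sigma,\sigma')}N-f(Q_N(\sigma,\sigma'))\right|\le \frac{C}N$ and $|Q^{(i)}_N(\sigma,\sigma)|\le M$; - if $N=N_1+N_2$ with $N_1,N_2\ge1$, and $\sigma=(\sigma^{(1)},\sigma^{(2)})$, $\sigma'=(\sigma'^{(1)},\sigma'^{(2)})$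 with $\sigma^{(j)},\sigma'^{(j)}\in S^{N_j}$, then $N m^{(i)}_N(\sigma)=N_1m^{(i)}_{N_1}(\sigma^{(1)})+N_2m^{(i)}_{N_2}(\sigma^{(2)})$ and $N Q^{(i)}_N(\sigma,\sigma')=N_1Q^{(i)}_{N_1}(\sigma^{(1)},\sigma'^{(1)})+N_2Q^{(i)}_{N_2}(\sigma^{(2)},\sigma'^{(2)})$. For $\beta>0$ let $Z_N(\beta)=\int_{S^N}e^{-\beta H_N(\sigma)}\,\nu(d\sigma_1)\cdots\nu(d\sigma_N)$. Then $0<Z_N(\beta)<\infty$ almost surely, $\ln Z_N(\beta)$ is integrable, and with $f_N(\beta)=-\frac1{N\beta}E\ln Z_N(\beta)$ there is a function $\beta\mapsto f_\infty(\beta)\in\mathbb R$ such that for every $\beta>0$: 1. $\lim_{N\to\infty}f_N(\beta)=f_\infty(\beta)$; 2. $\lim_{N\to\infty}-\frac1{N\beta}\ln Z_N(\beta)=f_\infty(\beta)$ almost surely; 3. with $L=\max_{|x_i|\le M\,\forall i}|f(x_1,\dots,x_k)|$, for all $N\ge1$ and $u>0$, $$P\left(\left|-\frac1{N\beta}\ln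 Z_N(\beta)-f_N(\beta)\right|\ge u\right)\le 2\exp\left(-\frac{Nu^2}{2L_N}\right),\qquad L_N=L+\frac CN .$$ Moreover, for every $N$ such that $c_N(\sigma,\sigma)\le NL$ for all $\sigma\in S^N$ (in particular if $c_N=N f(Q_N)$ exactly), this bound holds with $L_N=L$. If $L_N=0$, the right-hand side is read as $0$. -/

import Mathlib

open MeasureTheory ProbabilityTheory Filter Topology

noncomputable section

namespace SpinGlass

/-- Configurations of `N` spins with values in `S ⊆ ℝⁿ`. -/
abbrev Config {n : ℕ} (S : Set (EuclideanSpace ℝ (Fin n))) (N : ℕ) : Type := Fin N → S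

/-- A family of functions of the configuration, one for each system size `N`, such that `N` times
the `N`-th one is additive when the system is cut into two blocks of consecutive spins. -/
def IsSizeAdditive {n : ℕ} {S : Set (EuclideanSpace ℝ (Fin n))}
    (m : (N : ℕ) → Config S N → ℝ) : Prop :=
  ∀ N₁ N₂ : ℕ, 1 ≤ N₁ → 1 ≤ N₂ → ∀ (σ₁ : Config S N₁) (σ₂ : Config S N₂),
    ((N₁ + N₂ : ℕ) : ℝ) * m (N₁ + N₂) (Fin.append σ₁ σ₂) =
      (N₁ : ℝ) * m N₁ σ₁ + (N₂ : ℝ) * m N₂ σ₂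

/-- The same for functions of two configurations, both cut at the same place. -/
def IsSizeAdditive₂ {n : ℕ} {S : Set (EuclideanSpace ℝ (Fin n))}
    (Q : (N : ℕ) → Config S N → Config S N → ℝ) : Prop :=
  ∀ N₁ N₂ : ℕ, 1 ≤ N₁ → 1 ≤ N₂ →
    ∀ (σ₁ τ₁ : Config S N₁) (σ₂ τ₂ : Config S N₂),
    ((N₁ + N₂ : ℕ) : ℝ) * Q (N₁ + N₂) (Fin.append σ₁ σ₂) (Fin.append τ₁ τ₂) =
      (N₁ : ℝ) * Q N₁ σ₁ τ₁ + (N₂ : ℝ) * Q N₂ σ₂ τ₂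

section

variable {n : ℕ} {S : Set (EuclideanSpace ℝ (Fin n))} {Ω : Type*}

/-- The Boltzmann factor `exp (-β H_N(σ, J))`. -/
def boltzmannFactor (H : (N : ℕ) → Config S N → Ω → ℝ) (β : ℝ) (N : ℕ) (ω : Ω)
    (σ : Config S N) : ℝ :=
  Real.exp (-β * H N σ ω)

/-- The partition function: the integral of the Boltzmann factor against `ν(dσ₁)⋯ν(dσ_N)`. -/
def partitionFunction (ν : Measure S) [SigmaFinite ν] (H : (N : ℕ) → Config S N → Ω → ℝ)
    (β : ℝ) (N : ℕ) (ω : Ω) : ℝ :=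
  ∫ σ : Config S N, boltzmannFactor H β N ω σ ∂(Measure.pi fun _ : Fin N => ν)

/-- The disorder dependent free energy per site `-(1/(Nβ)) log Z_N`. -/
def freeEnergy (ν : Measure S) [SigmaFinite ν] (H : (N : ℕ) → Config S N → Ω → ℝ)
    (β : ℝ) (N : ℕ) (ω : Ω) : ℝ :=
  -(1 / ((N : ℝ) * β)) * Real.log (partitionFunction ν H β N ω)

/-- The quenched free energy per site `-(1/(Nβ)) E log Z_N`. -/
def quenchedFreeEnergy [MeasurableSpace Ω] (P : Measure Ω) (ν : Measure S) [SigmaFinite ν]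
    (H : (N : ℕ) → Config S N → Ω → ℝ) (β : ℝ) (N : ℕ) : ℝ :=
  -(1 / ((N : ℝ) * β)) * ∫ ω, Real.log (partitionFunction ν H β N ω) ∂P

end

/-- The maximum of `|f|` over the cube `|x_i| ≤ M` (attained when `f` is continuous). -/
def maxAbsOnCube {k : ℕ} (f : (Fin k → ℝ) → ℝ) (M : ℝ) : ℝ :=
  sSup ((fun x => |f x|) '' {x : Fin k → ℝ | ∀ i, |x i| ≤ M})

/-- The Gaussian bound `2 exp (-N u² / (2 L))` for deviations of size `u > 0`; for `L = 0` it is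
read as its limit `0` (Lean's division by zero would make it the void bound `2`). -/
def gaussianTail (N : ℕ) (L u : ℝ) : ℝ :=
  if L = 0 then 0 else 2 * Real.exp (-((N : ℝ) * u ^ 2 / (2 * L)))

end SpinGlass

end

/-! The proof is a Guerra–Toninelli superadditivity argument in which the order parameters are not
fixed in advance and nothing is differentiated along an interpolation. Convexity of `f` and
additivity of the overlaps bound the covariance of `H (N₁ + N₂)` at concatenated configurations by
that of a sum of independent copies of `H N₁` and `H N₂`, up to a constant (`cov_append_le`). By
Gaussian comparison (`integral_logSumExp_le_of_covariance_le`), smaller covariances raise the mean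
of log-sum-exp, provided that mean plus half variance does not drop at any point. This proviso can
fail for `-β H`, so a deterministic compensator is subtracted that makes mean plus half variance
vanish; the compensated quenched averages are then superadditive up to a constant
(`meanLog_compensated_append`). The compensator is, up to a bounded error, `N` times a continuous
function of magnetizations and self-overlaps, which range in a compact set. Cover that set by
finitely many small balls. On the cell of configurations belonging to one ball, compensated and true
energies differ by almost a constant, and by concentration some cell carries `E log Z_N` up to
`O(√N)` (`exists_meanLog_le_cell`). Concatenating blocks from a cell stays in the cell because balls
are convex, and a bounded remainder only doubles the radius. Hence `E log Z_N / N` is eventually at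
least `E log Z_{N₀} / N₀ - 4ε` for every large `N₀`; with the annealed upper bound this gives
convergence. Gaussian concentration of `log Z_N` (`hasSubgaussianMGF_log`) gives the tail bounds,
and Borel–Cantelli the almost sure limit. Both Gaussian inequalities rest on one device: averages
over Gaussian translations form a semigroup. At time `h` the inequality follows from a Taylor
expansion with error of order `h^(3/2)`; doubling the time `n` times from `h = 2^(-n)` reaches time
one with accumulated error of order `2^(-n/2)`. To pass from finite index sets to a measure,
independent points are sampled from it: the strong law gives the integral, and second moments of the
logarithms that are bounded uniformly in the sample give convergence of the means. -/

/-! ### The log-sum-exp function -/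

section LogSumExp

variable {ι : Type*} [Fintype ι]

/-- The logarithm of a sum of exponentials. -/
noncomputable def logSumExp (x : ι → ℝ) : ℝ := Real.log (∑ i, Real.exp (x i))

/-- The Gibbs weights attached to a vector of energies. -/
noncomputable def softmax (x : ι → ℝ) (i : ι) : ℝ := Real.exp (x i) / ∑ j, Real.exp (x j)

theorem sum_exp_pos [Nonempty ι] (x : ι → ℝ) : 0 < ∑ i, Real.exp (x i) :=
  Finset.sum_pos (fun _ _ => Real.exp_pos _) Finset.univ_nonempty

theorem softmax_nonneg (x : ι → ℝ) (i : ι) : 0 ≤ softmax x i := by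
  unfold softmax; positivity

theorem sum_softmax [Nonempty ι] (x : ι → ℝ) : ∑ i, softmax x i = 1 := by
  unfold softmax
  rw [← Finset.sum_div, div_self (sum_exp_pos x).ne']

/-- Increments of log-sum-exp are cumulant generating functions under the Gibbs weights, so every
later estimate reduces to one about probability weights, uniformly in the base point and in the
number of indices. -/
theorem logSumExp_add [Nonempty ι] (w v : ι → ℝ) :
    logSumExp (w + v) = logSumExp w + Real.log (∑ i, softmax w i * Real.exp (v i)) := by
  have h0 := sum_exp_pos w
  have h1 : ∑ i, softmax w i * Real.exp (v i)
      = (∑ i, Real.exp ((w + v) i)) / ∑ i, Real.exp (w i) := by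
    rw [Finset.sum_div]
    refine Finset.sum_congr rfl fun i _ => ?_
    simp only [softmax, Pi.add_apply, Real.exp_add]
    ring
  rw [h1, Real.log_div (sum_exp_pos _).ne' h0.ne']
  unfold logSumExp
  ring

theorem continuous_logSumExp [Nonempty ι] : Continuous (logSumExp : (ι → ℝ) → ℝ) := by
  unfold logSumExp
  exact Continuous.log (by fun_prop) fun x => (sum_exp_pos x).ne'

/-! ### Cumulant expansions for finite probability weights -/

section Weights

variable {p v : ι → ℝ} {a : ℝ}

theorem abs_weighted_sum_le (hp : ∀ i, 0 ≤ p i) (hp1 : ∑ i, p i = 1) {u : ι → ℝ} {b : ℝ}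
    (hu : ∀ i, |u i| ≤ b) : |∑ i, p i * u i| ≤ b :=
  calc |∑ i, p i * u i| ≤ ∑ i, |p i * u i| := Finset.abs_sum_le_sum_abs _ _
    _ ≤ ∑ i, p i * b := Finset.sum_le_sum fun i _ => by
        rw [abs_mul, abs_of_nonneg (hp i)]
        exact mul_le_mul_of_nonneg_left (hu i) (hp i)
    _ = b := by rw [← Finset.sum_mul, hp1, one_mul]

theorem abs_log_weighted_exp_le (hp : ∀ i, 0 ≤ p i) (hp1 : ∑ i, p i = 1)
    (hv : ∀ i, |v i| ≤ a) : |Real.log (∑ i, p i * Real.exp (v i))| ≤ a := by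
  have hlow : Real.exp (-a) ≤ ∑ i, p i * Real.exp (v i) := by
    calc Real.exp (-a) = ∑ i, p i * Real.exp (-a) := by rw [← Finset.sum_mul, hp1, one_mul]
      _ ≤ _ := Finset.sum_le_sum fun i _ => mul_le_mul_of_nonneg_left
          (Real.exp_le_exp.2 (neg_le_of_abs_le (hv i))) (hp i)
  have hup : ∑ i, p i * Real.exp (v i) ≤ Real.exp a := by
    calc _ ≤ ∑ i, p i * Real.exp a := Finset.sum_le_sum fun i _ => mul_le_mul_of_nonneg_left
          (Real.exp_le_exp.2 (le_of_abs_le (hv i))) (hp i)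
      _ = Real.exp a := by rw [← Finset.sum_mul, hp1, one_mul]
  have hpos := (Real.exp_pos _).trans_le hlow
  rw [abs_le]
  exact ⟨(Real.le_log_iff_exp_le hpos).2 hlow, (Real.log_le_iff_le_exp hpos).2 hup⟩

theorem abs_exp_sub_quadratic_le {x : ℝ} (hx : |x| ≤ 1) :
    |Real.exp x - 1 - x - x ^ 2 / 2| ≤ |x| ^ 3 := by
  have h := Real.exp_bound hx (n := 3) (by norm_num)
  simp only [Finset.sum_range_succ, Finset.sum_range_zero, Nat.factorial] at h
  norm_num at h
  have e : Real.exp x - 1 - x - x ^ 2 / 2 = Real.exp x - (1 + x + x ^ 2 / 2) := by ring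
  rw [e]
  refine h.trans ?_
  have : 0 ≤ |x| ^ 3 := by positivity
  linarith

theorem abs_log_one_add_sub_quadratic_le {s : ℝ} (hs : |s| ≤ 1 / 2) :
    |Real.log (1 + s) - s + s ^ 2 / 2| ≤ 2 * |s| ^ 3 := by
  have h := Real.abs_log_sub_add_sum_range_le (x := -s) (by rw [abs_neg]; linarith) 2
  simp only [Finset.sum_range_succ, Finset.sum_range_zero, abs_neg, sub_neg_eq_add] at h
  norm_num at h
  have e : Real.log (1 + s) - s + s ^ 2 / 2 = -s + s ^ 2 / 2 + Real.log (1 + s) := by ring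
  rw [e]
  refine h.trans ?_
  rw [div_le_iff₀ (by linarith)]
  have : 0 ≤ |s| ^ 3 := by positivity
  nlinarith

/-- Second order expansion of a cumulant generating function on a finite set. -/
theorem abs_log_weighted_exp_sub_quadratic_le (hp : ∀ i, 0 ≤ p i) (hp1 : ∑ i, p i = 1)
    (hv : ∀ i, |v i| ≤ a) (ha : 0 ≤ a) :
    |Real.log (∑ i, p i * Real.exp (v i)) - (∑ i, p i * v i)
      - ((∑ i, p i * v i ^ 2) - (∑ i, p i * v i) ^ 2) / 2| ≤ 50 * a ^ 3 := by
  set A := ∑ i, p i * v i with hA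
  set B := ∑ i, p i * v i ^ 2 with hB
  have hAa : |A| ≤ a := abs_weighted_sum_le hp hp1 hv
  have hBa : |B| ≤ a ^ 2 := abs_weighted_sum_le hp hp1 fun i => by
    rw [abs_pow]; exact pow_le_pow_left₀ (abs_nonneg _) (hv i) 2
  have ha2 : 0 ≤ a ^ 2 := by positivity
  have ha3 : 0 ≤ a ^ 3 := by positivity
  obtain ⟨hA1, hA2⟩ := abs_le.1 hAa
  obtain ⟨hB1, hB2⟩ := abs_le.1 hBa
  -- If `a ≤ 1/4`, the weighted sum is `1 + s` with `|s| ≤ 2a ≤ 1/2`, and the expansions of `exp`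
  -- and `log` compose. Otherwise each term separately is at most a multiple of `a ^ 3`. The
  -- constant `50` is not sharp.
  by_cases h4 : a ≤ 1 / 4
  · set s := (∑ i, p i * Real.exp (v i)) - 1 with hs
    have hse : |s - A - B / 2| ≤ a ^ 3 := by
      have e : s - A - B / 2 = ∑ i, p i * (Real.exp (v i) - 1 - v i - v i ^ 2 / 2) := by
        simp only [mul_sub, Finset.sum_sub_distrib, mul_one, hp1, hs, hA, hB, Finset.sum_div,
          mul_div_assoc]
      rw [e]
      refine abs_weighted_sum_le hp hp1 fun i => ?_
      refine (abs_exp_sub_quadratic_le ((hv i).trans (by linarith))).trans ?_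
      exact pow_le_pow_left₀ (abs_nonneg _) (hv i) 3
    obtain ⟨hs1, hs2⟩ := abs_le.1 hse
    have h32 : a ^ 3 ≤ a ^ 2 / 4 := by nlinarith
    have h21 : a ^ 2 ≤ a / 4 := by nlinarith
    have hsA : |s - A| ≤ a ^ 2 := by rw [abs_le]; constructor <;> linarith
    have hsa : |s| ≤ 2 * a := by
      obtain ⟨h1, h2⟩ := abs_le.1 hsA
      rw [abs_le]; constructor <;> linarith
    have hl := abs_log_one_add_sub_quadratic_le (s := s) (hsa.trans (by linarith))
    have hs3 : |s| ^ 3 ≤ 8 * a ^ 3 := by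
      calc |s| ^ 3 ≤ (2 * a) ^ 3 := pow_le_pow_left₀ (abs_nonneg _) hsa 3
        _ = _ := by ring
    have hq : |s ^ 2 - A ^ 2| ≤ 3 * a ^ 3 := by
      have : s ^ 2 - A ^ 2 = (s - A) * (s + A) := by ring
      rw [this, abs_mul]
      calc |s - A| * |s + A| ≤ a ^ 2 * (3 * a) := by
            refine mul_le_mul hsA ?_ (abs_nonneg _) ha2
            exact (abs_add_le _ _).trans (by linarith)
        _ = _ := by ring
    have h1s : ∑ i, p i * Real.exp (v i) = 1 + s := by rw [hs]; ring
    rw [h1s]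
    obtain ⟨hl1, hl2⟩ := abs_le.1 hl
    obtain ⟨hq1, hq2⟩ := abs_le.1 hq
    rw [abs_le]; constructor <;> linarith
  · have h4' : 1 / 4 < a := not_le.1 h4
    obtain ⟨hl1, hl2⟩ := abs_le.1 (abs_log_weighted_exp_le hp hp1 hv)
    have hA3 : A ^ 2 ≤ a ^ 2 := by
      rw [← sq_abs]; exact pow_le_pow_left₀ (abs_nonneg _) hAa 2
    have hA4 : 0 ≤ A ^ 2 := sq_nonneg A
    have h12 : a ≤ 4 * a ^ 2 := by nlinarith
    have h23 : a ^ 2 ≤ 4 * a ^ 3 := by nlinarith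
    rw [abs_le]; constructor <;> linarith

/-- First order expansion of a cumulant generating function on a finite set. -/
theorem abs_log_weighted_exp_sub_linear_le (hp : ∀ i, 0 ≤ p i) (hp1 : ∑ i, p i = 1)
    (hv : ∀ i, |v i| ≤ a) (ha : 0 ≤ a) :
    |Real.log (∑ i, p i * Real.exp (v i)) - ∑ i, p i * v i| ≤ 60 * a ^ 2 := by
  have hAa : |∑ i, p i * v i| ≤ a := abs_weighted_sum_le hp hp1 hv
  have hBa : |∑ i, p i * v i ^ 2| ≤ a ^ 2 := abs_weighted_sum_le hp hp1 fun i => by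
    rw [abs_pow]; exact pow_le_pow_left₀ (abs_nonneg _) (hv i) 2
  have hA3 : (∑ i, p i * v i) ^ 2 ≤ a ^ 2 := by
    rw [← sq_abs]; exact pow_le_pow_left₀ (abs_nonneg _) hAa 2
  have hA4 := sq_nonneg (∑ i, p i * v i)
  obtain ⟨hA1, hA2⟩ := abs_le.1 hAa
  obtain ⟨hB1, hB2⟩ := abs_le.1 hBa
  by_cases h1 : a ≤ 1
  · obtain ⟨h2, h3⟩ := abs_le.1 (abs_log_weighted_exp_sub_quadratic_le hp hp1 hv ha)
    have : a ^ 3 ≤ a ^ 2 := pow_le_pow_of_le_one ha h1 (by norm_num)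
    rw [abs_le]; constructor <;> linarith
  · obtain ⟨hl1, hl2⟩ := abs_le.1 (abs_log_weighted_exp_le hp hp1 hv)
    have : a ≤ a ^ 2 := by nlinarith [not_le.1 h1]
    rw [abs_le]; constructor <;> linarith

end Weights

theorem abs_logSumExp_add_sub_le [Nonempty ι] (w v : ι → ℝ) :
    |logSumExp (w + v) - logSumExp w| ≤ ‖v‖ := by
  rw [logSumExp_add, add_sub_cancel_left]
  exact abs_log_weighted_exp_le (softmax_nonneg w) (sum_softmax w) fun i => norm_le_pi_norm v i

theorem abs_logSumExp_add_sub_linear_le [Nonempty ι] (w v : ι → ℝ) :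
    |logSumExp (w + v) - logSumExp w - ∑ i, softmax w i * v i| ≤ 60 * ‖v‖ ^ 2 := by
  rw [logSumExp_add, add_sub_cancel_left]
  exact abs_log_weighted_exp_sub_linear_le (softmax_nonneg w) (sum_softmax w)
    (fun i => norm_le_pi_norm v i) (norm_nonneg v)

theorem abs_logSumExp_add_sub_quadratic_le [Nonempty ι] (w v : ι → ℝ) :
    |logSumExp (w + v) - logSumExp w - (∑ i, softmax w i * v i)
      - ((∑ i, softmax w i * v i ^ 2) - (∑ i, softmax w i * v i) ^ 2) / 2| ≤ 50 * ‖v‖ ^ 3 := by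
  rw [logSumExp_add, add_sub_cancel_left]
  exact abs_log_weighted_exp_sub_quadratic_le (softmax_nonneg w) (sum_softmax w)
    (fun i => norm_le_pi_norm v i) (norm_nonneg v)

end LogSumExp

/-! ### Averaging over Gaussian translations -/

theorem abs_add_sub_le_norm {E : Type*} [SeminormedAddCommGroup E] {U : E → ℝ}
    (hU : LipschitzWith 1 U) (w v : E) : |U (w + v) - U w| ≤ ‖v‖ := by
  have := hU.dist_le_mul (w + v) w
  simpa [Real.dist_eq, dist_eq_norm] using this

theorem abs_add_le_abs_add_norm {E : Type*} [SeminormedAddCommGroup E] {U : E → ℝ}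
    (hU : LipschitzWith 1 U) (w v : E) :
    |U (w + v)| ≤ |U w| + ‖v‖ := by
  have h1 := abs_add_sub_le_norm hU w v
  have h2 := abs_sub_abs_le_abs_sub (U (w + v)) (U w)
  linarith

section Smear

variable {E : Type*} [NormedAddCommGroup E] [NormedSpace ℝ E] [MeasurableSpace E] [BorelSpace E]
  [SecondCountableTopology E] [CompleteSpace E]

/-- Fernique's theorem makes `exp (C ‖x‖²)` integrable for some `C > 0`, and completing the square
dominates the linear exponent. -/
theorem IsGaussian.integrable_exp_mul_norm (γ : Measure E) [IsGaussian γ] (c : ℝ) :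
    Integrable (fun x => Real.exp (c * ‖x‖)) γ := by
  obtain ⟨C, hC, hint⟩ := IsGaussian.exists_integrable_exp_sq γ
  refine (hint.const_mul (Real.exp (c ^ 2 / (4 * C)))).mono' (by fun_prop) (ae_of_all _ fun x => ?_)
  rw [Real.norm_eq_abs, Real.abs_exp, ← Real.exp_add]
  refine Real.exp_le_exp.2 ?_
  have h : c ^ 2 / (4 * C) + C * ‖x‖ ^ 2 - c * ‖x‖ = (c - 2 * C * ‖x‖) ^ 2 / (4 * C) := by
    field_simp; ring
  have : 0 ≤ (c - 2 * C * ‖x‖) ^ 2 / (4 * C) := by positivity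
  linarith

theorem pow_mul_exp_le {r a : ℝ} (n : ℕ) (hr : 0 ≤ r) :
    r ^ n * Real.exp (a * r) ≤ n.factorial * Real.exp ((a + 1) * r) := by
  have h := Real.pow_div_factorial_le_exp r hr n
  rw [div_le_iff₀ (by positivity)] at h
  calc r ^ n * Real.exp (a * r) ≤ (Real.exp r * n.factorial) * Real.exp (a * r) := by gcongr
    _ = n.factorial * Real.exp ((a + 1) * r) := by rw [add_mul, Real.exp_add, one_mul]; ring

theorem IsGaussian.integrable_norm_add_pow_mul_exp (γ : Measure E) [IsGaussian γ] (n : ℕ)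
    {a b : ℝ} (hb : 0 ≤ b) :
    Integrable (fun x => (‖x‖ + b) ^ n * Real.exp (a * (‖x‖ + b))) γ := by
  refine ((IsGaussian.integrable_exp_mul_norm γ (a + 1)).const_mul
    (n.factorial * Real.exp ((a + 1) * b))).mono' (by fun_prop) (ae_of_all _ fun x => ?_)
  rw [Real.norm_eq_abs, abs_of_nonneg (by positivity)]
  refine (pow_mul_exp_le n (by positivity)).trans (le_of_eq ?_)
  rw [mul_add, Real.exp_add]; ring

theorem IsGaussian.integrable_norm_add_pow (γ : Measure E) [IsGaussian γ] (n : ℕ)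
    {b : ℝ} (hb : 0 ≤ b) : Integrable (fun x => (‖x‖ + b) ^ n) γ := by
  simpa using IsGaussian.integrable_norm_add_pow_mul_exp γ n (a := 0) hb

theorem IsGaussian.integrable_norm_pow (γ : Measure E) [IsGaussian γ] (n : ℕ) :
    Integrable (fun x => ‖x‖ ^ n) γ := by
  simpa using IsGaussian.integrable_norm_add_pow γ n le_rfl

/-- The sum of two independent copies of a centered Gaussian vector is a dilated copy. -/
theorem IsGaussian.map_add_prod_self (γ : Measure E) [IsGaussian γ] (hγ : γ[id] = 0) :
    (γ.prod γ).map (fun p : E × E => p.1 + p.2) = γ.map (fun x => √2 • x) := by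
  -- The product `γ × γ` is invariant under rotations, and `x + y` is `√2` times the first
  -- coordinate after a rotation by `π / 4`.
  have h := IsGaussian.map_rotation_eq_self hγ (Real.pi / 4)
  have hf : (fun p : E × E => p.1 + p.2)
      = (fun p : E × E => √2 • p.1) ∘ (ContinuousLinearMap.rotation (Real.pi / 4)) := by
    ext p
    have h2 : √2 * (√2 / 2) = 1 := by
      rw [← mul_div_assoc, Real.mul_self_sqrt (by norm_num)]; norm_num
    simp [ContinuousLinearMap.rotation_apply, Real.cos_pi_div_four, Real.sin_pi_div_four, smul_add,
      smul_smul, h2]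
  rw [hf, ← Measure.map_map (by fun_prop) (by fun_prop), h]
  have : (fun p : E × E => √2 • p.1) = (fun x : E => √2 • x) ∘ Prod.fst := rfl
  rw [this, ← Measure.map_map (by fun_prop) (by fun_prop), Measure.map_fst_prod]
  simp

/-- The average of `U` over a translation by a Gaussian vector with covariance `h` times that of
`γ` and mean `h • m`. -/
noncomputable def smear (γ : Measure E) (m : E) (h : ℝ) (U : E → ℝ) (w : E) : ℝ :=
  ∫ x, U (w + (√h • x + h • m)) ∂γ

variable {γ δ : Measure E} {m m' w : E} {h h' : ℝ} {U V : E → ℝ}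

variable [IsGaussian γ] [IsGaussian δ]

theorem integrable_norm_shift (γ : Measure E) [IsGaussian γ] (m : E) (h : ℝ) :
    Integrable (fun x => ‖√h • x + h • m‖) γ := by
  have h1 : Integrable (fun x : E => √h • x + h • m) γ :=
    ((IsGaussian.integrable_fun_id (μ := γ)).smul (√h)).add (integrable_const _)
  exact h1.norm

theorem integrable_smear (hU : LipschitzWith 1 U) (w : E) :
    Integrable (fun x => U (w + (√h • x + h • m))) γ := by
  have hc := hU.continuous
  refine ((integrable_const |U w|).add (integrable_norm_shift γ m h)).mono'
    (by fun_prop) (ae_of_all _ fun x => ?_)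
  exact abs_add_le_abs_add_norm hU _ _

theorem LipschitzWith.smear (hU : LipschitzWith 1 U) : LipschitzWith 1 (smear γ m h U) := by
  refine LipschitzWith.of_dist_le_mul fun w w' => ?_
  rw [Real.dist_eq, dist_eq_norm, NNReal.coe_one, one_mul]
  unfold _root_.smear
  rw [← integral_sub (integrable_smear hU w) (integrable_smear hU w')]
  refine (abs_integral_le_integral_abs).trans ?_
  have : ∫ _ : E, ‖w - w'‖ ∂γ = ‖w - w'‖ := by simp
  rw [← this]
  refine integral_mono_of_nonneg (ae_of_all _ fun x => abs_nonneg _) (integrable_const _)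
    (ae_of_all _ fun x => ?_)
  have h1 := abs_add_sub_le_norm hU (w' + (√h • x + h • m)) (w - w')
  have e : w' + (√h • x + h • m) + (w - w') = w + (√h • x + h • m) := by abel
  rwa [e] at h1

theorem smear_mono (hU : LipschitzWith 1 U) (hV : LipschitzWith 1 V) {c : ℝ}
    (hUV : ∀ w, U w ≤ V w + c) (w : E) : smear γ m h U w ≤ smear γ m h V w + c := by
  have e : smear γ m h V w + c = ∫ x, (V (w + (√h • x + h • m)) + c) ∂γ := by
    rw [integral_add (integrable_smear hV w) (integrable_const c)]; simp [smear]
  rw [e]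
  exact integral_mono (integrable_smear hU w) ((integrable_smear hV w).add (integrable_const c))
    fun x => hUV _

theorem smear_comm (hU : LipschitzWith 1 U) (w : E) :
    smear γ m h (smear δ m' h' U) w = smear δ m' h' (smear γ m h U) w := by
  have hc := hU.continuous
  unfold smear
  rw [integral_integral_swap]
  · refine integral_congr_ae (ae_of_all _ fun y => integral_congr_ae (ae_of_all _ fun x => ?_))
    simp only
    congr 1; abel
  · refine ((integrable_const |U w|).add (((integrable_norm_shift γ m h).comp_fst δ).add
      ((integrable_norm_shift δ m' h').comp_snd γ))).mono' (by fun_prop)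
      (ae_of_all _ fun p => ?_)
    simp only [Function.uncurry, Pi.add_apply]
    rw [add_assoc]
    exact (abs_add_le_abs_add_norm hU _ _).trans (by gcongr; exact norm_add_le _ _)

/-- The semigroup law, needed only for equal times: two independent displacements of scale `√h` add
up to one of scale `√(2h)`, and the drifts add. Integrability is assumed at time `2h` alone, so that
the law applies to `exp (l U)` as well as to Lipschitz functions. -/
theorem smear_smear_self (hγ : γ[id] = 0) (hU : Continuous U) (hh : 0 ≤ h)
    (hint : Integrable (fun x => U (w + (√(2 * h) • x + (2 * h) • m))) γ) :
    smear γ m h (smear γ m h U) w = smear γ m (2 * h) U w := by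
  set G : E → ℝ := fun z => U (w + (√h • z + (2 * h) • m)) with hG
  have hGc : Continuous G := by fun_prop
  have e1 : ∀ x, G (√2 • x) = U (w + (√(2 * h) • x + (2 * h) • m)) := fun x => by
    simp only [hG]
    rw [smul_smul, ← Real.sqrt_mul hh, mul_comm h 2]
  have hmap := IsGaussian.map_add_prod_self γ hγ
  have hi : Integrable G ((γ.prod γ).map (fun p : E × E => p.1 + p.2)) := by
    rw [hmap, integrable_map_measure hGc.aestronglyMeasurable (by fun_prop)]
    exact hint.congr (ae_of_all _ fun x => (e1 x).symm)
  have e2 : ∫ z, G z ∂((γ.prod γ).map (fun p : E × E => p.1 + p.2)) = smear γ m (2 * h) U w := by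
    rw [hmap, integral_map (by fun_prop) hGc.aestronglyMeasurable]
    exact integral_congr_ae (ae_of_all _ e1)
  rw [← e2, integral_map (by fun_prop) hGc.aestronglyMeasurable, integral_prod]
  · unfold smear
    refine integral_congr_ae (ae_of_all _ fun x => integral_congr_ae (ae_of_all _ fun y => ?_))
    simp only [hG]
    congr 1
    rw [smul_add, two_mul, add_smul]; abel
  · exact (integrable_map_measure hGc.aestronglyMeasurable (by fun_prop)).1 hi

/-- If a comparison of two Gaussian averages holds at scale `h` with error `e`, it holds at
scale `2 h` with error `2 e`. -/
theorem smear_le_smear_two_mul (hγ : γ[id] = 0) (hδ : δ[id] = 0) (hU : LipschitzWith 1 U)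
    (hh : 0 ≤ h) {e : ℝ} (hle : ∀ w, smear δ m' h U w ≤ smear γ m h U w + e) (w : E) :
    smear δ m' (2 * h) U w ≤ smear γ m (2 * h) U w + 2 * e := by
  rw [← smear_smear_self hγ hU.continuous hh (integrable_smear hU w),
    ← smear_smear_self hδ hU.continuous hh (integrable_smear hU w)]
  -- The two averages are exchanged one at a time: `δδ ≤ δγ + e = γδ + e ≤ γγ + 2e`, the equality
  -- being Fubini.
  have h1 := smear_mono (γ := δ) (m := m') (h := h) hU.smear hU.smear hle w
  have h2 := smear_mono (γ := γ) (m := m) (h := h) hU.smear hU.smear hle w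
  rw [smear_comm hU] at h2
  linarith

/-- This replaces integration of a derivative in time: with `h = 2^(-n)`, a local error `c h + o(h)`
becomes `c + o(1)` at time one. -/
theorem smear_le_smear_two_pow_mul (hγ : γ[id] = 0) (hδ : δ[id] = 0) (hU : LipschitzWith 1 U)
    (hh : 0 ≤ h) {e : ℝ} (hle : ∀ w, smear δ m' h U w ≤ smear γ m h U w + e) (n : ℕ) (w : E) :
    smear δ m' (2 ^ n * h) U w ≤ smear γ m (2 ^ n * h) U w + 2 ^ n * e := by
  induction n generalizing w with
  | zero => simpa using hle w
  | succ n ih =>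
    have := smear_le_smear_two_mul hγ hδ hU (by positivity) ih w
    simpa only [pow_succ', mul_assoc] using this

end Smear

/-! ### Comparison of Gaussian averages of log-sum-exp -/

section Comparison

variable {ι : Type*} [Fintype ι]

theorem IsGaussian.integrable_coord (γ : Measure (ι → ℝ)) [IsGaussian γ] (i : ι) :
    Integrable (fun x : ι → ℝ => x i) γ :=
  (IsGaussian.integrable_norm_pow γ 1).mono'
    (measurable_pi_apply i).aestronglyMeasurable (ae_of_all _ fun x => by
    rw [pow_one]; exact norm_le_pi_norm x i)

theorem IsGaussian.integrable_coord_mul (γ : Measure (ι → ℝ)) [IsGaussian γ] (i j : ι) :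
    Integrable (fun x : ι → ℝ => x i * x j) γ :=
  (IsGaussian.integrable_norm_pow γ 2).mono' (by fun_prop) (ae_of_all _ fun x => by
    rw [norm_mul, pow_two]
    exact mul_le_mul (norm_le_pi_norm x i) (norm_le_pi_norm x j) (norm_nonneg _) (norm_nonneg _))

theorem IsGaussian.integral_coord_eq_zero {γ : Measure (ι → ℝ)} [IsGaussian γ]
    (hγ : γ[id] = 0) (i : ι) :
    ∫ x, x i ∂γ = 0 := by
  have h := (ContinuousLinearMap.proj (R := ℝ) (φ := fun _ : ι => ℝ) i).integral_comp_comm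
    (IsGaussian.integrable_id (μ := γ))
  rw [hγ, map_zero] at h
  exact h

theorem IsGaussian.integrable_weighted_sq (γ : Measure (ι → ℝ)) [IsGaussian γ] (p : ι → ℝ) :
    Integrable (fun x : ι → ℝ => (∑ i, p i * x i) ^ 2) γ := by
  have : (fun x : ι → ℝ => (∑ i, p i * x i) ^ 2)
      = fun x => ∑ i, ∑ j, p i * p j * (x i * x j) := by
    ext x
    rw [pow_two, Finset.sum_mul_sum]
    exact Finset.sum_congr rfl fun i _ => Finset.sum_congr rfl fun j _ => by ring
  rw [this]
  exact integrable_finsetSum _ fun i _ => integrable_finsetSum _ fun j _ =>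
    (IsGaussian.integrable_coord_mul γ i j).const_mul _

theorem IsGaussian.integral_weighted_sq (γ : Measure (ι → ℝ)) [IsGaussian γ] (p : ι → ℝ) :
    ∫ x, (∑ i, p i * x i) ^ 2 ∂γ = ∑ i, ∑ j, p i * p j * ∫ x, x i * x j ∂γ := by
  have : ∀ x : ι → ℝ, (∑ i, p i * x i) ^ 2 = ∑ i, ∑ j, p i * p j * (x i * x j) := by
    intro x
    rw [pow_two, Finset.sum_mul_sum]
    exact Finset.sum_congr rfl fun i _ => Finset.sum_congr rfl fun j _ => by ring
  simp_rw [this]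
  rw [integral_finsetSum _ fun i _ => integrable_finsetSum _ fun j _ =>
    (IsGaussian.integrable_coord_mul γ i j).const_mul _]
  refine Finset.sum_congr rfl fun i _ => ?_
  rw [integral_finsetSum _ fun j _ => (IsGaussian.integrable_coord_mul γ i j).const_mul _]
  exact Finset.sum_congr rfl fun j _ => integral_const_mul _ _

variable [Nonempty ι]

theorem lipschitzWith_logSumExp : LipschitzWith 1 (logSumExp : (ι → ℝ) → ℝ) := by
  refine LipschitzWith.of_dist_le_mul fun w w' => ?_
  rw [Real.dist_eq, dist_eq_norm, NNReal.coe_one, one_mul]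
  simpa using abs_logSumExp_add_sub_le w' (w - w')

/-- The quadratic expansion at displacement `√h x + h m`, keeping terms up to order `h`. The
remainder is of order `h^(3/2)` uniformly in `w`, with a factor polynomial in `‖x‖` and hence
Gaussian integrable. -/
theorem abs_smear_integrand_sub_le (w m x : ι → ℝ) {h : ℝ} (h0 : 0 ≤ h) (h1 : h ≤ 1) :
    |logSumExp (w + (√h • x + h • m)) - logSumExp w
      - (√h * (∑ i, softmax w i * x i) + h * (∑ i, softmax w i * m i)
        + h * ((∑ i, softmax w i * x i ^ 2) - (∑ i, softmax w i * x i) ^ 2) / 2)|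
      ≤ h * √h * (50 * (‖x‖ + ‖m‖) ^ 3 + (‖x‖ + ‖m‖) ^ 2) := by
  set p := softmax w
  set v := √h • x + h • m with hv
  have hs0 : 0 ≤ √h := Real.sqrt_nonneg h
  have hss : √h * √h = h := Real.mul_self_sqrt h0
  have hs1 : √h ≤ 1 := by simpa using Real.sqrt_le_sqrt h1
  have hhs : h ≤ √h := by nlinarith
  have hhh : h * h ≤ h * √h := mul_le_mul_of_nonneg_left hhs h0
  have hnv : ‖v‖ ≤ √h * (‖x‖ + ‖m‖) := by
    refine (norm_add_le _ _).trans ?_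
    rw [norm_smul, norm_smul, Real.norm_eq_abs, Real.norm_eq_abs, abs_of_nonneg hs0,
      abs_of_nonneg h0, mul_add]
    gcongr
  have hv3 : ‖v‖ ^ 3 ≤ h * √h * (‖x‖ + ‖m‖) ^ 3 := by
    calc ‖v‖ ^ 3 ≤ (√h * (‖x‖ + ‖m‖)) ^ 3 := pow_le_pow_left₀ (norm_nonneg _) hnv 3
      _ = (√h * √h) * √h * (‖x‖ + ‖m‖) ^ 3 := by ring
      _ = _ := by rw [hss]
  have hq := abs_logSumExp_add_sub_quadratic_le w v
  have e1 : ∑ i, p i * v i = √h * (∑ i, p i * x i) + h * ∑ i, p i * m i := by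
    simp only [hv, Pi.add_apply, Pi.smul_apply, smul_eq_mul, Finset.mul_sum,
      ← Finset.sum_add_distrib]
    exact Finset.sum_congr rfl fun i _ => by ring
  have e2 : ∑ i, p i * v i ^ 2 = h * (∑ i, p i * x i ^ 2)
      + 2 * (h * √h) * (∑ i, p i * (x i * m i)) + h * h * ∑ i, p i * m i ^ 2 := by
    simp only [hv, Pi.add_apply, Pi.smul_apply, smul_eq_mul, Finset.mul_sum,
      ← Finset.sum_add_distrib]
    refine Finset.sum_congr rfl fun i _ => ?_
    calc p i * (√h * x i + h * m i) ^ 2 = (√h * √h) * (p i * x i ^ 2)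
          + 2 * (h * √h) * (p i * (x i * m i)) + h * h * (p i * m i ^ 2) := by ring
      _ = _ := by rw [hss]
  have hp0 := softmax_nonneg w
  have hp1 := sum_softmax w
  have bx : ∀ i, |x i| ≤ ‖x‖ := fun i => norm_le_pi_norm x i
  have bm : ∀ i, |m i| ≤ ‖m‖ := fun i => norm_le_pi_norm m i
  have hAx : |∑ i, p i * x i| ≤ ‖x‖ := abs_weighted_sum_le hp0 hp1 bx
  have hAm : |∑ i, p i * m i| ≤ ‖m‖ := abs_weighted_sum_le hp0 hp1 bm
  have hC : |∑ i, p i * (x i * m i)| ≤ ‖x‖ * ‖m‖ := abs_weighted_sum_le hp0 hp1 fun i => by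
    rw [abs_mul]; exact mul_le_mul (bx i) (bm i) (abs_nonneg _) (norm_nonneg _)
  have hBm : |∑ i, p i * m i ^ 2| ≤ ‖m‖ ^ 2 := abs_weighted_sum_le hp0 hp1 fun i => by
    rw [abs_pow]; exact pow_le_pow_left₀ (abs_nonneg _) (bm i) 2
  rw [e1, e2] at hq
  set Ax := ∑ i, p i * x i
  set Am := ∑ i, p i * m i
  set C := ∑ i, p i * (x i * m i)
  set Bm := ∑ i, p i * m i ^ 2
  set Bx := ∑ i, p i * x i ^ 2
  -- What the drift adds to half the variance of the displacement under the weights: the covariance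
  -- of `x` and `m`, at order `h^(3/2)`, and the variance of `m`, at order `h²`.
  have hR : |(h * √h) * (C - Ax * Am) + h * h * ((Bm - Am ^ 2) / 2)|
      ≤ h * √h * (‖x‖ + ‖m‖) ^ 2 := by
    have hk : 0 ≤ h * √h := mul_nonneg h0 hs0
    have hAA : |Ax * Am| ≤ ‖x‖ * ‖m‖ := by
      rw [abs_mul]; exact mul_le_mul hAx hAm (abs_nonneg _) (norm_nonneg _)
    have i1 : |C - Ax * Am| ≤ 2 * (‖x‖ * ‖m‖) := (abs_sub _ _).trans (by linarith)
    have hAm2 : Am ^ 2 ≤ ‖m‖ ^ 2 := by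
      rw [← sq_abs]; exact pow_le_pow_left₀ (abs_nonneg _) hAm 2
    have i2 : |(Bm - Am ^ 2) / 2| ≤ ‖m‖ ^ 2 := by
      obtain ⟨b1, b2⟩ := abs_le.1 hBm
      have := sq_nonneg Am
      rw [abs_le]; constructor <;> linarith
    calc _ ≤ |(h * √h) * (C - Ax * Am)| + |h * h * ((Bm - Am ^ 2) / 2)| := abs_add_le _ _
      _ ≤ (h * √h) * (2 * (‖x‖ * ‖m‖)) + (h * √h) * ‖m‖ ^ 2 := by
          rw [abs_mul (h * √h), abs_mul (h * h), abs_of_nonneg hk, abs_of_nonneg (mul_nonneg h0 h0)]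
          gcongr
      _ = h * √h * (2 * (‖x‖ * ‖m‖) + ‖m‖ ^ 2) := by ring
      _ ≤ h * √h * (‖x‖ + ‖m‖) ^ 2 := by
          refine mul_le_mul_of_nonneg_left ?_ hk
          nlinarith [sq_nonneg ‖x‖]
  have key : logSumExp (w + v) - logSumExp w - (√h * Ax + h * Am + h * (Bx - Ax ^ 2) / 2)
      = (logSumExp (w + v) - logSumExp w - (√h * Ax + h * Am) - (h * Bx + 2 * (h * √h) * C
          + h * h * Bm - (√h * Ax + h * Am) ^ 2) / 2)
        + ((h * √h) * (C - Ax * Am) + h * h * ((Bm - Am ^ 2) / 2)) := by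
    have : (√h * Ax + h * Am) ^ 2
        = h * Ax ^ 2 + 2 * (h * √h) * (Ax * Am) + h * h * Am ^ 2 := by
      calc _ = (√h * √h) * Ax ^ 2 + 2 * (h * √h) * (Ax * Am) + h * h * Am ^ 2 := by ring
        _ = _ := by rw [hss]
    rw [this]; ring
  rw [key]
  refine (abs_add_le _ _).trans ?_
  have : 50 * ‖v‖ ^ 3 ≤ 50 * (h * √h * (‖x‖ + ‖m‖) ^ 3) := by gcongr
  linarith

variable {γ δ : Measure (ι → ℝ)} [IsGaussian γ] [IsGaussian δ]

/-- Short time expansion of the Gaussian average of log-sum-exp. -/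
theorem exists_abs_smear_logSumExp_sub_le (hγ : γ[id] = 0) (m : ι → ℝ) :
    ∃ K, ∀ h, 0 ≤ h → h ≤ 1 → ∀ w : ι → ℝ,
      |smear γ m h logSumExp w - logSumExp w
        - h * ((∑ i, softmax w i * (m i + (∫ x, x i * x i ∂γ) / 2))
          - (∑ i, ∑ j, softmax w i * softmax w j * ∫ x, x i * x j ∂γ) / 2)| ≤ K * (h * √h) := by
  refine ⟨∫ x, (50 * (‖x‖ + ‖m‖) ^ 3 + (‖x‖ + ‖m‖) ^ 2) ∂γ, fun h h0 h1 w => ?_⟩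
  set p := softmax w with hp
  have hiA : Integrable (fun x : ι → ℝ => ∑ i, p i * x i) γ :=
    integrable_finsetSum _ fun i _ => (IsGaussian.integrable_coord γ i).const_mul _
  have hiB : Integrable (fun x : ι → ℝ => ∑ i, p i * x i ^ 2) γ :=
    integrable_finsetSum _ fun i _ => by
      simpa only [pow_two] using (IsGaussian.integrable_coord_mul γ i i).const_mul _
  have hiA2 := IsGaussian.integrable_weighted_sq γ p
  have eA : ∫ x, ∑ i, p i * x i ∂γ = 0 := by
    rw [integral_finsetSum _ fun i _ => (IsGaussian.integrable_coord γ i).const_mul _]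
    refine Finset.sum_eq_zero fun i _ => ?_
    rw [integral_const_mul, IsGaussian.integral_coord_eq_zero hγ, mul_zero]
  have eB : ∫ x, ∑ i, p i * x i ^ 2 ∂γ = ∑ i, p i * ∫ x, x i * x i ∂γ := by
    simp only [pow_two]
    rw [integral_finsetSum _ fun i _ => (IsGaussian.integrable_coord_mul γ i i).const_mul _]
    exact Finset.sum_congr rfl fun i _ => integral_const_mul _ _
  set J : (ι → ℝ) → ℝ := fun x => √h * (∑ i, p i * x i) + h * (∑ i, p i * m i)
        + h * ((∑ i, p i * x i ^ 2) - (∑ i, p i * x i) ^ 2) / 2 with hJ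
  have hiJ1 : Integrable (fun x : ι → ℝ => √h * (∑ i, p i * x i) + h * (∑ i, p i * m i)) γ :=
    (hiA.const_mul _).add (integrable_const _)
  have hiJ2 : Integrable (fun x : ι → ℝ =>
      h * ((∑ i, p i * x i ^ 2) - (∑ i, p i * x i) ^ 2) / 2) γ :=
    ((hiB.sub hiA2).const_mul _).div_const _
  have hiJ : Integrable J γ := hiJ1.add hiJ2
  have eJ : ∫ x, J x ∂γ = h * ((∑ i, p i * (m i + (∫ x, x i * x i ∂γ) / 2))
          - (∑ i, ∑ j, p i * p j * ∫ x, x i * x j ∂γ) / 2) := by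
    simp only [hJ]
    rw [integral_add hiJ1 hiJ2, integral_add (hiA.const_mul _) (integrable_const _),
      integral_const_mul, eA, integral_div, integral_const_mul _ (fun x : ι → ℝ =>
        (∑ i, p i * x i ^ 2) - (∑ i, p i * x i) ^ 2), integral_sub hiB hiA2, eB,
      IsGaussian.integral_weighted_sq]
    simp only [integral_const, probReal_univ, mul_add, Finset.sum_add_distrib, smul_eq_mul,
      ← mul_div_assoc, ← Finset.sum_div]
    ring
  have hi := integrable_smear (γ := γ) (m := m) (h := h) lipschitzWith_logSumExp w
  have hi' : Integrable (fun x => logSumExp (w + (√h • x + h • m)) - logSumExp w) γ :=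
    hi.sub (integrable_const _)
  have e : smear γ m h logSumExp w - logSumExp w
        - h * ((∑ i, p i * (m i + (∫ x, x i * x i ∂γ) / 2))
          - (∑ i, ∑ j, p i * p j * ∫ x, x i * x j ∂γ) / 2)
      = ∫ x, (logSumExp (w + (√h • x + h • m)) - logSumExp w - J x) ∂γ := by
    rw [integral_sub hi' hiJ, integral_sub hi (integrable_const _), eJ]
    simp [smear]
  rw [e, mul_comm _ (h * √h), ← integral_const_mul]
  refine abs_integral_le_integral_abs.trans ?_
  refine integral_mono (hi'.sub hiJ).abs ?_ fun x =>
    abs_smear_integrand_sub_le w m x h0 h1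
  exact (((IsGaussian.integrable_norm_add_pow γ 3 (norm_nonneg m)).const_mul 50).add
    (IsGaussian.integrable_norm_add_pow γ 2 (norm_nonneg m))).const_mul _

/-- Gaussian comparison: decreasing the covariances, at constant (or increasing) mean plus half
variance, increases the average of log-sum-exp. -/
theorem integral_logSumExp_le_of_covariance_le (hγ : γ[id] = 0) (hδ : δ[id] = 0)
    {m m' : ι → ℝ} {D : ℝ}
    (hdiag : ∀ i, m' i + (∫ x, x i * x i ∂δ) / 2 ≤ m i + (∫ x, x i * x i ∂γ) / 2)
    (hoff : ∀ i j, ∫ x, x i * x j ∂γ ≤ (∫ x, x i * x j ∂δ) + D) :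
    ∫ x, logSumExp (x + m') ∂δ ≤ (∫ x, logSumExp (x + m) ∂γ) + D / 2 := by
  obtain ⟨K, hK⟩ := exists_abs_smear_logSumExp_sub_le hγ m
  obtain ⟨K', hK'⟩ := exists_abs_smear_logSumExp_sub_le hδ m'
  -- At first order in `h`, the diagonal data enter with weights `p i ≥ 0` and the full covariance
  -- matrix with weights `-p i p j / 2 ≤ 0`. The two hypotheses therefore act separately, and `D`
  -- costs exactly `D / 2` because the weights sum to one.
  have hstep : ∀ h, 0 ≤ h → h ≤ 1 → ∀ w : ι → ℝ,
      smear δ m' h logSumExp w ≤ smear γ m h logSumExp w + (h * (D / 2) + (K + K') * (h * √h)) := by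
    intro h h0 h1 w
    obtain ⟨a1, -⟩ := abs_le.1 (hK h h0 h1 w)
    obtain ⟨-, b2⟩ := abs_le.1 (hK' h h0 h1 w)
    have hp0 := softmax_nonneg w
    have hp1 := sum_softmax w
    set p := softmax w
    have c1 : ∑ i, p i * (m' i + (∫ x, x i * x i ∂δ) / 2)
        ≤ ∑ i, p i * (m i + (∫ x, x i * x i ∂γ) / 2) :=
      Finset.sum_le_sum fun i _ => mul_le_mul_of_nonneg_left (hdiag i) (hp0 i)
    have c2 : ∑ i, ∑ j, p i * p j * ∫ x, x i * x j ∂γ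
        ≤ (∑ i, ∑ j, p i * p j * ∫ x, x i * x j ∂δ) + D := by
      calc _ ≤ ∑ i, ∑ j, p i * p j * ((∫ x, x i * x j ∂δ) + D) :=
            Finset.sum_le_sum fun i _ => Finset.sum_le_sum fun j _ =>
              mul_le_mul_of_nonneg_left (hoff i j) (mul_nonneg (hp0 i) (hp0 j))
        _ = _ := by
            simp only [mul_add, Finset.sum_add_distrib]
            congr 1
            simp only [← Finset.sum_mul, ← Finset.mul_sum, hp1, mul_one, one_mul]
    have c3 := mul_le_mul_of_nonneg_left
      (show (∑ i, p i * (m' i + (∫ x, x i * x i ∂δ) / 2))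
          - (∑ i, ∑ j, p i * p j * ∫ x, x i * x j ∂δ) / 2
        ≤ ((∑ i, p i * (m i + (∫ x, x i * x i ∂γ) / 2))
          - (∑ i, ∑ j, p i * p j * ∫ x, x i * x j ∂γ) / 2) + D / 2 by linarith) h0
    linarith
  have hlim : Tendsto (fun n : ℕ => (∫ x, logSumExp (x + m) ∂γ)
      + (D / 2 + (K + K') * √((1 / 2 : ℝ) ^ n))) atTop
      (𝓝 ((∫ x, logSumExp (x + m) ∂γ) + (D / 2 + (K + K') * √0))) := by
    refine tendsto_const_nhds.add (tendsto_const_nhds.add (tendsto_const_nhds.mul ?_))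
    exact (Real.continuous_sqrt.tendsto 0).comp
      (tendsto_pow_atTop_nhds_zero_of_lt_one (by norm_num) (by norm_num))
  simp only [Real.sqrt_zero, mul_zero, add_zero] at hlim
  -- Starting at `h = 2^(-n)`, `n` doublings reach time one, and the error terms `(K + K') h √h` add
  -- up to `(K + K') √(2^(-n))`.
  refine ge_of_tendsto' hlim fun n => ?_
  have h0 : (0 : ℝ) ≤ (1 / 2) ^ n := by positivity
  have h1 : ((1 : ℝ) / 2) ^ n ≤ 1 := pow_le_one₀ (by norm_num) (by norm_num)
  have h2 : (2 : ℝ) ^ n * (1 / 2) ^ n = 1 := by rw [← mul_pow]; norm_num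
  have := smear_le_smear_two_pow_mul hγ hδ lipschitzWith_logSumExp h0 (hstep _ h0 h1) n 0
  rw [h2] at this
  simp only [smear, Real.sqrt_one, one_smul, zero_add] at this
  refine this.trans (le_of_eq ?_)
  congr 1
  calc (2 : ℝ) ^ n * ((1 / 2) ^ n * (D / 2) + (K + K') * ((1 / 2) ^ n * √((1 / 2 : ℝ) ^ n)))
      = (2 ^ n * (1 / 2) ^ n) * (D / 2)
        + (K + K') * ((2 ^ n * (1 / 2) ^ n) * √((1 / 2 : ℝ) ^ n)) := by ring
    _ = _ := by rw [h2]; ring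

end Comparison

/-! ### Gaussian concentration of log-sum-exp -/

/-- For `|x| > 1` the last term alone dominates `exp x`, and the quadratic polynomial is positive.
-/
theorem exp_le_quadratic_add_cubic (x : ℝ) :
    Real.exp x ≤ 1 + x + x ^ 2 / 2 + |x| ^ 3 * Real.exp |x| := by
  have h3 : 0 ≤ |x| ^ 3 := by positivity
  by_cases h1 : |x| ≤ 1
  · have h := (abs_le.1 (abs_exp_sub_quadratic_le h1)).2
    have := mul_le_mul_of_nonneg_left (Real.one_le_exp (abs_nonneg x)) h3
    linarith
  · have h1' := not_le.1 h1
    have h2 : 1 ≤ |x| ^ 3 := one_le_pow₀ h1'.le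
    have h4 : Real.exp x ≤ Real.exp |x| := Real.exp_le_exp.2 (le_abs_self x)
    have h5 := mul_le_mul_of_nonneg_right h2 (Real.exp_pos |x|).le
    nlinarith [sq_nonneg (x + 1)]

theorem sq_integral_le_integral_sq {α : Type*} [MeasurableSpace α] {μ : Measure α}
    [IsProbabilityMeasure μ] {Y : α → ℝ} (h1 : Integrable Y μ)
    (h2 : Integrable (fun x => Y x ^ 2) μ) :
    (∫ x, Y x ∂μ) ^ 2 ≤ ∫ x, Y x ^ 2 ∂μ := by
  have h0 : 0 ≤ ∫ x, (Y x - ∫ y, Y y ∂μ) ^ 2 ∂μ := integral_nonneg fun x => sq_nonneg _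
  set a := ∫ y, Y y ∂μ with ha
  have e : ∀ x, (Y x - a) ^ 2 = (Y x ^ 2 - 2 * a * Y x) + a ^ 2 := fun x => by ring
  simp_rw [e] at h0
  have h3 : Integrable (fun x => Y x ^ 2 - 2 * a * Y x) μ := h2.sub (h1.const_mul _)
  rw [integral_add h3 (integrable_const _), integral_sub h2 (h1.const_mul _),
    integral_const_mul] at h0
  simp only [integral_const, probReal_univ, one_smul, ← ha] at h0
  linarith

/-! ### Exponential moments of Lipschitz functions along the doubling -/

section Concentration

variable {E : Type*} [NormedAddCommGroup E] [NormedSpace ℝ E] [MeasurableSpace E] [BorelSpace E]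
  [SecondCountableTopology E] [CompleteSpace E]
  {γ : Measure E} [IsGaussian γ] {U : E → ℝ} {h : ℝ}

theorem integrable_exp_smear (hU : LipschitzWith 1 U) (l : ℝ) (m w : E) :
    Integrable (fun x => Real.exp (l * U (w + (√h • x + h • m)))) γ := by
  have hc := hU.continuous
  refine ((IsGaussian.integrable_exp_mul_norm γ (|l| * √h)).const_mul
    (Real.exp (|l| * (|U w| + ‖h • m‖)))).mono' (by fun_prop) (ae_of_all _ fun x => ?_)
  rw [Real.norm_eq_abs, Real.abs_exp, ← Real.exp_add]
  refine Real.exp_le_exp.2 ?_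
  have h1 := abs_add_le_abs_add_norm hU w (√h • x + h • m)
  have h2 := norm_add_le (√h • x) (h • m)
  rw [norm_smul, Real.norm_eq_abs, abs_of_nonneg (Real.sqrt_nonneg h)] at h2
  calc l * U (w + (√h • x + h • m)) ≤ |l| * |U (w + (√h • x + h • m))| := by
        rw [← abs_mul]; exact le_abs_self _
    _ ≤ |l| * (|U w| + (√h * ‖x‖ + ‖h • m‖)) := by gcongr; linarith
    _ = _ := by ring

/-- Exponential moment bound for a small Gaussian displacement. -/
theorem smear_exp_le_of_sq_le (hU : LipschitzWith 1 U) (l : ℝ) (h0 : 0 ≤ h) {s : ℝ} (w : E)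
    (hs : ∫ x, (U (w + √h • x) - U w) ^ 2 ∂γ ≤ s) :
    smear γ 0 h (fun z => Real.exp (l * U z)) w ≤ Real.exp (l * smear γ 0 h U w
      + (l ^ 2 * s / 2 + (|l| ^ 3 * ∫ x, (‖x‖ + ∫ y, ‖y‖ ∂γ) ^ 3
        * Real.exp ((|l| * √h) * (‖x‖ + ∫ y, ‖y‖ ∂γ)) ∂γ) * (h * √h))) := by
  have hc := hU.continuous
  have hs0 : 0 ≤ √h := Real.sqrt_nonneg h
  have hss : √h * √h = h := Real.mul_self_sqrt h0
  set c := ∫ y, ‖y‖ ∂γ with hcdef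
  have hc0 : 0 ≤ c := integral_nonneg fun y => norm_nonneg y
  have hi : Integrable (fun x => U (w + √h • x)) γ := by
    simpa using integrable_smear (γ := γ) (m := 0) (h := h) hU w
  have hin : Integrable (fun x : E => ‖x‖) γ := by
    simpa using IsGaussian.integrable_norm_pow γ 1
  set a := smear γ 0 h U w with ha
  have ha' : ∫ x, U (w + √h • x) ∂γ = a := by simp [ha, smear]
  have hd : ∀ x, |U (w + √h • x) - U w| ≤ √h * ‖x‖ := fun x => by
    refine (abs_add_sub_le_norm hU _ _).trans ?_
    rw [norm_smul, Real.norm_eq_abs, abs_of_nonneg hs0]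
  have haU : |a - U w| ≤ √h * c := by
    have e : a - U w = ∫ x, (U (w + √h • x) - U w) ∂γ := by
      rw [integral_sub hi (integrable_const _), ha']; simp
    rw [e, hcdef, ← integral_const_mul]
    exact abs_integral_le_integral_abs.trans
      (integral_mono (hi.sub (integrable_const _)).abs (hin.const_mul _) hd)
  -- Centring at the mean `a` removes the linear term of the exponential expansion and can only
  -- decrease the second moment relative to centring at `U w`.
  set Y : E → ℝ := fun x => U (w + √h • x) - a with hY
  have hYb : ∀ x, |Y x| ≤ √h * (‖x‖ + c) := fun x => by
    have e : Y x = (U (w + √h • x) - U w) - (a - U w) := by simp only [hY]; ring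
    rw [e]
    refine (abs_sub _ _).trans ?_
    rw [mul_add]
    exact add_le_add (hd x) haU
  have hYc : Continuous Y := by fun_prop
  have hiY : Integrable Y γ := hi.sub (integrable_const _)
  have hdi : Integrable (fun x => U (w + √h • x) - U w) γ := hi.sub (integrable_const _)
  have hiY2 : Integrable (fun x => Y x ^ 2) γ := by
    refine ((IsGaussian.integrable_norm_add_pow γ 2 hc0).const_mul h).mono' (by fun_prop)
      (ae_of_all _ fun x => ?_)
    rw [norm_pow, Real.norm_eq_abs]
    calc |Y x| ^ 2 ≤ (√h * (‖x‖ + c)) ^ 2 := pow_le_pow_left₀ (abs_nonneg _) (hYb x) 2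
      _ = (√h * √h) * (‖x‖ + c) ^ 2 := by ring
      _ = _ := by rw [hss]
  have eY : ∫ x, Y x ∂γ = 0 := by
    simp only [hY]; rw [integral_sub hi (integrable_const _), ha']; simp
  have eY2 : ∫ x, Y x ^ 2 ∂γ ≤ s := by
    refine le_trans ?_ hs
    have e : ∀ x, (U (w + √h • x) - U w) ^ 2
        = Y x ^ 2 + 2 * (a - U w) * Y x + (a - U w) ^ 2 := fun x => by simp only [hY]; ring
    simp_rw [e]
    have hiYY : Integrable (fun x => Y x ^ 2 + 2 * (a - U w) * Y x) γ :=
      hiY2.add (hiY.const_mul _)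
    rw [integral_add hiYY (integrable_const _), integral_add hiY2 (hiY.const_mul _),
      integral_const_mul, eY]
    have := sq_nonneg (a - U w)
    simpa using this
  have hiK := IsGaussian.integrable_norm_add_pow_mul_exp γ 3 (a := |l| * √h) hc0
  set κ : E → ℝ := fun x => (‖x‖ + c) ^ 3 * Real.exp ((|l| * √h) * (‖x‖ + c)) with hκ
  have hpt : ∀ x, Real.exp (l * Y x)
      ≤ 1 + l * Y x + (l ^ 2 / 2) * Y x ^ 2 + (|l| ^ 3 * (h * √h)) * κ x := fun x => by
    refine (exp_le_quadratic_add_cubic _).trans ?_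
    have b1 : |l * Y x| ≤ |l| * √h * (‖x‖ + c) := by
      rw [abs_mul, mul_assoc]; gcongr; exact hYb x
    have b2 : |l * Y x| ^ 3 * Real.exp |l * Y x| ≤ (|l| ^ 3 * (h * √h)) * κ x := by
      calc _ ≤ (|l| * √h * (‖x‖ + c)) ^ 3 * Real.exp (|l| * √h * (‖x‖ + c)) := by gcongr
        _ = (|l| ^ 3 * ((√h * √h) * √h)) * κ x := by simp only [hκ]; ring
        _ = _ := by rw [hss]
    have : (l * Y x) ^ 2 / 2 = (l ^ 2 / 2) * Y x ^ 2 := by ring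
    linarith
  have e0 : smear γ 0 h (fun z => Real.exp (l * U z)) w
      = Real.exp (l * a) * ∫ x, Real.exp (l * Y x) ∂γ := by
    rw [← integral_const_mul]
    unfold smear
    refine integral_congr_ae (ae_of_all _ fun x => ?_)
    simp only [hY, smul_zero, add_zero, ← Real.exp_add]
    congr 1; ring
  have hi1 : Integrable (fun x => 1 + l * Y x) γ := (integrable_const _).add (hiY.const_mul _)
  have hi2 : Integrable (fun x => 1 + l * Y x + (l ^ 2 / 2) * Y x ^ 2) γ :=
    hi1.add (hiY2.const_mul _)
  have e1 : ∫ x, Real.exp (l * Y x) ∂γ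
      ≤ 1 + (l ^ 2 * s / 2 + (|l| ^ 3 * ∫ x, κ x ∂γ) * (h * √h)) := by
    refine (integral_mono_of_nonneg (ae_of_all _ fun x => (Real.exp_pos _).le)
      (hi2.add (hiK.const_mul _)) (ae_of_all _ hpt)).trans ?_
    rw [integral_add' hi2 (hiK.const_mul _), integral_add hi1 (hiY2.const_mul _),
      integral_add (integrable_const _) (hiY.const_mul _), integral_const_mul, integral_const_mul,
      integral_const_mul, eY]
    have := mul_le_mul_of_nonneg_left eY2 (show 0 ≤ l ^ 2 / 2 by positivity)
    simp only [integral_const, probReal_univ, one_smul, mul_zero, add_zero]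
    have e5 : |l| ^ 3 * (h * √h) * ∫ x, κ x ∂γ = (|l| ^ 3 * ∫ x, κ x ∂γ) * (h * √h) := by ring
    linarith
  rw [e0, Real.exp_add]
  refine mul_le_mul_of_nonneg_left (e1.trans ?_) (Real.exp_pos _).le
  rw [add_comm]; exact Real.add_one_le_exp _

/-- Gaussian averages do not increase mean square increments. -/
theorem integral_sq_smear_sub_le (hU : LipschitzWith 1 U) {k s : ℝ}
    (hs : ∀ w, ∫ x, (U (w + √h • x) - U w) ^ 2 ∂γ ≤ s) (w : E) :
    ∫ x, (smear γ 0 k U (w + √h • x) - smear γ 0 k U w) ^ 2 ∂γ ≤ s := by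
  have hc := hU.continuous
  have hinn : Integrable (fun x : E => (√h * ‖x‖) ^ 2) γ := by
    simpa only [mul_pow] using (IsGaussian.integrable_norm_pow γ 2).const_mul (√h ^ 2)
  have hb : ∀ w x : E, (U (w + √h • x) - U w) ^ 2 ≤ (√h * ‖x‖) ^ 2 := fun w x => by
    rw [← sq_abs]
    refine pow_le_pow_left₀ (abs_nonneg _) ((abs_add_sub_le_norm hU _ _).trans ?_) 2
    rw [norm_smul, Real.norm_eq_abs, abs_of_nonneg (Real.sqrt_nonneg h)]
  have hiU : ∀ w, Integrable (fun y => U (w + √k • y)) γ := fun w => by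
    simpa using integrable_smear (γ := γ) (m := 0) (h := k) hU w
  have hprod : Integrable (Function.uncurry fun x y : E =>
      (U (w + √k • y + √h • x) - U (w + √k • y)) ^ 2) (γ.prod γ) := by
    refine (hinn.comp_fst γ).mono' (by fun_prop) (ae_of_all _ fun p => ?_)
    simp only [Function.uncurry]
    rw [Real.norm_eq_abs, abs_of_nonneg (sq_nonneg _)]
    exact hb _ _
  -- Jensen's inequality moves the square inside the average over `y`; after Fubini the hypothesis
  -- applies at the base point `w + √k • y`.
  have h1 : ∀ x, (smear γ 0 k U (w + √h • x) - smear γ 0 k U w) ^ 2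
      ≤ ∫ y, (U (w + √k • y + √h • x) - U (w + √k • y)) ^ 2 ∂γ := fun x => by
    have e : smear γ 0 k U (w + √h • x) - smear γ 0 k U w
        = ∫ y, (U (w + √k • y + √h • x) - U (w + √k • y)) ∂γ := by
      simp only [smear, smul_zero, add_zero]
      rw [← integral_sub (hiU _) (hiU _)]
      refine integral_congr_ae (ae_of_all _ fun y => ?_)
      simp only [add_right_comm]
    rw [e]
    refine sq_integral_le_integral_sq ?_ ?_
    · have := (hiU (w + √h • x)).sub (hiU w)
      refine this.congr (ae_of_all _ fun y => ?_)
      simp only [Pi.sub_apply, add_right_comm]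
    · refine (integrable_const ((√h * ‖x‖) ^ 2)).mono' (by fun_prop) (ae_of_all _ fun y => ?_)
      rw [Real.norm_eq_abs, abs_of_nonneg (sq_nonneg _)]
      exact hb _ _
  calc _ ≤ ∫ x, ∫ y, (U (w + √k • y + √h • x) - U (w + √k • y)) ^ 2 ∂γ ∂γ :=
        integral_mono_of_nonneg (ae_of_all _ fun x => sq_nonneg _) hprod.integral_prod_left
          (ae_of_all _ h1)
    _ = ∫ y, ∫ x, (U (w + √k • y + √h • x) - U (w + √k • y)) ^ 2 ∂γ ∂γ :=
        integral_integral_swap hprod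
    _ ≤ ∫ _ : E, s ∂γ := integral_mono hprod.integral_prod_right (integrable_const _)
        fun y => hs _
    _ = s := by simp

/-- The induction has to range over all 1-Lipschitz functions with the given mean square increments
at the initial scale `h`. Gaussian averaging preserves this class, so a doubling uses the hypothesis
once for `U` and once for its average, and the exponent `e` doubles. -/
theorem smear_exp_le_two_pow (hγ : γ[id] = 0) (l : ℝ) (h0 : 0 ≤ h) {s e : ℝ}
    (hstep : ∀ U : E → ℝ, LipschitzWith 1 U →
      (∀ w, ∫ x, (U (w + √h • x) - U w) ^ 2 ∂γ ≤ s) → ∀ w,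
      smear γ 0 h (fun z => Real.exp (l * U z)) w ≤ Real.exp (l * smear γ 0 h U w + e)) (n : ℕ) :
    ∀ U : E → ℝ, LipschitzWith 1 U →
      (∀ w, ∫ x, (U (w + √h • x) - U w) ^ 2 ∂γ ≤ s) → ∀ w,
      smear γ 0 (2 ^ n * h) (fun z => Real.exp (l * U z)) w
        ≤ Real.exp (l * smear γ 0 (2 ^ n * h) U w + 2 ^ n * e) := by
  induction n with
  | zero => simpa using hstep
  | succ n ih =>
    intro U hU hs w
    have hc := hU.continuous
    rw [pow_succ', mul_assoc, mul_assoc]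
    set k := (2 : ℝ) ^ n * h with hk
    have hk0 : 0 ≤ k := by positivity
    have hU' : LipschitzWith 1 (smear γ 0 k U) := hU.smear
    rw [← smear_smear_self hγ hU.continuous hk0 (integrable_smear hU w),
      ← smear_smear_self hγ (by fun_prop) hk0 (integrable_exp_smear hU l 0 w)]
    have hint := (integrable_exp_smear (γ := γ) (h := k) hU' l 0 w).const_mul
      (Real.exp (2 ^ n * e))
    calc smear γ 0 k (smear γ 0 k fun z => Real.exp (l * U z)) w
        ≤ ∫ x, Real.exp (2 ^ n * e)
            * Real.exp (l * smear γ 0 k U (w + (√k • x + k • (0 : E)))) ∂γ := by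
          refine integral_mono_of_nonneg (ae_of_all _ fun x =>
            integral_nonneg fun y => (Real.exp_pos _).le) hint (ae_of_all _ fun x => ?_)
          refine (ih U hU hs _).trans (le_of_eq ?_)
          rw [Real.exp_add, mul_comm]
      _ = Real.exp (2 ^ n * e) * smear γ 0 k (fun z => Real.exp (l * smear γ 0 k U z)) w :=
          integral_const_mul _ _
      _ ≤ Real.exp (2 ^ n * e) * Real.exp (l * smear γ 0 k (smear γ 0 k U) w + 2 ^ n * e) :=
          mul_le_mul_of_nonneg_left (ih _ hU' (integral_sq_smear_sub_le hU hs) w)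
            (Real.exp_pos _).le
      _ = _ := by rw [← Real.exp_add]; congr 1; ring

end Concentration

/-! ### Sub-Gaussian moments of log-sum-exp -/

section LogSumExpConcentration

variable {ι : Type*} [Fintype ι] [Nonempty ι] {γ : Measure (ι → ℝ)} [IsGaussian γ]

/-- To leading order the increment is `√h ∑ p i x i`, and convexity of the square gives `(∑ p i x
i)² ≤ ∑ p i (x i)²`. This is where the largest single variance becomes the variance proxy, with no
dependence on the number of indices. -/
theorem integral_sq_logSumExp_sub_le {V : ℝ} (hV : ∀ i, ∫ x, x i * x i ∂γ ≤ V) {h : ℝ}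
    (h0 : 0 ≤ h) (h1 : h ≤ 1) (w : ι → ℝ) :
    ∫ x, (logSumExp (w + √h • x) - logSumExp w) ^ 2 ∂γ
      ≤ h * V + (∫ x, (120 * ‖x‖ ^ 3 + 3600 * ‖x‖ ^ 4) ∂γ) * (h * √h) := by
  have hs0 : 0 ≤ √h := Real.sqrt_nonneg h
  have hss : √h * √h = h := Real.mul_self_sqrt h0
  have hs1 : √h ≤ 1 := by simpa using Real.sqrt_le_sqrt h1
  have hhs : h ≤ √h := by nlinarith
  set p := softmax w with hp
  have hp0 : ∀ i, 0 ≤ p i := softmax_nonneg w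
  have hp1 : ∑ i, p i = 1 := sum_softmax w
  have hi2 : ∀ i, Integrable (fun x : ι → ℝ => p i * (x i * x i)) γ := fun i =>
    (IsGaussian.integrable_coord_mul γ i i).const_mul _
  have hiB : Integrable (fun x : ι → ℝ => h * ∑ i, p i * (x i * x i)) γ :=
    (integrable_finsetSum _ fun i _ => hi2 i).const_mul _
  have hiR : Integrable (fun x : ι → ℝ => (120 * ‖x‖ ^ 3 + 3600 * ‖x‖ ^ 4) * (h * √h)) γ :=
    (((IsGaussian.integrable_norm_pow γ 3).const_mul 120).add
      ((IsGaussian.integrable_norm_pow γ 4).const_mul 3600)).mul_const _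
  have hpt : ∀ x : ι → ℝ, (logSumExp (w + √h • x) - logSumExp w) ^ 2
      ≤ h * (∑ i, p i * (x i * x i)) + (120 * ‖x‖ ^ 3 + 3600 * ‖x‖ ^ 4) * (h * √h) := fun x => by
    have hl := abs_logSumExp_add_sub_linear_le w (√h • x)
    rw [norm_smul, Real.norm_eq_abs, abs_of_nonneg hs0, mul_pow, pow_two (√h), hss] at hl
    have e1 : ∑ i, softmax w i * (√h • x) i = √h * ∑ i, p i * x i := by
      rw [Finset.mul_sum]
      exact Finset.sum_congr rfl fun i _ => by simp only [Pi.smul_apply, smul_eq_mul, hp]; ring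
    rw [e1] at hl
    set A := ∑ i, p i * x i with hA
    set r := logSumExp (w + √h • x) - logSumExp w - √h * A with hr
    have hAx : |A| ≤ ‖x‖ := abs_weighted_sum_le hp0 hp1 fun i => norm_le_pi_norm x i
    have hA2 : A ^ 2 ≤ ∑ i, p i * (x i * x i) := by
      have h0 : 0 ≤ ∑ i, p i * (x i - A) ^ 2 :=
        Finset.sum_nonneg fun i _ => mul_nonneg (hp0 i) (sq_nonneg _)
      have e : ∑ i, p i * (x i - A) ^ 2 = (∑ i, p i * (x i * x i)) - A ^ 2 := by
        have e' : ∀ i, p i * (x i - A) ^ 2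
            = p i * (x i * x i) - 2 * A * (p i * x i) + A ^ 2 * p i := fun i => by ring
        simp_rw [e']
        rw [Finset.sum_add_distrib, Finset.sum_sub_distrib, ← Finset.mul_sum, ← Finset.mul_sum,
          hp1, ← hA]
        ring
      linarith
    have e2 : (logSumExp (w + √h • x) - logSumExp w) ^ 2
        = h * A ^ 2 + 2 * (√h * (A * r)) + r ^ 2 := by
      have : logSumExp (w + √h • x) - logSumExp w = √h * A + r := by rw [hr]; ring
      rw [this]
      calc (√h * A + r) ^ 2 = (√h * √h) * A ^ 2 + 2 * (√h * (A * r)) + r ^ 2 := by ring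
        _ = _ := by rw [hss]
    have b1 : A * r ≤ ‖x‖ * (60 * (h * ‖x‖ ^ 2)) := by
      refine (le_abs_self _).trans ?_
      rw [abs_mul]
      exact mul_le_mul hAx hl (abs_nonneg _) (norm_nonneg _)
    have b2 : r ^ 2 ≤ (60 * (h * ‖x‖ ^ 2)) ^ 2 := by
      rw [← sq_abs]; exact pow_le_pow_left₀ (abs_nonneg _) hl 2
    have b3 : (60 * (h * ‖x‖ ^ 2)) ^ 2 ≤ 3600 * ‖x‖ ^ 4 * (h * √h) := by
      calc _ = 3600 * ‖x‖ ^ 4 * (h * h) := by ring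
        _ ≤ _ := by gcongr
    have b4 := mul_le_mul_of_nonneg_left b1 hs0
    have b5 := mul_le_mul_of_nonneg_left hA2 h0
    rw [e2]
    linarith
  refine (integral_mono_of_nonneg (ae_of_all _ fun x => sq_nonneg _) (hiB.add hiR)
    (ae_of_all _ hpt)).trans ?_
  rw [integral_add' hiB hiR, integral_mul_const, integral_const_mul,
    integral_finsetSum _ fun i _ => hi2 i]
  simp_rw [integral_const_mul]
  gcongr
  calc ∑ i, p i * ∫ x, x i * x i ∂γ ≤ ∑ i, p i * V :=
        Finset.sum_le_sum fun i _ => mul_le_mul_of_nonneg_left (hV i) (hp0 i)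
    _ = V := by rw [← Finset.sum_mul, hp1, one_mul]

/-- Sub-Gaussian exponential moments of log-sum-exp of a Gaussian vector, with the sharp variance
proxy `max Var x_i`. -/
theorem integral_exp_logSumExp_le (hγ : γ[id] = 0) {V : ℝ} (hV : ∀ i, ∫ x, x i * x i ∂γ ≤ V)
    (w : ι → ℝ) (l : ℝ) :
    ∫ x, Real.exp (l * logSumExp (w + x)) ∂γ
      ≤ Real.exp (l * (∫ x, logSumExp (w + x) ∂γ) + l ^ 2 * V / 2) := by
  set c := ∫ y, ‖y‖ ∂γ with hc
  have hc0 : 0 ≤ c := integral_nonneg fun y => norm_nonneg y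
  set K₁ := ∫ x, (120 * ‖x‖ ^ 3 + 3600 * ‖x‖ ^ 4) ∂γ
  set K₂ := |l| ^ 3 * ∫ x, (‖x‖ + c) ^ 3 * Real.exp (|l| * (‖x‖ + c)) ∂γ with hK2
  set K := l ^ 2 * K₁ / 2 + K₂ with hK
  have hbound : ∀ h, 0 ≤ h → h ≤ 1 → ∀ U : (ι → ℝ) → ℝ, LipschitzWith 1 U →
      (∀ w, ∫ x, (U (w + √h • x) - U w) ^ 2 ∂γ ≤ h * V + K₁ * (h * √h)) → ∀ w,
      smear γ 0 h (fun z => Real.exp (l * U z)) w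
        ≤ Real.exp (l * smear γ 0 h U w + (h * (l ^ 2 * V / 2) + K * (h * √h))) := by
    intro h h0 h1 U hU hs w
    refine (smear_exp_le_of_sq_le hU l h0 w (hs w)).trans (Real.exp_le_exp.2 ?_)
    have hs0 : 0 ≤ √h := Real.sqrt_nonneg h
    have hs1 : √h ≤ 1 := by simpa using Real.sqrt_le_sqrt h1
    -- Bounding `√h` by one in the exponent makes the remainder constant uniform in `h ≤ 1`.
    have hle : |l| ^ 3 * ∫ x, (‖x‖ + c) ^ 3 * Real.exp (|l| * √h * (‖x‖ + c)) ∂γ ≤ K₂ := by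
      refine mul_le_mul_of_nonneg_left (integral_mono
        (IsGaussian.integrable_norm_add_pow_mul_exp γ 3 hc0)
        (IsGaussian.integrable_norm_add_pow_mul_exp γ 3 hc0) fun x => ?_) (by positivity)
      have : |l| * √h ≤ |l| := mul_le_of_le_one_right (abs_nonneg l) hs1
      simp only
      gcongr
    have := mul_le_mul_of_nonneg_right hle (mul_nonneg h0 hs0)
    have e : h * (l ^ 2 * V / 2) + K * (h * √h)
        = l ^ 2 * (h * V + K₁ * (h * √h)) / 2 + K₂ * (h * √h) := by rw [hK]; ring
    linarith
  have hlim : Tendsto (fun n : ℕ => Real.exp (l * (∫ x, logSumExp (w + x) ∂γ)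
      + (l ^ 2 * V / 2 + K * √((1 / 2 : ℝ) ^ n)))) atTop
      (𝓝 (Real.exp (l * (∫ x, logSumExp (w + x) ∂γ) + (l ^ 2 * V / 2 + K * √0)))) := by
    refine (Real.continuous_exp.tendsto _).comp ?_
    refine tendsto_const_nhds.add (tendsto_const_nhds.add (tendsto_const_nhds.mul ?_))
    exact (Real.continuous_sqrt.tendsto 0).comp
      (tendsto_pow_atTop_nhds_zero_of_lt_one (by norm_num) (by norm_num))
  simp only [Real.sqrt_zero, mul_zero, add_zero] at hlim
  refine ge_of_tendsto' hlim fun n => ?_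
  have h0 : (0 : ℝ) ≤ (1 / 2) ^ n := by positivity
  have h1 : ((1 : ℝ) / 2) ^ n ≤ 1 := pow_le_one₀ (by norm_num) (by norm_num)
  have h2 : (2 : ℝ) ^ n * (1 / 2) ^ n = 1 := by rw [← mul_pow]; norm_num
  have := smear_exp_le_two_pow hγ l h0 (hbound _ h0 h1) n logSumExp lipschitzWith_logSumExp
    (integral_sq_logSumExp_sub_le hV h0 h1) w
  rw [h2] at this
  simp only [smear, Real.sqrt_one, one_smul, smul_zero, add_zero] at this
  refine this.trans (le_of_eq ?_)
  congr 2
  calc (2 : ℝ) ^ n * ((1 / 2) ^ n * (l ^ 2 * V / 2) + K * ((1 / 2) ^ n * √((1 / 2 : ℝ) ^ n)))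
      = (2 ^ n * (1 / 2) ^ n) * (l ^ 2 * V / 2)
        + K * ((2 ^ n * (1 / 2) ^ n) * √((1 / 2 : ℝ) ^ n)) := by ring
    _ = _ := by rw [h2]; ring

end LogSumExpConcentration

/-! ### Gaussian random vectors -/

section GaussianVector

variable {ι Ω : Type*} [Fintype ι] [MeasurableSpace Ω] {P : Measure Ω}
  {X : ι → Ω → ℝ}

/-- The law of the centered vector. -/
noncomputable def centeredLaw (X : ι → Ω → ℝ) (P : Measure Ω) : Measure (ι → ℝ) :=
  P.map (fun ω i => X i ω - ∫ ω', X i ω' ∂P)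

theorem aemeasurable_centered (hX : HasGaussianLaw (fun ω i => X i ω) P) :
    AEMeasurable (fun ω i => X i ω - ∫ ω', X i ω' ∂P) P := by
  have h := hX.aemeasurable
  exact aemeasurable_pi_lambda _ fun i => (h.eval i).sub aemeasurable_const

theorem isGaussian_centeredLaw (hX : HasGaussianLaw (fun ω i => X i ω) P) :
    IsGaussian (centeredLaw X P) := by
  have := hX.isGaussian_map
  have e : centeredLaw X P
      = (P.map (fun ω i => X i ω)).map (fun x => x - fun i => ∫ ω', X i ω' ∂P) := by
    rw [AEMeasurable.map_map_of_aemeasurable (by fun_prop) hX.aemeasurable]; rfl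
  rw [e]; infer_instance

theorem integral_coord_mul_centeredLaw (hX : HasGaussianLaw (fun ω i => X i ω) P) (i j : ι) :
    ∫ x, x i * x j ∂(centeredLaw X P) = cov[X i, X j; P] := by
  unfold centeredLaw
  rw [integral_map (aemeasurable_centered hX)
    (by exact ((measurable_pi_apply i).mul (measurable_pi_apply j)).aestronglyMeasurable)]
  rfl

theorem integral_id_centeredLaw (hX : HasGaussianLaw (fun ω i => X i ω) P) :
    ∫ x, id x ∂(centeredLaw X P) = 0 := by
  have := hX.isProbabilityMeasure
  have hG := isGaussian_centeredLaw hX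
  have hi : Integrable (fun x : ι → ℝ => x) (centeredLaw X P) := IsGaussian.integrable_fun_id
  ext i
  have h := (ContinuousLinearMap.proj (R := ℝ) (φ := fun _ : ι => ℝ) i).integral_comp_comm hi
  simp only [ContinuousLinearMap.proj_apply] at h
  simp only [id, Pi.zero_apply]
  rw [← h]
  unfold centeredLaw
  rw [integral_map (aemeasurable_centered hX) (measurable_pi_apply i).aestronglyMeasurable,
    integral_sub (hX.eval i).integrable (integrable_const _)]
  simp

theorem integral_centeredLaw_add (hX : HasGaussianLaw (fun ω i => X i ω) P)
    {G : (ι → ℝ) → ℝ} (hG : Continuous G) :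
    ∫ x, G ((fun i => ∫ ω', X i ω' ∂P) + x) ∂(centeredLaw X P) = ∫ ω, G (fun i => X i ω) ∂P := by
  unfold centeredLaw
  rw [integral_map (aemeasurable_centered hX) (by fun_prop)]
  refine integral_congr_ae (ae_of_all _ fun ω => ?_)
  simp only
  congr 1
  ext i
  simp

theorem integrable_centeredLaw_add_iff (hX : HasGaussianLaw (fun ω i => X i ω) P)
    {G : (ι → ℝ) → ℝ} (hG : Continuous G) :
    Integrable (fun x => G ((fun i => ∫ ω', X i ω' ∂P) + x)) (centeredLaw X P)
      ↔ Integrable (fun ω => G (fun i => X i ω)) P := by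
  unfold centeredLaw
  rw [integrable_map_measure (by fun_prop) (aemeasurable_centered hX)]
  refine integrable_congr (ae_of_all _ fun ω => ?_)
  simp only [Function.comp]
  congr 1
  ext i
  simp

variable [Nonempty ι]

theorem integrable_exp_mul_logSumExp (hX : HasGaussianLaw (fun ω i => X i ω) P) (l : ℝ) :
    Integrable (fun ω => Real.exp (l * logSumExp (fun i => X i ω))) P := by
  have hG := isGaussian_centeredLaw hX
  have hc : Continuous (logSumExp : (ι → ℝ) → ℝ) := continuous_logSumExp
  rw [← integrable_centeredLaw_add_iff hX (G := fun x => Real.exp (l * logSumExp x)) (by fun_prop)]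
  simpa using integrable_exp_smear (γ := centeredLaw X P) (h := 1) lipschitzWith_logSumExp l 0
    (fun i => ∫ ω, X i ω ∂P)

/-- Sub-Gaussian exponential moments of log-sum-exp of a Gaussian random vector. -/
theorem HasGaussianLaw.integral_exp_logSumExp_le (hX : HasGaussianLaw (fun ω i => X i ω) P)
    {V : ℝ} (hV : ∀ i, cov[X i, X i; P] ≤ V) (l : ℝ) :
    ∫ ω, Real.exp (l * logSumExp (fun i => X i ω)) ∂P
      ≤ Real.exp (l * (∫ ω, logSumExp (fun i => X i ω) ∂P) + l ^ 2 * V / 2) := by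
  have hG := isGaussian_centeredLaw hX
  have hc : Continuous (logSumExp : (ι → ℝ) → ℝ) := continuous_logSumExp
  have h := _root_.integral_exp_logSumExp_le (integral_id_centeredLaw hX)
    (fun i => (integral_coord_mul_centeredLaw hX i i).trans_le (hV i))
    (fun i => ∫ ω', X i ω' ∂P) l
  rwa [integral_centeredLaw_add hX (G := fun x => Real.exp (l * logSumExp x)) (by fun_prop),
    integral_centeredLaw_add hX hc] at h

variable {Ω' : Type*} [MeasurableSpace Ω'] {P' : Measure Ω'} {Y : ι → Ω' → ℝ}

theorem HasGaussianLaw.integral_logSumExp_le (hX : HasGaussianLaw (fun ω i => X i ω) P)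
    (hY : HasGaussianLaw (fun ω i => Y i ω) P') {D : ℝ}
    (hdiag : ∀ i, (∫ ω, Y i ω ∂P') + cov[Y i, Y i; P'] / 2
      ≤ (∫ ω, X i ω ∂P) + cov[X i, X i; P] / 2)
    (hoff : ∀ i j, cov[X i, X j; P] ≤ cov[Y i, Y j; P'] + D) :
    ∫ ω, logSumExp (fun i => Y i ω) ∂P' ≤ (∫ ω, logSumExp (fun i => X i ω) ∂P) + D / 2 := by
  have hG := isGaussian_centeredLaw hX
  have hG' := isGaussian_centeredLaw hY
  have hc : Continuous (logSumExp : (ι → ℝ) → ℝ) := continuous_logSumExp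
  have h := integral_logSumExp_le_of_covariance_le (m := fun i => ∫ ω', X i ω' ∂P)
    (m' := fun i => ∫ ω', Y i ω' ∂P') (integral_id_centeredLaw hX) (integral_id_centeredLaw hY)
    (D := D) (by simpa only [integral_coord_mul_centeredLaw hX,
      integral_coord_mul_centeredLaw hY] using hdiag)
    (by simpa only [integral_coord_mul_centeredLaw hX,
      integral_coord_mul_centeredLaw hY] using hoff)
  simp_rw [add_comm _ (fun i => ∫ ω', X i ω' ∂P), add_comm _ (fun i => ∫ ω', Y i ω' ∂P')] at h
  rwa [integral_centeredLaw_add hX hc, integral_centeredLaw_add hY hc] at h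

end GaussianVector

/-! ### Convergence of integrals under a second moment bound -/

theorem abs_sub_clamp_le {K : ℝ} (hK : 0 < K) (x : ℝ) : |x - max (-K) (min x K)| ≤ x ^ 2 / K := by
  rw [le_div_iff₀ hK]
  rcases le_total x K with h1 | h1
  · rcases le_total (-K) x with h2 | h2
    · rw [min_eq_left h1, max_eq_right h2, sub_self, abs_zero, zero_mul]; positivity
    · rw [min_eq_left h1, max_eq_left h2, abs_of_nonpos (by linarith)]; nlinarith
  · rw [min_eq_right h1, max_eq_right (by linarith), abs_of_nonneg (by linarith)]; nlinarith

/-- Bounded second moments give uniform integrability: truncation at height `K` costs at most `C /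
K` in mean, uniformly in `n`, and dominated convergence handles the truncated functions. -/
theorem tendsto_integral_of_sq_bounded {Ω : Type*} [MeasurableSpace Ω] {P : Measure Ω}
    [IsFiniteMeasure P] {φ : ℕ → Ω → ℝ} {ψ : Ω → ℝ} {C : ℝ}
    (hφ : ∀ n, Integrable (φ n) P) (hφ2 : ∀ n, Integrable (fun ω => φ n ω ^ 2) P)
    (hC : ∀ n, ∫ ω, φ n ω ^ 2 ∂P ≤ C) (hψ : Integrable ψ P)
    (hψ2 : Integrable (fun ω => ψ ω ^ 2) P) (hCψ : ∫ ω, ψ ω ^ 2 ∂P ≤ C)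
    (hlim : ∀ᵐ ω ∂P, Tendsto (fun n => φ n ω) atTop (𝓝 (ψ ω))) :
    Tendsto (fun n => ∫ ω, φ n ω ∂P) atTop (𝓝 (∫ ω, ψ ω ∂P)) := by
  have hC0 : 0 ≤ C := (integral_nonneg fun ω => sq_nonneg _).trans hCψ
  rw [Metric.tendsto_atTop]
  intro ε hε
  set K := 4 * (C + 1) / ε with hKdef
  have hK : 0 < K := by positivity
  set cl : ℝ → ℝ := fun x => max (-K) (min x K) with hcl
  have hclc : Continuous cl := by fun_prop
  have hclb : ∀ x, ‖cl x‖ ≤ K := fun x => by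
    rw [Real.norm_eq_abs, abs_le]
    exact ⟨le_max_left _ _, max_le (by linarith) (min_le_right _ _)⟩
  have hcli : ∀ {f : Ω → ℝ}, Integrable f P → Integrable (fun ω => cl (f ω)) P := fun {f} hf =>
    (integrable_const K).mono' (hclc.comp_aestronglyMeasurable hf.1) (ae_of_all _ fun ω => hclb _)
  have htrunc : ∀ {f : Ω → ℝ}, Integrable f P → Integrable (fun ω => f ω ^ 2) P →
      ∫ ω, f ω ^ 2 ∂P ≤ C → |(∫ ω, f ω ∂P) - ∫ ω, cl (f ω) ∂P| ≤ ε / 4 := fun {f} h1 h2 h3 => by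
    rw [← integral_sub h1 (hcli h1)]
    refine abs_integral_le_integral_abs.trans ?_
    refine (integral_mono (h1.sub (hcli h1)).abs (h2.div_const K)
      fun ω => abs_sub_clamp_le hK _).trans ?_
    rw [integral_div, div_le_iff₀ hK, hKdef]
    have : ε / 4 * (4 * (C + 1) / ε) = C + 1 := by field_simp
    linarith
  have hdc : Tendsto (fun n => ∫ ω, cl (φ n ω) ∂P) atTop (𝓝 (∫ ω, cl (ψ ω) ∂P)) := by
    refine tendsto_integral_of_dominated_convergence (fun _ => K)
      (fun n => hclc.comp_aestronglyMeasurable (hφ n).1) (integrable_const K)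
      (fun n => ae_of_all _ fun ω => hclb _) ?_
    filter_upwards [hlim] with ω hω
    exact (hclc.tendsto _).comp hω
  obtain ⟨N, hN⟩ := Metric.tendsto_atTop.1 hdc (ε / 4) (by positivity)
  refine ⟨N, fun n hn => ?_⟩
  have h1 := abs_le.1 (htrunc (hφ n) (hφ2 n) (hC n))
  have h2 := abs_le.1 (htrunc hψ hψ2 hCψ)
  have h3 := abs_lt.1 ((Real.dist_eq _ _) ▸ hN n hn)
  rw [Real.dist_eq, abs_lt]
  constructor <;> linarith [h1.1, h1.2, h2.1, h2.2, h3.1, h3.2]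

/-! ### Gaussian processes with bounded mean and variance -/

/-- Fatou's lemma, in a form that also delivers integrability of the limit. -/
theorem integrable_and_integral_le_of_tendsto {Ω : Type*} [MeasurableSpace Ω] {P : Measure Ω}
    {f : ℕ → Ω → ℝ} {g : Ω → ℝ} {C : ℕ → ℝ} {c : ℝ} (hf0 : ∀ n ω, 0 ≤ f n ω)
    (hf : ∀ n, Integrable (f n) P) (hC : ∀ n, ∫ ω, f n ω ∂P ≤ C n)
    (hCc : Tendsto C atTop (𝓝 c))
    (hlim : ∀ᵐ ω ∂P, Tendsto (fun n => f n ω) atTop (𝓝 (g ω))) :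
    Integrable g P ∧ ∫ ω, g ω ∂P ≤ c := by
  have hgm : AEStronglyMeasurable g P :=
    aestronglyMeasurable_of_tendsto_ae _ (fun n => (hf n).1) hlim
  have hg0 : 0 ≤ᵐ[P] g := by
    filter_upwards [hlim] with ω hω
    exact ge_of_tendsto' hω fun n => hf0 n ω
  have hc0 : 0 ≤ c := ge_of_tendsto' hCc fun n => (integral_nonneg (hf0 n)).trans (hC n)
  have key : ∫⁻ ω, ENNReal.ofReal (g ω) ∂P ≤ ENNReal.ofReal c := by
    calc ∫⁻ ω, ENNReal.ofReal (g ω) ∂P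
        = ∫⁻ ω, liminf (fun n => ENNReal.ofReal (f n ω)) atTop ∂P := by
          refine lintegral_congr_ae ?_
          filter_upwards [hlim] with ω hω
          exact ((ENNReal.tendsto_ofReal hω).liminf_eq).symm
      _ ≤ liminf (fun n => ∫⁻ ω, ENNReal.ofReal (f n ω) ∂P) atTop :=
          lintegral_liminf_le' fun n => (hf n).1.aemeasurable.ennreal_ofReal
      _ ≤ liminf (fun n => ENNReal.ofReal (C n)) atTop := by
          refine liminf_le_liminf (Eventually.of_forall fun n => ?_)
          rw [← ofReal_integral_eq_lintegral_ofReal (hf n) (ae_of_all _ (hf0 n))]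
          exact ENNReal.ofReal_le_ofReal (hC n)
      _ = ENNReal.ofReal c := (ENNReal.tendsto_ofReal hCc).liminf_eq
  have hgi : Integrable g P := by
    refine ⟨hgm, ?_⟩
    rw [hasFiniteIntegral_iff_ofReal hg0]
    exact key.trans_lt ENNReal.ofReal_lt_top
  refine ⟨hgi, ?_⟩
  rwa [← ofReal_integral_eq_lintegral_ofReal hgi hg0, ENNReal.ofReal_le_ofReal_iff hc0] at key

theorem sq_le_exp_add_exp_neg (x : ℝ) : x ^ 2 ≤ 2 * (Real.exp x + Real.exp (-x)) := by
  have h1 : ∀ y : ℝ, 0 ≤ y → y ^ 2 ≤ 2 * (Real.exp y + Real.exp (-y)) := fun y hy => by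
    linarith [Real.quadratic_le_exp_of_nonneg hy, Real.exp_pos (-y)]
  rcases le_total 0 x with h | h
  · exact h1 x h
  · have := h1 (-x) (by linarith)
    rw [neg_neg] at this
    linarith [neg_sq x]

/-- A jointly measurable Gaussian process with means in `[-B, B]` and variances at most `V`. -/
structure IsBoundedGaussian {T Ω : Type*} [MeasurableSpace T] [MeasurableSpace Ω]
    (X : T → Ω → ℝ) (P : Measure Ω) (B V : ℝ) : Prop where
  measurable : Measurable (fun p : T × Ω => X p.1 p.2)
  gaussian : IsGaussianProcess X P
  mean_le : ∀ t, |∫ ω, X t ω ∂P| ≤ B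
  cov_le : ∀ t, cov[X t, X t; P] ≤ V

/-- The exponential integral `∫ exp (X t ω) ∂μ(t)`. -/
noncomputable def expIntegral {T Ω : Type*} [MeasurableSpace T] (X : T → Ω → ℝ) (μ : Measure T)
    (ω : Ω) : ℝ := ∫ t, Real.exp (X t ω) ∂μ

theorem integral_exp_pos' {T : Type*} [MeasurableSpace T] {μ : Measure T} (hμ : μ ≠ 0) {x : T → ℝ}
    (hx : Integrable (fun t => Real.exp (x t)) μ) : 0 < ∫ t, Real.exp (x t) ∂μ := by
  have : NeZero μ := ⟨hμ⟩
  exact integral_exp_pos hx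

namespace IsBoundedGaussian

variable {T Ω : Type*} [MeasurableSpace T] [MeasurableSpace Ω] {X : T → Ω → ℝ} {P : Measure Ω}
  {B V : ℝ}

theorem measurable_left (hX : IsBoundedGaussian X P B V) (ω : Ω) : Measurable fun t => X t ω :=
  hX.measurable.comp (by fun_prop : Measurable fun t : T => (t, ω))

theorem measurable_right (hX : IsBoundedGaussian X P B V) (t : T) : Measurable (X t) :=
  hX.measurable.comp (by fun_prop : Measurable fun ω : Ω => (t, ω))

theorem measurable_expIntegral (hX : IsBoundedGaussian X P B V) (μ : Measure T)
    [IsFiniteMeasure μ] : Measurable (expIntegral X μ) :=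
  (hX.measurable.exp.stronglyMeasurable.integral_prod_left' (μ := μ)).measurable

theorem hasGaussianLaw_fin (hX : IsBoundedGaussian X P B V) {n : ℕ} (t : Fin n → T) :
    HasGaussianLaw (fun ω i => X (t i) ω) P := by
  let L : (↥(Finset.univ : Finset (Fin n)) → ℝ) →L[ℝ] (Fin n → ℝ) :=
    ContinuousLinearMap.pi fun i => ContinuousLinearMap.proj ⟨i, Finset.mem_univ i⟩
  exact ((hX.gaussian.comp_right t).hasGaussianLaw Finset.univ).map L

theorem integrable_exp_mul (hX : IsBoundedGaussian X P B V) (t : T) (l : ℝ) :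
    Integrable (fun ω => Real.exp (l * X t ω)) P := by
  have h := (hX.gaussian.hasGaussianLaw_eval t).map_eq_gaussianReal
  have h2 := integrable_exp_mul_gaussianReal (μ := P[X t]) (v := Var[X t; P].toNNReal) l
  rw [← h, integrable_map_measure (by fun_prop) (hX.measurable_right t).aemeasurable] at h2
  exact h2

theorem integral_exp_mul_le (hX : IsBoundedGaussian X P B V) (t : T) {l : ℝ} (hl : |l| = 1) :
    ∫ ω, Real.exp (l * X t ω) ∂P ≤ Real.exp (B + V / 2) := by
  have h := mgf_gaussianReal (hX.gaussian.hasGaussianLaw_eval t).map_eq_gaussianReal l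
  unfold mgf at h
  rw [h]
  refine Real.exp_le_exp.2 ?_
  have hl2 : l ^ 2 = 1 := by rw [← sq_abs, hl, one_pow]
  rw [Real.coe_toNNReal _ (variance_nonneg _ _), hl2, mul_one,
    ← covariance_self (hX.measurable_right t).aemeasurable]
  have h1 : (∫ ω, X t ω ∂P) * l ≤ B := by
    refine (le_abs_self _).trans ?_
    rw [abs_mul, hl, mul_one]; exact hX.mean_le t
  linarith [hX.cov_le t]

theorem nonneg_var (hX : IsBoundedGaussian X P B V) (t : T) : 0 ≤ V := by
  refine le_trans ?_ (hX.cov_le t)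
  rw [covariance_self (hX.measurable_right t).aemeasurable]
  exact variance_nonneg _ _

variable [IsProbabilityMeasure P]

theorem integrable_exp_prod (hX : IsBoundedGaussian X P B V) (μ : Measure T) [IsFiniteMeasure μ] :
    Integrable (fun p : T × Ω => Real.exp (X p.1 p.2)) (μ.prod P) := by
  have hm : Measurable (fun p : T × Ω => Real.exp (X p.1 p.2)) := hX.measurable.exp
  rw [integrable_prod_iff hm.aestronglyMeasurable]
  refine ⟨ae_of_all _ fun t => by simpa using hX.integrable_exp_mul t 1, ?_⟩
  refine (integrable_const (Real.exp (B + V / 2))).mono'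
    hm.norm.stronglyMeasurable.integral_prod_right.aestronglyMeasurable (ae_of_all _ fun t => ?_)
  rw [Real.norm_eq_abs, abs_of_nonneg (integral_nonneg fun ω => norm_nonneg _)]
  simp only [Real.norm_eq_abs, Real.abs_exp]
  simpa using hX.integral_exp_mul_le t (l := 1) abs_one

theorem ae_integrable_exp (hX : IsBoundedGaussian X P B V) (μ : Measure T) [IsFiniteMeasure μ] :
    ∀ᵐ ω ∂P, Integrable (fun t => Real.exp (X t ω)) μ :=
  (hX.integrable_exp_prod μ).prod_left_ae

theorem ae_expIntegral_pos (hX : IsBoundedGaussian X P B V) {μ : Measure T} [IsFiniteMeasure μ]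
    (hμ : μ ≠ 0) : ∀ᵐ ω ∂P, 0 < expIntegral X μ ω := by
  filter_upwards [hX.ae_integrable_exp μ] with ω hω
  exact integral_exp_pos' hμ hω

/-- Almost every sequence of independent samples of `μ` computes the exponential integral. -/
theorem ae_tendsto_average (hX : IsBoundedGaussian X P B V) (μ : Measure T)
    [IsProbabilityMeasure μ] :
    ∀ᵐ t ∂(Measure.infinitePi fun _ : ℕ => μ), ∀ᵐ ω ∂P,
      Tendsto (fun n : ℕ => (∑ i ∈ Finset.range n, Real.exp (X (t i) ω)) / n) atTop
        (𝓝 (expIntegral X μ ω)) := by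
  -- The strong law holds for almost every fixed `ω`, with randomness in the samples. Exchanging the
  -- two almost-everywhere quantifiers needs joint measurability of the convergence event, which is
  -- the second goal.
  rw [Measure.ae_ae_comm]
  · filter_upwards [hX.ae_integrable_exp μ] with ω hω
    have hme : Measurable (fun s => Real.exp (X s ω)) := (hX.measurable_left ω).exp
    have hpres := fun i : ℕ => measurePreserving_eval_infinitePi (fun _ : ℕ => μ) i
    have hint0 : ∫ t, Real.exp (X (t 0) ω) ∂(Measure.infinitePi fun _ : ℕ => μ)
        = expIntegral X μ ω := by
      have h := integral_map (hpres 0).measurable.aemeasurable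
        (f := fun s => Real.exp (X s ω)) (by rw [(hpres 0).map_eq]; exact hme.aestronglyMeasurable)
      rw [(hpres 0).map_eq] at h
      exact h.symm
    rw [← hint0]
    refine strong_law_ae_real (fun i (t : ℕ → T) => Real.exp (X (t i) ω)) ?_ ?_ ?_
    · exact (hpres 0).integrable_comp_of_integrable hω
    · intro i j hij
      exact (iIndepFun_infinitePi (P := fun _ : ℕ => μ)
        (X := fun _ s => Real.exp (X s ω)) (fun _ => hme)).indepFun hij
    · intro i
      refine ⟨(hme.comp (measurable_pi_apply i)).aemeasurable,
        (hme.comp (measurable_pi_apply 0)).aemeasurable, ?_⟩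
      have h1 : ∀ j : ℕ, Measure.map (fun t : ℕ → T => Real.exp (X (t j) ω))
          (Measure.infinitePi fun _ : ℕ => μ) = μ.map (fun s => Real.exp (X s ω)) := fun j => by
        have : (fun t : ℕ → T => Real.exp (X (t j) ω))
            = (fun s => Real.exp (X s ω)) ∘ Function.eval j := rfl
        rw [this, ← Measure.map_map hme (measurable_pi_apply j), (hpres j).map_eq]
      rw [h1, h1]
  · refine measurableSet_tendsto_fun (fun n => ?_)
      ((hX.measurable_expIntegral μ).comp measurable_snd)
    refine Measurable.div_const (Finset.measurable_sum _ fun i _ => ?_) _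
    refine Measurable.exp ?_
    have hg : Measurable fun p : (ℕ → T) × Ω => (p.1 i, p.2) :=
      ((measurable_pi_apply i).comp measurable_fst).prodMk measurable_snd
    exact hX.measurable.comp hg

end IsBoundedGaussian

/-! ### Logarithms of empirical averages of exponentials -/

section LogAverage

variable {n : ℕ}

/-- The logarithm of the average of exponentials. -/
noncomputable def logAvgExp (x : Fin (n + 1) → ℝ) : ℝ := logSumExp x - Real.log (n + 1 : ℕ)

theorem exp_logAvgExp (x : Fin (n + 1) → ℝ) :
    Real.exp (logAvgExp x) = (∑ i, Real.exp (x i)) / (n + 1 : ℕ) := by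
  unfold logAvgExp logSumExp
  rw [Real.exp_sub, Real.exp_log (sum_exp_pos x), Real.exp_log (by positivity)]

/-- The inequality between harmonic and arithmetic means, from Cauchy–Schwarz. It prevents the
empirical average from being too close to zero. -/
theorem exp_neg_logAvgExp_le (x : Fin (n + 1) → ℝ) :
    Real.exp (-logAvgExp x) ≤ (∑ i, Real.exp (-x i)) / (n + 1 : ℕ) := by
  have hn : (0 : ℝ) < (n + 1 : ℕ) := by positivity
  have hpos := sum_exp_pos x
  rw [Real.exp_neg, exp_logAvgExp, inv_div, div_le_div_iff₀ hpos hn, mul_comm (∑ i, _)]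
  have h := Finset.sum_mul_sq_le_sq_mul_sq Finset.univ (fun i => Real.exp (x i / 2))
    (fun i => Real.exp (-x i / 2))
  have e1 : ∀ i, Real.exp (x i / 2) * Real.exp (-x i / 2) = 1 := fun i => by
    rw [← Real.exp_add]; ring_nf; exact Real.exp_zero
  have e2 : ∀ y : ℝ, Real.exp (y / 2) ^ 2 = Real.exp y := fun y => by
    rw [← Real.exp_nat_mul]; congr 1; push_cast; ring
  simp only [e1, e2, Finset.sum_const, Finset.card_univ, Fintype.card_fin, nsmul_eq_mul,
    mul_one] at h
  rw [← pow_two]; exact h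

end LogAverage

namespace IsBoundedGaussian

variable {T Ω : Type*} [MeasurableSpace T] [MeasurableSpace Ω] {X : T → Ω → ℝ} {P : Measure Ω}
  {B V : ℝ}

theorem measurable_logAvgExp (hX : IsBoundedGaussian X P B V) {n : ℕ} (t : Fin (n + 1) → T) :
    Measurable (fun ω => logAvgExp fun i => X (t i) ω) := by
  have hc : Continuous (logSumExp : (Fin (n + 1) → ℝ) → ℝ) := continuous_logSumExp
  exact (hc.measurable.comp (measurable_pi_lambda _ fun i => hX.measurable_right (t i))).sub_const _

/-- The square is dominated by averages of `exp (X t)` and `exp (-X t)`, whose means are bounded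
point by point. The bound is thus independent of the number and position of the samples. -/
theorem integrable_sq_logAvgExp (hX : IsBoundedGaussian X P B V) {n : ℕ} (t : Fin (n + 1) → T) :
    Integrable (fun ω => (logAvgExp fun i => X (t i) ω) ^ 2) P ∧
      ∫ ω, (logAvgExp fun i => X (t i) ω) ^ 2 ∂P ≤ 4 * Real.exp (B + V / 2) := by
  have hn : (0 : ℝ) < (n + 1 : ℕ) := by positivity
  set G : Ω → ℝ := fun ω => 2 * ((∑ i, Real.exp (1 * X (t i) ω)) / (n + 1 : ℕ)
    + (∑ i, Real.exp (-1 * X (t i) ω)) / (n + 1 : ℕ)) with hG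
  have hi : ∀ l : ℝ, Integrable (fun ω => (∑ i, Real.exp (l * X (t i) ω)) / (n + 1 : ℕ)) P :=
    fun l => (integrable_finsetSum _ fun i _ => hX.integrable_exp_mul (t i) l).div_const _
  have hGi : Integrable G P := ((hi 1).add (hi (-1))).const_mul 2
  have hle : ∀ ω, (logAvgExp fun i => X (t i) ω) ^ 2 ≤ G ω := fun ω => by
    refine (sq_le_exp_add_exp_neg _).trans ?_
    have h1 := exp_logAvgExp fun i => X (t i) ω
    have h2 := exp_neg_logAvgExp_le fun i => X (t i) ω
    simp only [hG, one_mul, neg_one_mul]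
    linarith
  have hb : ∀ l : ℝ, |l| = 1 → ∫ ω, (∑ i, Real.exp (l * X (t i) ω)) / (n + 1 : ℕ) ∂P
      ≤ Real.exp (B + V / 2) := fun l hl => by
    rw [integral_div, div_le_iff₀ hn,
      integral_finsetSum _ fun i _ => hX.integrable_exp_mul (t i) l]
    refine (Finset.sum_le_sum fun i _ => hX.integral_exp_mul_le (t i) hl).trans (le_of_eq ?_)
    simp [mul_comm]
  have hGb : ∫ ω, G ω ∂P ≤ 4 * Real.exp (B + V / 2) := by
    simp only [hG]
    rw [integral_const_mul, integral_add (hi 1) (hi (-1))]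
    linarith [hb 1 abs_one, hb (-1) (by simp)]
  have hint : Integrable (fun ω => (logAvgExp fun i => X (t i) ω) ^ 2) P :=
    hGi.mono' ((hX.measurable_logAvgExp t).pow_const 2).aestronglyMeasurable
      (ae_of_all _ fun ω => by rw [Real.norm_eq_abs, abs_of_nonneg (sq_nonneg _)]; exact hle ω)
  exact ⟨hint, (integral_mono hint hGi hle).trans hGb⟩

variable [IsProbabilityMeasure P]

theorem integrable_of_sq {f : Ω → ℝ} (hm : AEStronglyMeasurable f P)
    (h2 : Integrable (fun ω => f ω ^ 2) P) : Integrable f P :=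
  ((memLp_two_iff_integrable_sq hm).2 h2).integrable (by norm_num)

/-- For almost every sequence of samples of `μ`, the logarithms of the empirical averages converge
almost surely and in mean to the logarithm of the exponential integral. -/
theorem ae_tendsto_logAvgExp (hX : IsBoundedGaussian X P B V) (μ : Measure T)
    [IsProbabilityMeasure μ] :
    ∀ᵐ t ∂(Measure.infinitePi fun _ : ℕ => μ),
      (∀ᵐ ω ∂P, Tendsto (fun n : ℕ => logAvgExp fun i : Fin (n + 1) => X (t i) ω) atTop
        (𝓝 (Real.log (expIntegral X μ ω)))) ∧
      Integrable (fun ω => Real.log (expIntegral X μ ω)) P ∧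
      Tendsto (fun n : ℕ => ∫ ω, logAvgExp (fun i : Fin (n + 1) => X (t i) ω) ∂P) atTop
        (𝓝 (∫ ω, Real.log (expIntegral X μ ω) ∂P)) := by
  filter_upwards [hX.ae_tendsto_average μ] with t ht
  have hlim : ∀ᵐ ω ∂P, Tendsto (fun n : ℕ => logAvgExp fun i : Fin (n + 1) => X (t i) ω) atTop
        (𝓝 (Real.log (expIntegral X μ ω))) := by
    filter_upwards [ht, hX.ae_expIntegral_pos (IsProbabilityMeasure.ne_zero μ)] with ω hω hpos
    have h1 := (Real.continuousAt_log hpos.ne').tendsto.comp (hω.comp (tendsto_add_atTop_nat 1))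
    refine h1.congr fun n => ?_
    simp only [Function.comp]
    rw [← Real.log_exp (logAvgExp _), exp_logAvgExp, Finset.sum_range]
  have hsq := fun n : ℕ => hX.integrable_sq_logAvgExp (fun i : Fin (n + 1) => t i)
  have hm : Measurable fun ω => Real.log (expIntegral X μ ω) := (hX.measurable_expIntegral μ).log
  have hF := integrable_and_integral_le_of_tendsto (P := P)
    (f := fun n ω => (logAvgExp fun i : Fin (n + 1) => X (t i) ω) ^ 2)
    (g := fun ω => Real.log (expIntegral X μ ω) ^ 2) (fun n ω => sq_nonneg _)
    (fun n => (hsq n).1) (fun n => (hsq n).2) tendsto_const_nhds (by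
      filter_upwards [hlim] with ω hω using hω.pow 2)
  have hint := integrable_of_sq hm.aestronglyMeasurable hF.1
  exact ⟨hlim, hint, tendsto_integral_of_sq_bounded
    (fun n => integrable_of_sq (hX.measurable_logAvgExp _).aestronglyMeasurable (hsq n).1)
    (fun n => (hsq n).1) (fun n => (hsq n).2) hint hF.1 hF.2 hlim⟩

theorem integral_logAvgExp (hX : IsBoundedGaussian X P B V) {n : ℕ} (t : Fin (n + 1) → T) :
    ∫ ω, logAvgExp (fun i => X (t i) ω) ∂P
      = (∫ ω, logSumExp (fun i => X (t i) ω) ∂P) - Real.log (n + 1 : ℕ) := by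
  have hi := integrable_of_sq (hX.measurable_logAvgExp t).aestronglyMeasurable
    (hX.integrable_sq_logAvgExp t).1
  have hi' : Integrable (fun ω => logSumExp fun i => X (t i) ω) P := by
    refine (hi.add (integrable_const (Real.log (n + 1 : ℕ)))).congr (ae_of_all _ fun ω => ?_)
    simp [logAvgExp]
  simp only [logAvgExp]
  rw [integral_sub hi' (integrable_const _)]
  simp

theorem integral_exp_mul_logAvgExp_le (hX : IsBoundedGaussian X P B V) {n : ℕ}
    (t : Fin (n + 1) → T) (l : ℝ) :
    Integrable (fun ω => Real.exp (l * logAvgExp fun i => X (t i) ω)) P ∧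
    ∫ ω, Real.exp (l * logAvgExp fun i => X (t i) ω) ∂P
      ≤ Real.exp (l * (∫ ω, logAvgExp (fun i => X (t i) ω) ∂P) + l ^ 2 * V / 2) := by
  have hG := hX.hasGaussianLaw_fin t
  have e : ∀ ω, Real.exp (l * logAvgExp fun i => X (t i) ω)
      = Real.exp (-(l * Real.log (n + 1 : ℕ))) * Real.exp (l * logSumExp fun i => X (t i) ω) :=
    fun ω => by rw [← Real.exp_add, logAvgExp]; congr 1; ring
  simp_rw [e]
  refine ⟨(integrable_exp_mul_logSumExp hG l).const_mul _, ?_⟩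
  rw [integral_const_mul, hX.integral_logAvgExp]
  refine (mul_le_mul_of_nonneg_left (HasGaussianLaw.integral_exp_logSumExp_le hG
    (fun i => hX.cov_le (t i)) l) (Real.exp_pos _).le).trans (le_of_eq ?_)
  rw [← Real.exp_add]; congr 1; ring

theorem integrable_log_of_isProbabilityMeasure (hX : IsBoundedGaussian X P B V) (μ : Measure T)
    [IsProbabilityMeasure μ] : Integrable (fun ω => Real.log (expIntegral X μ ω)) P := by
  obtain ⟨t, -, ht, -⟩ := (hX.ae_tendsto_logAvgExp μ).exists
  exact ht

/-- One good sample sequence suffices: the finite-dimensional bound has a proxy `V` independent of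
the sample size, and Fatou passes it to the limit. -/
theorem integral_exp_mul_log_le_of_isProbabilityMeasure (hX : IsBoundedGaussian X P B V)
    (μ : Measure T) [IsProbabilityMeasure μ] (l : ℝ) :
    Integrable (fun ω => Real.exp (l * Real.log (expIntegral X μ ω))) P ∧
    ∫ ω, Real.exp (l * Real.log (expIntegral X μ ω)) ∂P
      ≤ Real.exp (l * (∫ ω, Real.log (expIntegral X μ ω) ∂P) + l ^ 2 * V / 2) := by
  obtain ⟨t, ht1, ht2, ht3⟩ := (hX.ae_tendsto_logAvgExp μ).exists
  refine integrable_and_integral_le_of_tendsto (P := P)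
    (f := fun n ω => Real.exp (l * logAvgExp fun i : Fin (n + 1) => X (t i) ω))
    (fun n ω => (Real.exp_pos _).le)
    (fun n => (hX.integral_exp_mul_logAvgExp_le _ l).1)
    (fun n => (hX.integral_exp_mul_logAvgExp_le _ l).2) ?_ ?_
  · exact (Real.continuous_exp.tendsto _).comp ((ht3.const_mul l).add_const _)
  · filter_upwards [ht1] with ω hω
    exact (Real.continuous_exp.tendsto _).comp (hω.const_mul l)

section Comparison

variable {Ω' : Type*} [MeasurableSpace Ω'] {P' : Measure Ω'} [IsProbabilityMeasure P']
  {Y : T → Ω' → ℝ} {B' V' : ℝ}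

/-- Almost every sample sequence is good for `X` and for `Y` simultaneously, so both processes are
discretized at the same points; the terms `log (n + 1)` cancel. -/
theorem integral_log_le_of_isProbabilityMeasure (hX : IsBoundedGaussian X P B V)
    (hY : IsBoundedGaussian Y P' B' V') (μ : Measure T) [IsProbabilityMeasure μ] {D : ℝ}
    (hdiag : ∀ t, (∫ ω, Y t ω ∂P') + cov[Y t, Y t; P'] / 2
      ≤ (∫ ω, X t ω ∂P) + cov[X t, X t; P] / 2)
    (hoff : ∀ s t, cov[X s, X t; P] ≤ cov[Y s, Y t; P'] + D) :
    ∫ ω, Real.log (expIntegral Y μ ω) ∂P'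
      ≤ (∫ ω, Real.log (expIntegral X μ ω) ∂P) + D / 2 := by
  obtain ⟨t, ⟨-, -, hX3⟩, ⟨-, -, hY3⟩⟩ :=
    ((hX.ae_tendsto_logAvgExp μ).and (hY.ae_tendsto_logAvgExp μ)).exists
  refine le_of_tendsto_of_tendsto' hY3 (hX3.add_const (D / 2)) fun n => ?_
  rw [hX.integral_logAvgExp, hY.integral_logAvgExp]
  have := HasGaussianLaw.integral_logSumExp_le (hX.hasGaussianLaw_fin fun i : Fin (n + 1) => t i)
    (hY.hasGaussianLaw_fin fun i : Fin (n + 1) => t i) (D := D) (fun i => hdiag _)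
    (fun i j => hoff _ _)
  linarith

end Comparison

end IsBoundedGaussian

/-! ### Quenched averages over finite measures -/

/-- The mean of the logarithm of the exponential integral. -/
noncomputable def meanLog {T Ω : Type*} [MeasurableSpace T] [MeasurableSpace Ω] (X : T → Ω → ℝ)
    (μ : Measure T) (P : Measure Ω) : ℝ := ∫ ω, Real.log (expIntegral X μ ω) ∂P

namespace IsBoundedGaussian

variable {T Ω : Type*} [MeasurableSpace T] [MeasurableSpace Ω] {X : T → Ω → ℝ} {P : Measure Ω}
  [IsProbabilityMeasure P] {B V : ℝ} {μ : Measure T} [IsFiniteMeasure μ]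

/-- Sampling requires a probability measure; normalizing a finite measure shifts the logarithm by a
deterministic constant only. -/
theorem log_expIntegral_eq (hX : IsBoundedGaussian X P B V) (hμ : μ ≠ 0) :
    (fun ω => Real.log (expIntegral X μ ω)) =ᵐ[P]
      fun ω => Real.log (μ.real Set.univ)
        + Real.log (expIntegral X ((μ Set.univ)⁻¹ • μ) ω) := by
  have : NeZero μ := ⟨hμ⟩
  have hpos : 0 < μ.real Set.univ := measureReal_univ_pos
  filter_upwards [hX.ae_expIntegral_pos (μ := (μ Set.univ)⁻¹ • μ)
    (IsProbabilityMeasure.ne_zero _)] with ω hω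
  rw [← Real.log_mul hpos.ne' hω.ne']
  congr 1
  unfold expIntegral
  rw [integral_smul_measure, ENNReal.toReal_inv, smul_eq_mul, ← mul_assoc]
  change _ = μ.real Set.univ * (μ.real Set.univ)⁻¹ * _
  rw [mul_inv_cancel₀ hpos.ne', one_mul]

theorem integrable_log (hX : IsBoundedGaussian X P B V) (hμ : μ ≠ 0) :
    Integrable (fun ω => Real.log (expIntegral X μ ω)) P := by
  have : NeZero μ := ⟨hμ⟩
  exact (((integrable_const _).add
    (hX.integrable_log_of_isProbabilityMeasure ((μ Set.univ)⁻¹ • μ))).congr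
      (hX.log_expIntegral_eq hμ).symm)

theorem meanLog_eq (hX : IsBoundedGaussian X P B V) (hμ : μ ≠ 0) :
    meanLog X μ P = Real.log (μ.real Set.univ) + meanLog X ((μ Set.univ)⁻¹ • μ) P := by
  have : NeZero μ := ⟨hμ⟩
  unfold meanLog
  rw [integral_congr_ae (hX.log_expIntegral_eq hμ), integral_add (integrable_const _)
    (hX.integrable_log_of_isProbabilityMeasure _)]
  simp

/-- Gaussian concentration of the logarithm of the exponential integral. -/
theorem hasSubgaussianMGF_log (hX : IsBoundedGaussian X P B V) (hμ : μ ≠ 0) :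
    HasSubgaussianMGF (fun ω => Real.log (expIntegral X μ ω) - meanLog X μ P) V.toNNReal P := by
  have : NeZero μ := ⟨hμ⟩
  obtain ⟨t⟩ := Measure.nonempty_of_neZero μ
  have hV : 0 ≤ V := hX.nonneg_var t
  set μ' := (μ Set.univ)⁻¹ • μ with hμ'
  have key : HasSubgaussianMGF (fun ω => Real.log (expIntegral X μ' ω) - meanLog X μ' P)
      V.toNNReal P := by
    have e : ∀ l ω, Real.exp (l * (Real.log (expIntegral X μ' ω) - meanLog X μ' P))
        = Real.exp (-(l * meanLog X μ' P)) * Real.exp (l * Real.log (expIntegral X μ' ω)) :=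
      fun l ω => by rw [← Real.exp_add]; congr 1; ring
    refine ⟨fun l => ?_, fun l => ?_⟩
    · simp_rw [e]
      exact (hX.integral_exp_mul_log_le_of_isProbabilityMeasure μ' l).1.const_mul _
    · unfold mgf
      simp_rw [e]
      rw [integral_const_mul, Real.coe_toNNReal _ hV]
      refine (mul_le_mul_of_nonneg_left
        (hX.integral_exp_mul_log_le_of_isProbabilityMeasure μ' l).2 (Real.exp_pos _).le).trans
        (le_of_eq ?_)
      rw [← Real.exp_add]; congr 1; unfold meanLog; ring
  refine key.congr ?_
  filter_upwards [hX.log_expIntegral_eq hμ] with ω hω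
  rw [hω, hX.meanLog_eq hμ]
  ring

/-- Follows from `|y| ≤ (exp (l y) + exp (-l y)) / l`. The parameter stays free; the choice of order
`1 / √V` makes this a bound of order `√V`. -/
theorem integral_abs_log_sub_le (hX : IsBoundedGaussian X P B V) (hμ : μ ≠ 0) {l : ℝ}
    (hl : 0 < l) :
    ∫ ω, |Real.log (expIntegral X μ ω) - meanLog X μ P| ∂P ≤ 2 * Real.exp (V * l ^ 2 / 2) / l := by
  have : NeZero μ := ⟨hμ⟩
  obtain ⟨t⟩ := Measure.nonempty_of_neZero μ
  have hV : 0 ≤ V := hX.nonneg_var t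
  have hs := hX.hasSubgaussianMGF_log hμ
  set Y := fun ω => Real.log (expIntegral X μ ω) - meanLog X μ P with hY
  have hle : ∀ ω, |Y ω| ≤ (Real.exp (l * Y ω) + Real.exp (-l * Y ω)) / l := fun ω => by
    rw [le_div_iff₀ hl, ← abs_of_pos hl, ← abs_mul, abs_of_pos hl, mul_comm]
    have h1 := Real.add_one_le_exp (l * Y ω)
    have h2 := Real.add_one_le_exp (-l * Y ω)
    have h3 := Real.exp_pos (l * Y ω)
    have h4 := Real.exp_pos (-l * Y ω)
    rw [abs_le]; constructor <;> linarith
  have hi := hs.integrable_exp_mul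
  have h1 := hs.mgf_le l
  have h2 := hs.mgf_le (-l)
  rw [Real.coe_toNNReal _ hV] at h1 h2
  rw [neg_sq] at h2
  unfold mgf at h1 h2
  refine (integral_mono hs.integrable.abs (((hi l).add (hi (-l))).div_const l) hle).trans ?_
  rw [integral_div]
  refine div_le_div_of_nonneg_right ?_ hl.le
  rw [integral_add' (hi l) (hi (-l))]
  linarith

/-- Monotonicity in the process and in the measure. -/
theorem meanLog_mono (hX : IsBoundedGaussian X P B V) {X' : T → Ω → ℝ} {B' V' : ℝ}
    (hX' : IsBoundedGaussian X' P B' V') {μ' : Measure T} [IsFiniteMeasure μ'] (hμ : μ ≠ 0)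
    (hle : μ ≤ μ') {c : ℝ} (hc : ∀ᵐ t ∂μ, ∀ ω, X t ω ≤ X' t ω + c) :
    meanLog X μ P ≤ meanLog X' μ' P + c := by
  have hμ' : μ' ≠ 0 := fun h => hμ (by rw [h] at hle; exact le_antisymm hle (Measure.zero_le μ))
  have e : meanLog X' μ' P + c = ∫ ω, (Real.log (expIntegral X' μ' ω) + c) ∂P := by
    rw [integral_add (hX'.integrable_log hμ') (integrable_const c)]; simp [meanLog]
  rw [e]
  refine integral_mono_ae (hX.integrable_log hμ)
    ((hX'.integrable_log hμ').add (integrable_const c)) ?_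
  filter_upwards [hX.ae_integrable_exp μ, hX'.ae_integrable_exp μ'] with ω h1 h2
  have p1 := integral_exp_pos' hμ h1
  have p2 : 0 < expIntegral X' μ' ω := integral_exp_pos' hμ' h2
  rw [← Real.log_exp c, ← Real.log_mul p2.ne' (Real.exp_pos c).ne']
  refine Real.log_le_log p1 ?_
  calc ∫ t, Real.exp (X t ω) ∂μ ≤ ∫ t, Real.exp (X' t ω) * Real.exp c ∂μ := by
        refine integral_mono_ae h1 ((h2.mono_measure hle).mul_const _) ?_
        filter_upwards [hc] with t ht
        rw [← Real.exp_add]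
        exact Real.exp_le_exp.2 (ht ω)
    _ = (∫ t, Real.exp (X' t ω) ∂μ) * Real.exp c := integral_mul_const _ _
    _ ≤ (∫ t, Real.exp (X' t ω) ∂μ') * Real.exp c := by
        refine mul_le_mul_of_nonneg_right ?_ (Real.exp_pos c).le
        exact integral_mono_measure hle (ae_of_all _ fun t => (Real.exp_pos _).le) h2

section Comparison

variable {Ω' : Type*} [MeasurableSpace Ω'] {P' : Measure Ω'} {B' V' : ℝ}
  [IsProbabilityMeasure P'] {Y : T → Ω' → ℝ}

theorem meanLog_le_of_covariance_le (hX : IsBoundedGaussian X P B V)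
    (hY : IsBoundedGaussian Y P' B' V') (hμ : μ ≠ 0) {D : ℝ}
    (hdiag : ∀ t, (∫ ω, Y t ω ∂P') + cov[Y t, Y t; P'] / 2
      ≤ (∫ ω, X t ω ∂P) + cov[X t, X t; P] / 2)
    (hoff : ∀ s t, cov[X s, X t; P] ≤ cov[Y s, Y t; P'] + D) :
    meanLog Y μ P' ≤ meanLog X μ P + D / 2 := by
  have : NeZero μ := ⟨hμ⟩
  rw [hX.meanLog_eq hμ, hY.meanLog_eq hμ]
  have := hX.integral_log_le_of_isProbabilityMeasure hY ((μ Set.univ)⁻¹ • μ) hdiag hoff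
  unfold meanLog
  linarith

end Comparison

/-- In a finite measurable cover, some piece carries almost all of the exponential integral. -/
theorem exists_meanLog_le_restrict (hX : IsBoundedGaussian X P B V) (hμ : μ ≠ 0)
    {ι : Type*} [Fintype ι] {A : ι → Set T} (hcover : ∀ t, ∃ i, t ∈ A i) {l : ℝ} (hl : 0 < l) :
    ∃ i, μ.restrict (A i) ≠ 0 ∧
      meanLog X μ P ≤ meanLog X (μ.restrict (A i)) P + Real.log (Fintype.card ι)
        + Fintype.card ι * (2 * Real.exp (V * l ^ 2 / 2) / l) := by
  classical
  -- Null pieces must be left out of the maximum: `Real.log 0 = 0` would give them the value zero,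
  -- which could exceed the value of every genuine piece.
  set I : Finset ι := Finset.univ.filter fun i => μ.restrict (A i) ≠ 0 with hI
  have hle : μ ≤ ∑ i, μ.restrict (A i) := by
    refine Measure.le_iff.2 fun s hs => ?_
    rw [Measure.finsetSum_apply]
    have hsub : s ⊆ ⋃ i ∈ (Finset.univ : Finset ι), s ∩ A i := fun t ht => by
      obtain ⟨i, hi⟩ := hcover t
      simp only [Set.mem_iUnion]
      exact ⟨i, Finset.mem_univ i, ht, hi⟩
    refine (measure_mono hsub).trans ((measure_biUnion_finset_le _ _).trans (le_of_eq ?_))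
    exact Finset.sum_congr rfl fun i _ => (Measure.restrict_apply hs).symm
  have hIne : I.Nonempty := by
    by_contra h
    rw [Finset.not_nonempty_iff_eq_empty, hI, Finset.filter_eq_empty_iff] at h
    refine hμ (le_antisymm (hle.trans (le_of_eq ?_)) (Measure.zero_le μ))
    exact Finset.sum_eq_zero fun i hi => not_not.1 (h hi)
  obtain ⟨i₀, hi₀, hmax⟩ := I.exists_max_image (fun i => meanLog X (μ.restrict (A i)) P) hIne
  have hmem : ∀ {i}, i ∈ I → μ.restrict (A i) ≠ 0 := fun {i} hi => (Finset.mem_filter.1 hi).2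
  refine ⟨i₀, hmem hi₀, ?_⟩
  have hcard : (0 : ℝ) < Fintype.card ι := by
    have : Nonempty ι := ⟨i₀⟩
    exact_mod_cast Fintype.card_pos
  set Y : ι → Ω → ℝ := fun i ω =>
    Real.log (expIntegral X (μ.restrict (A i)) ω) - meanLog X (μ.restrict (A i)) P with hY
  set a := meanLog X (μ.restrict (A i₀)) P with ha
  have hYi : ∀ i ∈ I, Integrable (fun ω => |Y i ω|) P := fun i hi =>
    ((hX.integrable_log (hmem hi)).sub (integrable_const _)).abs
  -- Each contributing piece has logarithm at most the largest mean `a` plus the sum of all absolute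
  -- fluctuations, so summing the pieces costs only the logarithm of their number.
  have hbound : ∀ᵐ ω ∂P, Real.log (expIntegral X μ ω)
      ≤ (a + Real.log (Fintype.card ι)) + ∑ i ∈ I, |Y i ω| := by
    have hall : ∀ᵐ ω ∂P, ∀ i, Integrable (fun t => Real.exp (X t ω)) (μ.restrict (A i)) :=
      ae_all_iff.2 fun i => hX.ae_integrable_exp _
    filter_upwards [hall, hX.ae_integrable_exp μ] with ω hω hωμ
    have hpos := integral_exp_pos' hμ hωμ
    set R := Real.exp (a + ∑ i ∈ I, |Y i ω|) with hR
    have hsum : Integrable (fun t => Real.exp (X t ω)) (∑ i, μ.restrict (A i)) :=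
      integrable_finsetSum_measure.2 fun i _ => hω i
    have h1 : expIntegral X μ ω ≤ Fintype.card ι * R := by
      calc expIntegral X μ ω ≤ ∫ t, Real.exp (X t ω) ∂(∑ i, μ.restrict (A i)) :=
            integral_mono_measure hle (ae_of_all _ fun t => (Real.exp_pos _).le) hsum
        _ = ∑ i, expIntegral X (μ.restrict (A i)) ω :=
            integral_finsetSum_measure fun i _ => hω i
        _ ≤ ∑ _i : ι, R := by
            refine Finset.sum_le_sum fun i _ => ?_
            by_cases hi : i ∈ I
            · have hp := integral_exp_pos' (hmem hi) (hω i)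
              refine (Real.log_le_iff_le_exp hp).1 ?_
              have h2 : |Y i ω| ≤ ∑ i ∈ I, |Y i ω| :=
                Finset.single_le_sum (f := fun i => |Y i ω|) (fun j _ => abs_nonneg _) hi
              have h3 := le_abs_self (Y i ω)
              have h4 := hmax i hi
              have h5 : Real.log (expIntegral X (μ.restrict (A i)) ω)
                  = Y i ω + meanLog X (μ.restrict (A i)) P := by simp only [hY]; ring
              unfold expIntegral at h5
              linarith
            · have h0 : μ.restrict (A i) = 0 := by
                by_contra h; exact hi (Finset.mem_filter.2 ⟨Finset.mem_univ i, h⟩)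
              rw [h0]
              simp only [expIntegral, integral_zero_measure]
              exact (Real.exp_pos _).le
        _ = Fintype.card ι * R := by simp
    calc Real.log (expIntegral X μ ω) ≤ Real.log (Fintype.card ι * R) := Real.log_le_log hpos h1
      _ = (a + Real.log (Fintype.card ι)) + ∑ i ∈ I, |Y i ω| := by
          rw [Real.log_mul hcard.ne' (Real.exp_pos _).ne', Real.log_exp]; ring
  have hi2 : Integrable (fun ω => ∑ i ∈ I, |Y i ω|) P := integrable_finsetSum _ hYi
  calc meanLog X μ P
      ≤ ∫ ω, ((a + Real.log (Fintype.card ι)) + ∑ i ∈ I, |Y i ω|) ∂P :=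
        integral_mono_ae (hX.integrable_log hμ) ((integrable_const _).add hi2) hbound
    _ = (a + Real.log (Fintype.card ι)) + ∑ i ∈ I, ∫ ω, |Y i ω| ∂P := by
        rw [integral_add (integrable_const _) hi2, integral_finsetSum _ hYi]; simp
    _ ≤ (a + Real.log (Fintype.card ι))
        + Fintype.card ι * (2 * Real.exp (V * l ^ 2 / 2) / l) := by
        gcongr
        calc ∑ i ∈ I, ∫ ω, |Y i ω| ∂P ≤ ∑ _i ∈ I, 2 * Real.exp (V * l ^ 2 / 2) / l :=
              Finset.sum_le_sum fun i hi => hX.integral_abs_log_sub_le (hmem hi) hl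
          _ = I.card * (2 * Real.exp (V * l ^ 2 / 2) / l) := by simp
          _ ≤ _ := by
              gcongr
              exact Finset.card_le_univ I

end IsBoundedGaussian

/-! ### Independent sums -/

section Product

variable {T₁ T₂ Ω₁ Ω₂ : Type*} [MeasurableSpace Ω₁] [MeasurableSpace Ω₂]
  {X₁ : T₁ → Ω₁ → ℝ} {X₂ : T₂ → Ω₂ → ℝ} {P₁ : Measure Ω₁} {P₂ : Measure Ω₂}
  [IsProbabilityMeasure P₁] [IsProbabilityMeasure P₂] {B₁ B₂ V₁ V₂ : ℝ}

/-- The sum of two processes driven by independent randomness. -/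
def independentSum (X₁ : T₁ → Ω₁ → ℝ) (X₂ : T₂ → Ω₂ → ℝ) (t : T₁ × T₂) (ω : Ω₁ × Ω₂) : ℝ :=
  X₁ t.1 ω.1 + X₂ t.2 ω.2

theorem HasGaussianLaw.comp_measurePreserving {Ω Ω' E : Type*} [MeasurableSpace Ω]
    [MeasurableSpace Ω'] [TopologicalSpace E] [AddCommMonoid E] [Module ℝ E] [MeasurableSpace E]
    {P : Measure Ω} {P' : Measure Ω'} {f : Ω → E} (hf : HasGaussianLaw f P) {g : Ω' → Ω}
    (hg : MeasurePreserving g P' P) : HasGaussianLaw (f ∘ g) P' where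
  isGaussian_map := by
    have hm : AEMeasurable f (P'.map g) := by rw [hg.map_eq]; exact hf.aemeasurable
    rw [← AEMeasurable.map_map_of_aemeasurable hm hg.measurable.aemeasurable, hg.map_eq]
    exact hf.isGaussian_map

theorem isGaussianProcess_independentSum (h₁ : IsGaussianProcess X₁ P₁)
    (h₂ : IsGaussianProcess X₂ P₂) :
    IsGaussianProcess (independentSum X₁ X₂) (P₁.prod P₂) where
  hasGaussianLaw I := by
    have g₁ : HasGaussianLaw (fun ω (i : I) => X₁ i.1.1 ω) P₁ := by
      have := ((h₁.comp_right fun i : I => i.1.1).hasGaussianLaw Finset.univ)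
      let L : (↥(Finset.univ : Finset I) → ℝ) →L[ℝ] (I → ℝ) :=
        ContinuousLinearMap.pi fun i => ContinuousLinearMap.proj ⟨i, Finset.mem_univ i⟩
      exact this.map L
    have g₂ : HasGaussianLaw (fun ω (i : I) => X₂ i.1.2 ω) P₂ := by
      have := ((h₂.comp_right fun i : I => i.1.2).hasGaussianLaw Finset.univ)
      let L : (↥(Finset.univ : Finset I) → ℝ) →L[ℝ] (I → ℝ) :=
        ContinuousLinearMap.pi fun i => ContinuousLinearMap.proj ⟨i, Finset.mem_univ i⟩
      exact this.map L
    have k₁ := HasGaussianLaw.comp_measurePreserving g₁ (measurePreserving_fst (μ := P₁) (ν := P₂))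
    have k₂ := HasGaussianLaw.comp_measurePreserving g₂ (measurePreserving_snd (μ := P₁) (ν := P₂))
    have hind := indepFun_prod₀ (μ := P₁) (ν := P₂) g₁.aemeasurable g₂.aemeasurable
    exact (IndepFun.hasGaussianLaw k₁ k₂ hind).add

theorem covariance_independentSum (h₁ : IsGaussianProcess X₁ P₁) (h₂ : IsGaussianProcess X₂ P₂)
    (s t : T₁ × T₂) :
    cov[independentSum X₁ X₂ s, independentSum X₁ X₂ t; P₁.prod P₂]
      = cov[X₁ s.1, X₁ t.1; P₁] + cov[X₂ s.2, X₂ t.2; P₂] := by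
  have m₁ := fun u => (h₁.hasGaussianLaw_eval u).memLp_two
  have m₂ := fun u => (h₂.hasGaussianLaw_eval u).memLp_two
  have e : ∀ u, independentSum X₁ X₂ u
      = (fun p : Ω₁ × Ω₂ => X₁ u.1 p.1) + fun p : Ω₁ × Ω₂ => X₂ u.2 p.2 := fun u => rfl
  rw [e, e, covariance_add_left ((m₁ _).comp_fst P₂) ((m₂ _).comp_snd P₁)
      (((m₁ _).comp_fst P₂).add ((m₂ _).comp_snd P₁)),
    covariance_add_right ((m₁ _).comp_fst P₂) ((m₁ _).comp_fst P₂) ((m₂ _).comp_snd P₁),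
    covariance_add_right ((m₂ _).comp_snd P₁) ((m₁ _).comp_fst P₂) ((m₂ _).comp_snd P₁),
    covariance_fst_snd_prod (m₁ _) (m₂ _), covariance_comm (fun p : Ω₁ × Ω₂ => X₂ s.2 p.2),
    covariance_fst_snd_prod (m₁ _) (m₂ _), add_zero, zero_add]
  have c₁ := covariance_map_fun (μ := P₁.prod P₂) (Z := Prod.fst) (X := X₁ s.1) (Y := X₁ t.1)
    (by rw [Measure.map_fst_prod]; simpa using (m₁ _).1)
    (by rw [Measure.map_fst_prod]; simpa using (m₁ _).1) (by fun_prop)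
  have c₂ := covariance_map_fun (μ := P₁.prod P₂) (Z := Prod.snd) (X := X₂ s.2) (Y := X₂ t.2)
    (by rw [Measure.map_snd_prod]; simpa using (m₂ _).1)
    (by rw [Measure.map_snd_prod]; simpa using (m₂ _).1) (by fun_prop)
  rw [Measure.map_fst_prod, measure_univ, one_smul] at c₁
  rw [Measure.map_snd_prod, measure_univ, one_smul] at c₂
  rw [c₁, c₂]

theorem integral_independentSum (h₁ : IsGaussianProcess X₁ P₁) (h₂ : IsGaussianProcess X₂ P₂)
    (t : T₁ × T₂) :
    ∫ ω, independentSum X₁ X₂ t ω ∂(P₁.prod P₂) = (∫ ω, X₁ t.1 ω ∂P₁) + ∫ ω, X₂ t.2 ω ∂P₂ := by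
  unfold independentSum
  rw [integral_add ((h₁.hasGaussianLaw_eval _).integrable.comp_fst P₂)
    ((h₂.hasGaussianLaw_eval _).integrable.comp_snd P₁), integral_fun_fst, integral_fun_snd]
  simp

variable [MeasurableSpace T₁] [MeasurableSpace T₂]

theorem IsBoundedGaussian.independentSum (h₁ : IsBoundedGaussian X₁ P₁ B₁ V₁)
    (h₂ : IsBoundedGaussian X₂ P₂ B₂ V₂) :
    IsBoundedGaussian (independentSum X₁ X₂) (P₁.prod P₂) (B₁ + B₂) (V₁ + V₂) where
  measurable := by
    have g₁ : Measurable fun p : (T₁ × T₂) × Ω₁ × Ω₂ => (p.1.1, p.2.1) := by fun_prop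
    have g₂ : Measurable fun p : (T₁ × T₂) × Ω₁ × Ω₂ => (p.1.2, p.2.2) := by fun_prop
    exact (h₁.measurable.comp g₁).add (h₂.measurable.comp g₂)
  gaussian := isGaussianProcess_independentSum h₁.gaussian h₂.gaussian
  mean_le t := by
    rw [integral_independentSum h₁.gaussian h₂.gaussian]
    exact (abs_add_le _ _).trans (add_le_add (h₁.mean_le _) (h₂.mean_le _))
  cov_le t := by
    rw [covariance_independentSum h₁.gaussian h₂.gaussian]
    exact add_le_add (h₁.cov_le _) (h₂.cov_le _)

/-- The exponential integral factorizes over the product measure. Almost sure positivity of the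
factors is what allows the logarithm to be split. -/
theorem meanLog_independentSum (h₁ : IsBoundedGaussian X₁ P₁ B₁ V₁)
    (h₂ : IsBoundedGaussian X₂ P₂ B₂ V₂) {μ₁ : Measure T₁} {μ₂ : Measure T₂}
    [IsFiniteMeasure μ₁] [IsFiniteMeasure μ₂] (hμ₁ : μ₁ ≠ 0) (hμ₂ : μ₂ ≠ 0) :
    meanLog (independentSum X₁ X₂) (μ₁.prod μ₂) (P₁.prod P₂)
      = meanLog X₁ μ₁ P₁ + meanLog X₂ μ₂ P₂ := by
  have e : ∀ ω : Ω₁ × Ω₂, expIntegral (independentSum X₁ X₂) (μ₁.prod μ₂) ω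
      = expIntegral X₁ μ₁ ω.1 * expIntegral X₂ μ₂ ω.2 := fun ω => by
    unfold expIntegral independentSum
    simp_rw [Real.exp_add]
    exact integral_prod_mul (fun s => Real.exp (X₁ s ω.1)) (fun s => Real.exp (X₂ s ω.2))
  have hae : ∀ᵐ ω ∂(P₁.prod P₂), Real.log (expIntegral (independentSum X₁ X₂) (μ₁.prod μ₂) ω)
      = Real.log (expIntegral X₁ μ₁ ω.1) + Real.log (expIntegral X₂ μ₂ ω.2) := by
    have a₁ := (measurePreserving_fst (μ := P₁) (ν := P₂)).quasiMeasurePreserving.ae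
      (h₁.ae_expIntegral_pos hμ₁)
    have a₂ := (measurePreserving_snd (μ := P₁) (ν := P₂)).quasiMeasurePreserving.ae
      (h₂.ae_expIntegral_pos hμ₂)
    filter_upwards [a₁, a₂] with ω p₁ p₂
    rw [e, Real.log_mul p₁.ne' p₂.ne']
  unfold meanLog
  rw [integral_congr_ae hae, integral_add ((h₁.integrable_log hμ₁).comp_fst P₂)
    ((h₂.integrable_log hμ₂).comp_snd P₁),
    integral_fun_fst (fun ω => Real.log (expIntegral X₁ μ₁ ω)),
    integral_fun_snd (fun ω => Real.log (expIntegral X₂ μ₂ ω))]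
  simp

end Product

/-! ### Reparametrization, deterministic shifts and the annealed bound -/

section Affine

variable {T Ω : Type*} [MeasurableSpace T] [MeasurableSpace Ω] {X : T → Ω → ℝ} {P : Measure Ω}
  {B V : ℝ}

theorem isGaussianProcess_sub_const {T Ω : Type*} [MeasurableSpace Ω] {X : T → Ω → ℝ}
    {P : Measure Ω} (hX : IsGaussianProcess X P) (k : T → ℝ) :
    IsGaussianProcess (fun t ω => X t ω - k t) P where
  hasGaussianLaw I := by
    have h := hX.hasGaussianLaw I
    refine ⟨?_⟩
    have := h.isGaussian_map
    have e : P.map (fun ω => I.restrict fun t => X t ω - k t)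
        = (P.map fun ω => I.restrict fun t => X t ω).map (fun x => x - I.restrict k) := by
      rw [AEMeasurable.map_map_of_aemeasurable (by fun_prop) h.aemeasurable]; rfl
    rw [e]; infer_instance

namespace IsBoundedGaussian

theorem integrable (hX : IsBoundedGaussian X P B V) (t : T) : Integrable (X t) P :=
  (hX.gaussian.hasGaussianLaw_eval t).integrable

theorem comp {T' : Type*} [MeasurableSpace T'] (hX : IsBoundedGaussian X P B V) {φ : T' → T}
    (hφ : Measurable φ) : IsBoundedGaussian (fun t => X (φ t)) P B V where
  measurable := by
    have hg : Measurable fun p : T' × Ω => (φ p.1, p.2) := by fun_prop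
    exact hX.measurable.comp hg
  gaussian := hX.gaussian.comp_right φ
  mean_le t := hX.mean_le _
  cov_le t := hX.cov_le _

theorem meanLog_map {T' : Type*} [MeasurableSpace T'] (hX : IsBoundedGaussian X P B V)
    {φ : T' → T} (hφ : Measurable φ) (μ : Measure T') :
    meanLog X (μ.map φ) P = meanLog (fun t => X (φ t)) μ P := by
  unfold meanLog expIntegral
  congr 1
  ext ω
  rw [integral_map hφ.aemeasurable (hX.measurable_left ω).exp.aestronglyMeasurable]

variable [IsProbabilityMeasure P]

theorem covariance_sub_const (hX : IsBoundedGaussian X P B V) (a b : ℝ) (s t : T) :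
    cov[fun ω => X s ω - a, fun ω => X t ω - b; P] = cov[X s, X t; P] := by
  rw [covariance_sub_const_left (hX.integrable s), covariance_sub_const_right (hX.integrable t)]

theorem sub_const (hX : IsBoundedGaussian X P B V) {k : T → ℝ} (hk : Measurable k) {K : ℝ}
    (hK : ∀ t, |k t| ≤ K) : IsBoundedGaussian (fun t ω => X t ω - k t) P (B + K) V where
  measurable := hX.measurable.sub (hk.comp measurable_fst)
  gaussian := isGaussianProcess_sub_const hX.gaussian k
  mean_le t := by
    rw [integral_sub (hX.integrable t) (integrable_const _)]
    simp only [integral_const, probReal_univ, one_smul]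
    exact (abs_sub _ _).trans (add_le_add (hX.mean_le t) (hK t))
  cov_le t := by
    rw [hX.covariance_sub_const]; exact hX.cov_le t

/-- The quenched average is bounded by the annealed one. -/
theorem meanLog_le (hX : IsBoundedGaussian X P B V) {μ : Measure T} [IsFiniteMeasure μ]
    (hμ : μ ≠ 0) : meanLog X μ P ≤ Real.log (μ.real Set.univ) + (B + V / 2) := by
  have : NeZero μ := ⟨hμ⟩
  have hpos : 0 < μ.real Set.univ := measureReal_univ_pos
  set c := μ.real Set.univ * Real.exp (B + V / 2) with hc
  have hc0 : 0 < c := by positivity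
  have hZi : Integrable (expIntegral X μ) P := (hX.integrable_exp_prod μ).integral_prod_right
  have hEZ : ∫ ω, expIntegral X μ ω ∂P ≤ c := by
    unfold expIntegral
    rw [integral_integral_swap
      (f := fun ω t => Real.exp (X t ω)) (by exact (hX.integrable_exp_prod μ).swap)]
    calc ∫ t, ∫ ω, Real.exp (X t ω) ∂P ∂μ ≤ ∫ _ : T, Real.exp (B + V / 2) ∂μ := by
          refine integral_mono (hX.integrable_exp_prod μ).integral_prod_left
            (integrable_const _) fun t => ?_
          simpa using hX.integral_exp_mul_le t (l := 1) abs_one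
      _ = c := by simp [hc]
  -- Jensen's inequality for the logarithm, obtained from its tangent line at the upper bound `c` of
  -- the annealed mean.
  have hlog : ∀ᵐ ω ∂P, Real.log (expIntegral X μ ω)
      ≤ expIntegral X μ ω / c + (Real.log c - 1) := by
    filter_upwards [hX.ae_expIntegral_pos hμ] with ω hω
    have h := Real.log_le_sub_one_of_pos (div_pos hω hc0)
    rw [Real.log_div hω.ne' hc0.ne'] at h
    linarith
  have e : Real.log c = Real.log (μ.real Set.univ) + (B + V / 2) := by
    rw [hc, Real.log_mul hpos.ne' (Real.exp_pos _).ne', Real.log_exp]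
  calc meanLog X μ P ≤ ∫ ω, (expIntegral X μ ω / c + (Real.log c - 1)) ∂P :=
        integral_mono_ae (hX.integrable_log hμ) ((hZi.div_const c).add (integrable_const _)) hlog
    _ = (∫ ω, expIntegral X μ ω ∂P) / c + (Real.log c - 1) := by
        rw [integral_add (hZi.div_const c) (integrable_const _), integral_div]; simp
    _ ≤ 1 + (Real.log c - 1) := by
        gcongr
        exact (div_le_one hc0).2 hEZ
    _ = _ := by rw [← e]; ring

end IsBoundedGaussian

end Affine

/-! ### Concatenation of configurations -/

section Append

variable {α : Type*} [MeasurableSpace α]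

theorem measurable_fin_append (m n : ℕ) :
    Measurable fun p : (Fin m → α) × (Fin n → α) => Fin.append p.1 p.2 := by
  refine measurable_pi_lambda _ fun i => ?_
  induction i using Fin.addCases with
  | left i => simp only [Fin.append_left]; fun_prop
  | right i => simp only [Fin.append_right]; fun_prop

theorem map_append_pi_prod_pi (ν : Measure α) [IsFiniteMeasure ν] (m n : ℕ) :
    ((Measure.pi fun _ : Fin m => ν).prod (Measure.pi fun _ : Fin n => ν)).map
      (fun p => Fin.append p.1 p.2) = Measure.pi fun _ : Fin (m + n) => ν := by
  refine (Measure.pi_eq fun s hs => ?_).symm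
  rw [Measure.map_apply (measurable_fin_append m n) (MeasurableSet.univ_pi hs)]
  have e : (fun p : (Fin m → α) × (Fin n → α) => Fin.append p.1 p.2) ⁻¹' Set.univ.pi s
      = (Set.univ.pi fun i => s (Fin.castAdd n i)) ×ˢ Set.univ.pi fun i => s (Fin.natAdd m i) := by
    ext p
    simp only [Set.mem_preimage, Set.mem_pi, Set.mem_univ, forall_const, Set.mem_prod,
      Fin.forall_fin_add, Fin.append_left, Fin.append_right]
  rw [e, Measure.prod_prod, Measure.pi_pi, Measure.pi_pi, Fin.prod_univ_add]

/-- Only an inequality, since a configuration in `A` may have blocks outside `A₁` or `A₂`. It is all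
that the lower bound on the larger system needs. -/
theorem map_append_restrict_le (ν : Measure α) [IsFiniteMeasure ν] {m n : ℕ}
    {A₁ : Set (Fin m → α)} {A₂ : Set (Fin n → α)} {A : Set (Fin (m + n) → α)}
    (hA : ∀ σ ∈ A₁, ∀ τ ∈ A₂, Fin.append σ τ ∈ A) :
    ((((Measure.pi fun _ : Fin m => ν).restrict A₁).prod
      ((Measure.pi fun _ : Fin n => ν).restrict A₂)).map fun p => Fin.append p.1 p.2)
      ≤ (Measure.pi fun _ : Fin (m + n) => ν).restrict A := by
  refine Measure.le_iff.2 fun s hs => ?_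
  have hm := measurable_fin_append (α := α) m n
  rw [Measure.prod_restrict, Measure.map_apply hm hs, Measure.restrict_apply (hm hs),
    Measure.restrict_apply hs, ← map_append_pi_prod_pi ν m n]
  refine le_trans (measure_mono ?_) (Measure.le_map_apply hm.aemeasurable _)
  rintro ⟨σ, τ⟩ ⟨h1, h2, h3⟩
  exact ⟨h1, hA σ h2 τ h3⟩

end Append

/-! ### The mean-field model and its compensated energies -/

namespace SpinGlass

/-- Gaussian Hamiltonians of all sizes whose mean and covariance per site are, up to a bounded
total correction, functions of additive order parameters, the covariance being a convex function
of the overlaps. -/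
structure IsMeanFieldModel {n : ℕ} {S : Set (EuclideanSpace ℝ (Fin n))} {Ω : Type*}
    [MeasurableSpace Ω] (P : Measure Ω) (H : (N : ℕ) → Config S N → Ω → ℝ) {k : ℕ} (M : ℝ)
    (g : (Fin k → ℝ) → ℝ) (m : Fin k → (N : ℕ) → Config S N → ℝ) (Cb : ℝ)
    (f : (Fin k → ℝ) → ℝ) (Q : Fin k → (N : ℕ) → Config S N → Config S N → ℝ) (Cc : ℝ) :
    Prop where
  measurable : ∀ N : ℕ, 1 ≤ N → Measurable (fun p : Config S N × Ω => H N p.1 p.2)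
  gaussian : ∀ N : ℕ, 1 ≤ N → IsGaussianProcess (H N) P
  continuous_mean : Continuous g
  measurable_magnetization : ∀ i, ∀ N : ℕ, 1 ≤ N → Measurable (m i N)
  magnetization_le : ∀ i, ∀ N : ℕ, 1 ≤ N → ∀ σ, |m i N σ| ≤ M
  magnetization_add : ∀ i, IsSizeAdditive (m i)
  mean_sub_le : ∀ N : ℕ, 1 ≤ N → ∀ σ : Config S N,
    |(∫ ω, H N σ ω ∂P) / N - g (fun i => m i N σ)| ≤ Cb / N
  continuous_cov : Continuous f
  convex_cov : ConvexOn ℝ Set.univ f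
  measurable_overlap : ∀ i, ∀ N : ℕ, 1 ≤ N →
    Measurable (fun p : Config S N × Config S N => Q i N p.1 p.2)
  overlap_le : ∀ i, ∀ N : ℕ, 1 ≤ N → ∀ σ, |Q i N σ σ| ≤ M
  overlap_add : ∀ i, IsSizeAdditive₂ (Q i)
  cov_sub_le : ∀ N : ℕ, 1 ≤ N → ∀ σ τ : Config S N,
    |covariance (H N σ) (H N τ) P / N - f (fun i => Q i N σ τ)| ≤ Cc / N

theorem abs_le_maxAbsOnCube {k : ℕ} {f : (Fin k → ℝ) → ℝ} (hf : Continuous f) {M : ℝ}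
    {x : Fin k → ℝ} (hx : ∀ i, |x i| ≤ M) : |f x| ≤ maxAbsOnCube f M := by
  have hc : IsCompact {x : Fin k → ℝ | ∀ i, |x i| ≤ M} := by
    have : {x : Fin k → ℝ | ∀ i, |x i| ≤ M} = Set.univ.pi fun _ => Set.Icc (-M) M := by
      ext x; simp only [Set.mem_ofPred_eq, Set.mem_pi, Set.mem_univ, forall_const, Set.mem_Icc,
        abs_le]
    rw [this]
    exact isCompact_univ_pi fun _ => isCompact_Icc
  exact le_csSup (hc.image hf.abs).bddAbove ⟨x, hx, rfl⟩

/-- The compensator: the mean plus half the variance of `-β H_N(σ)`. -/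
noncomputable def compensator {n : ℕ} {S : Set (EuclideanSpace ℝ (Fin n))} {Ω : Type*}
    [MeasurableSpace Ω] (P : Measure Ω) (H : (N : ℕ) → Config S N → Ω → ℝ) (β : ℝ) (N : ℕ)
    (σ : Config S N) : ℝ :=
  -β * (∫ ω, H N σ ω ∂P) + β ^ 2 * covariance (H N σ) (H N σ) P / 2

/-- The order parameters of a configuration: magnetizations and self-overlaps. -/
def orderParameter {n : ℕ} {S : Set (EuclideanSpace ℝ (Fin n))} {k : ℕ}
    (m : Fin k → (N : ℕ) → Config S N → ℝ)
    (Q : Fin k → (N : ℕ) → Config S N → Config S N → ℝ) (N : ℕ) (σ : Config S N) :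
    (Fin k → ℝ) × (Fin k → ℝ) := (fun i => m i N σ, fun i => Q i N σ σ)

/-- The process `-β H_N`. -/
noncomputable def energy {n : ℕ} {S : Set (EuclideanSpace ℝ (Fin n))} {Ω : Type*}
    (H : (N : ℕ) → Config S N → Ω → ℝ) (β : ℝ) (N : ℕ) (σ : Config S N) (ω : Ω) : ℝ :=
  -β * H N σ ω

/-- The compensated process, whose exponential has mean one at each configuration. -/
noncomputable def compensated {n : ℕ} {S : Set (EuclideanSpace ℝ (Fin n))} {Ω : Type*}
    [MeasurableSpace Ω] (P : Measure Ω) (H : (N : ℕ) → Config S N → Ω → ℝ) (β : ℝ) (N : ℕ)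
    (σ : Config S N) (ω : Ω) : ℝ := energy H β N σ ω - compensator P H β N σ

/-- The compensator per site as a function of the order parameters. -/
noncomputable def siteCompensator {k : ℕ} (g f : (Fin k → ℝ) → ℝ) (β : ℝ)
    (x : (Fin k → ℝ) × (Fin k → ℝ)) : ℝ := -β * g x.1 + β ^ 2 * f x.2 / 2

namespace IsMeanFieldModel

variable {n : ℕ} {S : Set (EuclideanSpace ℝ (Fin n))} {Ω : Type*}
  [MeasurableSpace Ω] {P : Measure Ω}
  {H : (N : ℕ) → Config S N → Ω → ℝ} {k : ℕ} {M : ℝ}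
  {g : (Fin k → ℝ) → ℝ} {m : Fin k → (N : ℕ) → Config S N → ℝ} {Cb : ℝ}
  {f : (Fin k → ℝ) → ℝ} {Q : Fin k → (N : ℕ) → Config S N → Config S N → ℝ} {Cc : ℝ}

theorem abs_mean_sub_le (h : IsMeanFieldModel P H M g m Cb f Q Cc) {N : ℕ} (hN : 1 ≤ N)
    (σ : Config S N) : |(∫ ω, H N σ ω ∂P) - N * g (fun i => m i N σ)| ≤ Cb := by
  have hN' : (0 : ℝ) < N := by exact_mod_cast hN
  have h1 := mul_le_mul_of_nonneg_left (h.mean_sub_le N hN σ) hN'.le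
  rw [← abs_of_pos hN', ← abs_mul, abs_of_pos hN', mul_sub, mul_div_cancel₀ _ hN'.ne',
    mul_div_cancel₀ _ hN'.ne'] at h1
  exact h1

theorem abs_cov_sub_le (h : IsMeanFieldModel P H M g m Cb f Q Cc) {N : ℕ} (hN : 1 ≤ N)
    (σ τ : Config S N) :
    |covariance (H N σ) (H N τ) P - N * f (fun i => Q i N σ τ)| ≤ Cc := by
  have hN' : (0 : ℝ) < N := by exact_mod_cast hN
  have h1 := mul_le_mul_of_nonneg_left (h.cov_sub_le N hN σ τ) hN'.le
  rw [← abs_of_pos hN', ← abs_mul, abs_of_pos hN', mul_sub, mul_div_cancel₀ _ hN'.ne',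
    mul_div_cancel₀ _ hN'.ne'] at h1
  exact h1

theorem cov_self_le (h : IsMeanFieldModel P H M g m Cb f Q Cc) {N : ℕ} (hN : 1 ≤ N)
    (σ : Config S N) :
    covariance (H N σ) (H N σ) P ≤ N * (maxAbsOnCube f M + Cc / N) := by
  have hN' : (0 : ℝ) < N := by exact_mod_cast hN
  have h1 := (abs_le.1 (h.abs_cov_sub_le hN σ σ)).2
  have h2 := (le_abs_self _).trans
    (abs_le_maxAbsOnCube h.continuous_cov (fun i => h.overlap_le i N hN σ))
  have h3 := mul_le_mul_of_nonneg_left h2 hN'.le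
  rw [mul_add, mul_div_cancel₀ _ hN'.ne']
  linarith

theorem abs_mean_le (h : IsMeanFieldModel P H M g m Cb f Q Cc) {N : ℕ} (hN : 1 ≤ N)
    (σ : Config S N) : |∫ ω, H N σ ω ∂P| ≤ N * maxAbsOnCube g M + Cb := by
  have hN' : (0 : ℝ) < N := by exact_mod_cast hN
  have h2 := abs_le_maxAbsOnCube h.continuous_mean (fun i => h.magnetization_le i N hN σ)
  have h3 := mul_le_mul_of_nonneg_left h2 hN'.le
  have h4 := abs_sub_abs_le_abs_sub (∫ ω, H N σ ω ∂P) (N * g (fun i => m i N σ))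
  rw [abs_mul, abs_of_pos hN'] at h4
  linarith [h.abs_mean_sub_le hN σ]

theorem covariance_energy (β : ℝ) (N : ℕ) (σ τ : Config S N) :
    covariance (energy H β N σ) (energy H β N τ) P
      = β ^ 2 * covariance (H N σ) (H N τ) P := by
  have e : ∀ σ, energy H β N σ = fun ω => -β * H N σ ω := fun σ => rfl
  rw [e, e, covariance_const_mul_left, covariance_const_mul_right]
  ring

theorem measurable_orderParameter (h : IsMeanFieldModel P H M g m Cb f Q Cc) {N : ℕ}
    (hN : 1 ≤ N) : Measurable (orderParameter m Q N) := by
  have hd : Measurable fun σ : Config S N => (σ, σ) := by fun_prop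
  exact (measurable_pi_lambda _ fun i => h.measurable_magnetization i N hN).prodMk
    (measurable_pi_lambda _ fun i => (h.measurable_overlap i N hN).comp hd)

theorem norm_orderParameter_le (h : IsMeanFieldModel P H M g m Cb f Q Cc) {N : ℕ}
    (hN : 1 ≤ N) (σ : Config S N) : ‖orderParameter m Q N σ‖ ≤ |M| := by
  refine norm_prod_le_iff.2 ⟨?_, ?_⟩
  · exact (pi_norm_le_iff_of_nonneg (abs_nonneg M)).2 fun i =>
      (h.magnetization_le i N hN σ).trans (le_abs_self M)
  · exact (pi_norm_le_iff_of_nonneg (abs_nonneg M)).2 fun i =>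
      (h.overlap_le i N hN σ).trans (le_abs_self M)

theorem orderParameter_append (h : IsMeanFieldModel P H M g m Cb f Q Cc) {N₁ N₂ : ℕ}
    (h₁ : 1 ≤ N₁) (h₂ : 1 ≤ N₂) (σ₁ : Config S N₁) (σ₂ : Config S N₂) :
    ((N₁ + N₂ : ℕ) : ℝ) • orderParameter m Q (N₁ + N₂) (Fin.append σ₁ σ₂)
      = (N₁ : ℝ) • orderParameter m Q N₁ σ₁ + (N₂ : ℝ) • orderParameter m Q N₂ σ₂ := by
  refine Prod.ext (funext fun i => ?_) (funext fun i => ?_)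
  · exact h.magnetization_add i N₁ N₂ h₁ h₂ σ₁ σ₂
  · exact h.overlap_add i N₁ N₂ h₁ h₂ σ₁ σ₁ σ₂ σ₂

theorem abs_compensator_sub_le (h : IsMeanFieldModel P H M g m Cb f Q Cc) {β : ℝ} (hβ : 0 < β)
    {N : ℕ} (hN : 1 ≤ N) (σ : Config S N) :
    |compensator P H β N σ - N * siteCompensator g f β (orderParameter m Q N σ)|
      ≤ β * Cb + β ^ 2 * Cc / 2 := by
  have e : compensator P H β N σ - N * siteCompensator g f β (orderParameter m Q N σ)
      = -β * ((∫ ω, H N σ ω ∂P) - N * g (fun i => m i N σ))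
        + β ^ 2 / 2 * (covariance (H N σ) (H N σ) P - N * f (fun i => Q i N σ σ)) := by
    simp only [compensator, siteCompensator, orderParameter]; ring
  rw [e]
  refine (abs_add_le _ _).trans ?_
  rw [abs_mul, abs_mul, abs_neg, abs_of_pos hβ, abs_of_nonneg (by positivity : 0 ≤ β ^ 2 / 2)]
  have h1 := mul_le_mul_of_nonneg_left (h.abs_mean_sub_le hN σ) hβ.le
  have h2 := mul_le_mul_of_nonneg_left (h.abs_cov_sub_le hN σ σ)
    (by positivity : 0 ≤ β ^ 2 / 2)
  linarith

theorem continuous_siteCompensator (h : IsMeanFieldModel P H M g m Cb f Q Cc) (β : ℝ) :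
    Continuous (siteCompensator g f β) := by
  have h1 := h.continuous_mean
  have h2 := h.continuous_cov
  unfold siteCompensator
  fun_prop

/-- The overlap of concatenated configurations is the convex combination of the block overlaps with
weights `N₁ / N` and `N₂ / N`, where `N = N₁ + N₂`, so convexity of `f` gives the inequality.
Replacing three covariances by values of `f` costs `Cc` each. -/
theorem cov_append_le (h : IsMeanFieldModel P H M g m Cb f Q Cc) {N₁ N₂ : ℕ}
    (h₁ : 1 ≤ N₁) (h₂ : 1 ≤ N₂) (σ₁ τ₁ : Config S N₁) (σ₂ τ₂ : Config S N₂) :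
    covariance (H (N₁ + N₂) (Fin.append σ₁ σ₂)) (H (N₁ + N₂) (Fin.append τ₁ τ₂)) P
      ≤ covariance (H N₁ σ₁) (H N₁ τ₁) P + covariance (H N₂ σ₂) (H N₂ τ₂) P + 3 * Cc := by
  have a := (abs_le.1 (h.abs_cov_sub_le (N := N₁ + N₂) (by omega)
    (Fin.append σ₁ σ₂) (Fin.append τ₁ τ₂))).2
  have b := (abs_le.1 (h.abs_cov_sub_le h₁ σ₁ τ₁)).1
  have c := (abs_le.1 (h.abs_cov_sub_le h₂ σ₂ τ₂)).1
  have p₁ : (0 : ℝ) < N₁ := by exact_mod_cast h₁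
  have p₂ : (0 : ℝ) < N₂ := by exact_mod_cast h₂
  have hN : ((N₁ + N₂ : ℕ) : ℝ) = N₁ + N₂ := by push_cast; ring
  set s : ℝ := (N₁ : ℝ) + N₂ with hs
  have ps : 0 < s := by positivity
  have hconv := h.convex_cov.2 (Set.mem_univ fun i => Q i N₁ σ₁ τ₁)
    (Set.mem_univ fun i => Q i N₂ σ₂ τ₂) (by positivity : 0 ≤ (N₁ : ℝ) / s)
    (by positivity : 0 ≤ (N₂ : ℝ) / s) (by rw [← add_div, div_self ps.ne'])
  have e : (fun i => Q i (N₁ + N₂) (Fin.append σ₁ σ₂) (Fin.append τ₁ τ₂))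
      = ((N₁ : ℝ) / s) • (fun i => Q i N₁ σ₁ τ₁) + ((N₂ : ℝ) / s) • fun i => Q i N₂ σ₂ τ₂ := by
    ext i
    have := h.overlap_add i N₁ N₂ h₁ h₂ σ₁ τ₁ σ₂ τ₂
    rw [hN] at this
    simp only [Pi.add_apply, Pi.smul_apply, smul_eq_mul]
    field_simp
    rw [mul_comm]; exact this
  rw [e, hN] at a
  have hm := mul_le_mul_of_nonneg_left hconv ps.le
  simp only [smul_eq_mul] at hm
  have e2 : s * (N₁ / s * f (fun i => Q i N₁ σ₁ τ₁) + N₂ / s * f fun i => Q i N₂ σ₂ τ₂)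
      = N₁ * f (fun i => Q i N₁ σ₁ τ₁) + N₂ * f fun i => Q i N₂ σ₂ τ₂ := by
    field_simp
  rw [e2] at hm
  linarith

theorem isBoundedGaussian_energy (h : IsMeanFieldModel P H M g m Cb f Q Cc) {β : ℝ} (hβ : 0 < β)
    {N : ℕ} (hN : 1 ≤ N) {V : ℝ} (hV : ∀ σ, covariance (H N σ) (H N σ) P ≤ V) :
    IsBoundedGaussian (energy H β N) P (β * (N * maxAbsOnCube g M + Cb)) (β ^ 2 * V) where
  measurable := (h.measurable N hN).const_mul (-β)
  gaussian := (h.gaussian N hN).smul fun _ => -β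
  mean_le σ := by
    unfold energy
    rw [integral_const_mul, abs_mul, abs_neg, abs_of_pos hβ]
    exact mul_le_mul_of_nonneg_left (h.abs_mean_le hN σ) hβ.le
  cov_le σ := by
    rw [covariance_energy]
    exact mul_le_mul_of_nonneg_left (hV σ) (sq_nonneg β)

/-- A nonzero `ν` forces `S` to be nonempty, and the variance at a constant configuration is
nonnegative. -/
theorem nonneg_of_covariance_le (h : IsMeanFieldModel P H M g m Cb f Q Cc) {ν : Measure S}
    (hν : ν ≠ 0) {N : ℕ} (hN : 1 ≤ N) {L : ℝ}
    (hL : ∀ σ, covariance (H N σ) (H N σ) P ≤ N * L) : 0 ≤ L := by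
  have : NeZero ν := ⟨hν⟩
  obtain ⟨s⟩ : Nonempty S := ν.nonempty_of_neZero
  have hN' : (0 : ℝ) < N := by exact_mod_cast hN
  have h0 := hL fun _ => s
  rw [covariance_self ((h.gaussian N hN).aemeasurable _)] at h0
  exact nonneg_of_mul_nonneg_right ((variance_nonneg _ _).trans h0) hN'

variable [IsProbabilityMeasure P]

theorem measurable_mean (h : IsMeanFieldModel P H M g m Cb f Q Cc) {N : ℕ} (hN : 1 ≤ N) :
    Measurable fun σ => ∫ ω, H N σ ω ∂P :=
  (h.measurable N hN).stronglyMeasurable.integral_prod_right'.measurable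

theorem measurable_compensator (h : IsMeanFieldModel P H M g m Cb f Q Cc) (β : ℝ) {N : ℕ}
    (hN : 1 ≤ N) : Measurable (compensator P H β N) := by
  have h1 := h.measurable_mean hN
  have h2 : Measurable fun p : Config S N × Ω => H N p.1 p.2 - ∫ ω, H N p.1 ω ∂P :=
    (h.measurable N hN).sub (h1.comp measurable_fst)
  have h3 : Measurable fun σ => covariance (H N σ) (H N σ) P :=
    (h2.mul h2).stronglyMeasurable.integral_prod_right'.measurable
  exact (h1.const_mul _).add ((h3.const_mul _).div_const _)

theorem isBoundedGaussian_compensated (h : IsMeanFieldModel P H M g m Cb f Q Cc) {β : ℝ}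
    (hβ : 0 < β) {N : ℕ} (hN : 1 ≤ N) :
    ∃ B V, IsBoundedGaussian (compensated P H β N) P B V := by
  have h1 := h.isBoundedGaussian_energy hβ hN (h.cov_self_le hN)
  refine ⟨_, _, h1.sub_const (h.measurable_compensator β hN)
    (K := β * (N * maxAbsOnCube g M + Cb) + β ^ 2 * (N * (maxAbsOnCube f M + Cc / N)) / 2)
    fun σ => ?_⟩
  unfold compensator
  refine (abs_add_le _ _).trans (add_le_add ?_ ?_)
  · rw [abs_mul, abs_neg, abs_of_pos hβ]
    exact mul_le_mul_of_nonneg_left (h.abs_mean_le hN σ) hβ.le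
  · have h0 : 0 ≤ covariance (H N σ) (H N σ) P := by
      rw [covariance_self ((h.gaussian N hN).aemeasurable σ)]; exact variance_nonneg _ _
    rw [abs_of_nonneg (by positivity)]
    have := mul_le_mul_of_nonneg_left (h.cov_self_le hN σ) (sq_nonneg β)
    linarith

theorem covariance_compensated (h : IsMeanFieldModel P H M g m Cb f Q Cc) {β : ℝ}
    (hβ : 0 < β) {N : ℕ} (hN : 1 ≤ N) (σ τ : Config S N) :
    covariance (compensated P H β N σ) (compensated P H β N τ) P
      = β ^ 2 * covariance (H N σ) (H N τ) P := by
  have h1 := h.isBoundedGaussian_energy hβ hN (h.cov_self_le hN)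
  exact (h1.covariance_sub_const _ _ σ τ).trans (covariance_energy β N σ τ)

/-- This turns the diagonal condition of the Gaussian comparison into an equality, leaving only the
covariance inequality to be checked. -/
theorem mean_add_half_covariance_compensated (h : IsMeanFieldModel P H M g m Cb f Q Cc) {β : ℝ}
    (hβ : 0 < β) {N : ℕ} (hN : 1 ≤ N) (σ : Config S N) :
    (∫ ω, compensated P H β N σ ω ∂P)
      + covariance (compensated P H β N σ) (compensated P H β N σ) P / 2 = 0 := by
  have h1 := h.isBoundedGaussian_energy hβ hN (h.cov_self_le hN)
  rw [h.covariance_compensated hβ hN]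
  unfold compensated
  rw [integral_sub (h1.integrable σ) (integrable_const _)]
  unfold energy
  rw [integral_const_mul]
  simp only [integral_const, probReal_univ, one_smul, compensator]
  ring

variable {ν : Measure S} [IsFiniteMeasure ν]

/-- Superadditivity of the compensated quenched averages, up to a constant. -/
theorem meanLog_compensated_append (h : IsMeanFieldModel P H M g m Cb f Q Cc) {β : ℝ}
    (hβ : 0 < β) {N₁ N₂ : ℕ} (h₁ : 1 ≤ N₁) (h₂ : 1 ≤ N₂)
    {A₁ : Set (Config S N₁)} {A₂ : Set (Config S N₂)} {A : Set (Config S (N₁ + N₂))}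
    (hA₁ : (Measure.pi fun _ : Fin N₁ => ν).restrict A₁ ≠ 0)
    (hA₂ : (Measure.pi fun _ : Fin N₂ => ν).restrict A₂ ≠ 0)
    (hA : ∀ σ ∈ A₁, ∀ τ ∈ A₂, Fin.append σ τ ∈ A) :
    (Measure.pi fun _ : Fin (N₁ + N₂) => ν).restrict A ≠ 0 ∧
    meanLog (compensated P H β N₁) ((Measure.pi fun _ : Fin N₁ => ν).restrict A₁) P
      + meanLog (compensated P H β N₂) ((Measure.pi fun _ : Fin N₂ => ν).restrict A₂) P
      ≤ meanLog (compensated P H β (N₁ + N₂))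
        ((Measure.pi fun _ : Fin (N₁ + N₂) => ν).restrict A) P + 3 * β ^ 2 * Cc / 2 := by
  obtain ⟨B₁, V₁, g₁⟩ := h.isBoundedGaussian_compensated hβ h₁
  obtain ⟨B₂, V₂, g₂⟩ := h.isBoundedGaussian_compensated hβ h₂
  obtain ⟨B, V, g₃⟩ := h.isBoundedGaussian_compensated hβ (N := N₁ + N₂) (by omega)
  set μ₁ := (Measure.pi fun _ : Fin N₁ => ν).restrict A₁ with hμ₁
  set μ₂ := (Measure.pi fun _ : Fin N₂ => ν).restrict A₂ with hμ₂
  set app : Config S N₁ × Config S N₂ → Config S (N₁ + N₂) := fun p => Fin.append p.1 p.2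
    with happ
  have hm : Measurable app := measurable_fin_append N₁ N₂
  have hle : (μ₁.prod μ₂).map app ≤ (Measure.pi fun _ : Fin (N₁ + N₂) => ν).restrict A :=
    map_append_restrict_le ν hA
  have hprod : μ₁.prod μ₂ ≠ 0 := fun h0 => by
    have h1 := Measure.prod_prod (μ := μ₁) (ν := μ₂) Set.univ Set.univ
    rw [h0, Measure.coe_zero, Pi.zero_apply] at h1
    rcases mul_eq_zero.1 h1.symm with h2 | h2
    · exact hA₁ (Measure.measure_univ_eq_zero.1 h2)
    · exact hA₂ (Measure.measure_univ_eq_zero.1 h2)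
  have hmap : (μ₁.prod μ₂).map app ≠ 0 := by
    rwa [Ne, Measure.map_eq_zero_iff hm.aemeasurable]
  refine ⟨fun h0 => hmap (le_antisymm (h0 ▸ hle) (Measure.zero_le _)), ?_⟩
  -- The comparison process lives on `P.prod P`. Hamiltonians of different sizes may be dependent
  -- under `P`, so independent copies of the two blocks are needed.
  rw [← meanLog_independentSum g₁ g₂ hA₁ hA₂]
  have hcmp := (g₃.comp hm).meanLog_le_of_covariance_le (g₁.independentSum g₂) hprod
    (D := 3 * β ^ 2 * Cc) (fun t => by
      rw [integral_independentSum g₁.gaussian g₂.gaussian,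
        covariance_independentSum g₁.gaussian g₂.gaussian,
        h.mean_add_half_covariance_compensated hβ (N := N₁ + N₂) (by omega)]
      linarith [h.mean_add_half_covariance_compensated hβ h₁ t.1,
        h.mean_add_half_covariance_compensated hβ h₂ t.2]) (fun s t => by
      rw [covariance_independentSum g₁.gaussian g₂.gaussian, h.covariance_compensated hβ h₁,
        h.covariance_compensated hβ h₂, h.covariance_compensated hβ (N := N₁ + N₂) (by omega)]
      have := mul_le_mul_of_nonneg_left (h.cov_append_le h₁ h₂ s.1 t.1 s.2 t.2) (sq_nonneg β)
      linarith)
  refine hcmp.trans ?_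
  -- Concatenation pushes the product of the two restricted measures below the measure restricted to
  -- `A`, and the quenched average is monotone in the measure.
  rw [← g₃.meanLog_map hm]
  have := g₃.meanLog_mono g₃ hmap hle (c := 0) (ae_of_all _ fun t ω => by simp)
  linarith

end IsMeanFieldModel

end SpinGlass

/-! ### Convergence of almost increasing sequences and other auxiliary facts -/

/-- A substitute for Fekete's lemma: the hypothesis gives `limsup u ≤ liminf u + ε` for every `ε >
0`, and both are finite. -/
theorem exists_tendsto_of_eventually_sub_le {u : ℕ → ℝ} {K : ℝ} (hK : ∀ᶠ N in atTop, u N ≤ K)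
    (h : ∀ ε > 0, ∀ᶠ n in atTop, ∀ᶠ N in atTop, u n - ε ≤ u N) :
    ∃ l, Tendsto u atTop (𝓝 l) := by
  obtain ⟨n₀, hn₀⟩ := (h 1 one_pos).exists
  have hb : IsBoundedUnder (· ≤ ·) atTop u := ⟨K, by simpa using hK⟩
  have hb' : IsBoundedUnder (· ≥ ·) atTop u := ⟨u n₀ - 1, by simpa using hn₀⟩
  refine ⟨liminf u atTop, tendsto_of_le_liminf_of_limsup_le le_rfl ?_ hb hb'⟩
  refine le_of_forall_pos_le_add fun ε hε => limsup_le_of_le hb'.isCoboundedUnder_le ?_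
  filter_upwards [h ε hε] with n hn
  have := le_liminf_of_le hb.isCoboundedUnder_ge hn
  linarith

theorem tendsto_add_mul_sqrt_div_atTop (a b : ℝ) :
    Tendsto (fun N : ℕ => (a + b * √(N : ℝ)) / N) atTop (𝓝 0) := by
  have h1 := tendsto_const_div_atTop_nhds_zero_nat a
  have h2 : Tendsto (fun N : ℕ => b * (√(N : ℝ))⁻¹) atTop (𝓝 (b * 0)) :=
    ((Real.tendsto_sqrt_atTop.comp tendsto_natCast_atTop_atTop).inv_tendsto_atTop).const_mul b
  have h3 := h1.add h2
  rw [mul_zero, add_zero] at h3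
  refine h3.congr fun N => ?_
  rw [add_div, mul_div_assoc, Real.sqrt_div_self', one_div]

theorem Measure.pi_const_ne_zero {α : Type*} [MeasurableSpace α] {ν : Measure α}
    [IsFiniteMeasure ν] (hν : ν ≠ 0) (N : ℕ) : (Measure.pi fun _ : Fin N => ν) ≠ 0 := by
  intro h
  have := Measure.pi_univ (fun _ : Fin N => ν)
  rw [h, Measure.coe_zero, Pi.zero_apply, eq_comm, Finset.prod_eq_zero_iff] at this
  obtain ⟨i, -, hi⟩ := this
  exact hν (Measure.measure_univ_eq_zero.1 hi)

/-! ### Cells of order parameters and convergence of quenched averages -/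

namespace SpinGlass

/-- The configurations whose order parameters lie within distance `r` of `x`. -/
def cell {n : ℕ} {S : Set (EuclideanSpace ℝ (Fin n))} {k : ℕ}
    (m : Fin k → (N : ℕ) → Config S N → ℝ)
    (Q : Fin k → (N : ℕ) → Config S N → Config S N → ℝ)
    (x : (Fin k → ℝ) × (Fin k → ℝ)) (r : ℝ) (N : ℕ) : Set (Config S N) :=
  orderParameter m Q N ⁻¹' Metric.closedBall x r

/-- The product a priori measure restricted to a cell. -/
noncomputable def cellMeasure {n : ℕ} {S : Set (EuclideanSpace ℝ (Fin n))} (ν : Measure S)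
    [IsFiniteMeasure ν] {k : ℕ} (m : Fin k → (N : ℕ) → Config S N → ℝ)
    (Q : Fin k → (N : ℕ) → Config S N → Config S N → ℝ)
    (x : (Fin k → ℝ) × (Fin k → ℝ)) (r : ℝ) (N : ℕ) : Measure (Config S N) :=
  (Measure.pi fun _ : Fin N => ν).restrict (cell m Q x r N)

instance {n : ℕ} {S : Set (EuclideanSpace ℝ (Fin n))} (ν : Measure S)
    [IsFiniteMeasure ν] {k : ℕ} (m : Fin k → (N : ℕ) → Config S N → ℝ)
    (Q : Fin k → (N : ℕ) → Config S N → Config S N → ℝ)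
    (x : (Fin k → ℝ) × (Fin k → ℝ)) (r : ℝ) (N : ℕ) :
    IsFiniteMeasure (cellMeasure ν m Q x r N) := by
  unfold cellMeasure; infer_instance

namespace IsMeanFieldModel

variable {n : ℕ} {S : Set (EuclideanSpace ℝ (Fin n))} {Ω : Type*}
  [MeasurableSpace Ω] {P : Measure Ω}
  {H : (N : ℕ) → Config S N → Ω → ℝ} {k : ℕ} {M : ℝ}
  {g : (Fin k → ℝ) → ℝ} {m : Fin k → (N : ℕ) → Config S N → ℝ} {Cb : ℝ}
  {f : (Fin k → ℝ) → ℝ} {Q : Fin k → (N : ℕ) → Config S N → Config S N → ℝ} {Cc : ℝ}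
  {x : (Fin k → ℝ) × (Fin k → ℝ)} {r : ℝ}

theorem measurableSet_cell (h : IsMeanFieldModel P H M g m Cb f Q Cc) {N : ℕ} (hN : 1 ≤ N) :
    MeasurableSet (cell m Q x r N) :=
  h.measurable_orderParameter hN Metric.isClosed_closedBall.measurableSet

/-- Order parameters of a concatenation are convex combinations of those of its blocks, so balls are
stable under concatenation. -/
theorem dist_orderParameter_append_le (h : IsMeanFieldModel P H M g m Cb f Q Cc) {N₁ N₂ : ℕ}
    (h₁ : 1 ≤ N₁) (h₂ : 1 ≤ N₂) (σ₁ : Config S N₁) (σ₂ : Config S N₂)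
    (x : (Fin k → ℝ) × (Fin k → ℝ)) :
    ((N₁ + N₂ : ℕ) : ℝ) * dist (orderParameter m Q (N₁ + N₂) (Fin.append σ₁ σ₂)) x
      ≤ N₁ * dist (orderParameter m Q N₁ σ₁) x + N₂ * dist (orderParameter m Q N₂ σ₂) x := by
  have e : ((N₁ + N₂ : ℕ) : ℝ) • (orderParameter m Q (N₁ + N₂) (Fin.append σ₁ σ₂) - x)
      = (N₁ : ℝ) • (orderParameter m Q N₁ σ₁ - x)
        + (N₂ : ℝ) • (orderParameter m Q N₂ σ₂ - x) := by
    rw [smul_sub, h.orderParameter_append h₁ h₂, Nat.cast_add, add_smul, smul_sub, smul_sub]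
    abel
  have hn : ∀ (N : ℕ) (y : (Fin k → ℝ) × (Fin k → ℝ)), ‖(N : ℝ) • y‖ = N * ‖y‖ := fun N y => by
    rw [norm_smul, Real.norm_natCast]
  rw [dist_eq_norm, dist_eq_norm, dist_eq_norm, ← hn, e, ← hn, ← hn]
  exact norm_add_le _ _

variable [IsProbabilityMeasure P] {ν : Measure S} [IsFiniteMeasure ν]

/-- Repeating a block keeps the order parameters in a ball. -/
theorem meanLog_cell_mul (h : IsMeanFieldModel P H M g m Cb f Q Cc) {β : ℝ} (hβ : 0 < β)
    {N : ℕ} (hN : 1 ≤ N) (h0 : cellMeasure ν m Q x r N ≠ 0) (q : ℕ) :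
    cellMeasure ν m Q x r ((q + 1) * N) ≠ 0 ∧
    (q + 1) * meanLog (compensated P H β N) (cellMeasure ν m Q x r N) P
      ≤ meanLog (compensated P H β ((q + 1) * N)) (cellMeasure ν m Q x r ((q + 1) * N)) P
        + q * (3 * β ^ 2 * Cc / 2) := by
  -- Counting blocks as `q + 1` keeps every system nonempty; gluing them takes `q` concatenations,
  -- each costing the superadditivity constant once.
  induction q with
  | zero =>
    rw [show (0 + 1) * N = N by omega]
    exact ⟨h0, by simp⟩
  | succ q ih =>
    have e : (q + 1 + 1) * N = (q + 1) * N + N := Nat.succ_mul _ _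
    have hq : 1 ≤ (q + 1) * N := Nat.mul_pos (Nat.succ_pos q) hN
    rw [e]
    have key := h.meanLog_compensated_append (ν := ν) hβ hq hN (A₁ := cell m Q x r ((q + 1) * N))
      (A₂ := cell m Q x r N) (A := cell m Q x r ((q + 1) * N + N)) ih.1 h0 fun σ hσ τ hτ => by
        have hd := h.dist_orderParameter_append_le hq hN σ τ x
        have h1 : dist (orderParameter m Q _ σ) x ≤ r := hσ
        have h2 : dist (orderParameter m Q _ τ) x ≤ r := hτ
        have p : (0 : ℝ) < ((q + 1) * N + N : ℕ) := by exact_mod_cast (by omega)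
        refine Metric.mem_closedBall.2 (le_of_mul_le_mul_left (hd.trans ?_) p)
        refine le_trans ?_ (by rw [Nat.cast_add ((q + 1) * N) N, add_mul])
        exact add_le_add (mul_le_mul_of_nonneg_left h1 (Nat.cast_nonneg _))
          (mul_le_mul_of_nonneg_left h2 (Nat.cast_nonneg _))
    refine ⟨key.1, ?_⟩
    have k2 := key.2
    have k3 := ih.2
    unfold cellMeasure at k3 ⊢
    push_cast at k3 ⊢
    linarith

/-- Adding a remainder to a repeated block moves the order parameters only slightly. -/
theorem meanLog_cell_mul_add (h : IsMeanFieldModel P H M g m Cb f Q Cc) (hν : ν ≠ 0) {β : ℝ}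
    (hβ : 0 < β) {N R : ℕ} (hN : 1 ≤ N) (hR : 1 ≤ R) (h0 : cellMeasure ν m Q x r N ≠ 0) (q : ℕ)
    (hx : ‖x‖ ≤ |M|) (hr : 0 ≤ r)
    (hlarge : R * (2 * |M|) ≤ (((q + 1) * N + R : ℕ) : ℝ) * r) :
    cellMeasure ν m Q x (2 * r) ((q + 1) * N + R) ≠ 0 ∧
    (q + 1) * meanLog (compensated P H β N) (cellMeasure ν m Q x r N) P
        + meanLog (compensated P H β R) (Measure.pi fun _ : Fin R => ν) P
      ≤ meanLog (compensated P H β ((q + 1) * N + R))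
          (cellMeasure ν m Q x (2 * r) ((q + 1) * N + R)) P
        + (q + 1) * (3 * β ^ 2 * Cc / 2) := by
  obtain ⟨i1, i2⟩ := h.meanLog_cell_mul (ν := ν) hβ hN h0 q
  have hq : 1 ≤ (q + 1) * N := Nat.mul_pos (Nat.succ_pos q) hN
  have key := h.meanLog_compensated_append (ν := ν) hβ hq hR (A₁ := cell m Q x r ((q + 1) * N))
    (A₂ := Set.univ) (A := cell m Q x (2 * r) ((q + 1) * N + R)) i1
    (by rw [Measure.restrict_univ]; exact Measure.pi_const_ne_zero hν R) fun σ hσ τ _ => by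
      have hd := h.dist_orderParameter_append_le hq hR σ τ x
      have h1 : dist (orderParameter m Q _ σ) x ≤ r := hσ
      -- The remainder is unconstrained, so only the diameter of the parameter range controls it. By
      -- `hlarge` its weight in the whole system is small enough for this to fit in the extra radius
      -- `r`.
      have h2 : dist (orderParameter m Q _ τ) x ≤ 2 * |M| := by
        rw [dist_eq_norm]
        linarith [norm_sub_le (orderParameter m Q _ τ) x, h.norm_orderParameter_le hR τ]
      have p : (0 : ℝ) < ((q + 1) * N + R : ℕ) := by exact_mod_cast (by omega)
      refine Metric.mem_closedBall.2 (le_of_mul_le_mul_left (hd.trans ?_) p)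
      have h3 := mul_le_mul_of_nonneg_left h1 (Nat.cast_nonneg (α := ℝ) ((q + 1) * N))
      have h4 := mul_le_mul_of_nonneg_left h2 (Nat.cast_nonneg (α := ℝ) R)
      rw [Nat.cast_add ((q + 1) * N) R] at hlarge ⊢
      nlinarith [mul_nonneg (Nat.cast_nonneg (α := ℝ) R) hr]
  refine ⟨key.1, ?_⟩
  have k2 := key.2
  rw [Measure.restrict_univ] at k2
  unfold cellMeasure at i2 ⊢
  linarith

/-- On a cell the compensator is `N` times its value per site at the centre, up to `N ε` and a
bounded error. In this direction the restriction to the cell can be dropped at no cost. -/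
theorem meanLog_compensated_cell_le (h : IsMeanFieldModel P H M g m Cb f Q Cc) {β : ℝ}
    (hβ : 0 < β) {N : ℕ} (hN : 1 ≤ N) (h0 : cellMeasure ν m Q x r N ≠ 0) {ε : ℝ}
    (hosc : ∀ y, ‖y‖ ≤ |M| → dist y x ≤ r →
      |siteCompensator g f β y - siteCompensator g f β x| ≤ ε) :
    meanLog (compensated P H β N) (cellMeasure ν m Q x r N) P
      ≤ meanLog (energy H β N) (Measure.pi fun _ : Fin N => ν) P
        + (-(N * (siteCompensator g f β x - ε)) + (β * Cb + β ^ 2 * Cc / 2)) := by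
  obtain ⟨B, V, hU⟩ := h.isBoundedGaussian_compensated hβ hN
  have hE := h.isBoundedGaussian_energy hβ hN (h.cov_self_le hN)
  refine hU.meanLog_mono hE h0 Measure.restrict_le_self
    (ae_restrict_of_forall_mem (h.measurableSet_cell hN) fun σ hσ ω => ?_)
  have h1 := (abs_le.1 (h.abs_compensator_sub_le hβ hN σ)).1
  have h2 := (abs_le.1 (hosc _ (h.norm_orderParameter_le hN σ) hσ)).1
  have h3 := mul_le_mul_of_nonneg_left h2 (Nat.cast_nonneg (α := ℝ) N)
  simp only [compensated]
  linarith

/-- The converse estimate. Here both sides stay on the cell, since elsewhere the compensator could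
be very different from its value at the centre. -/
theorem meanLog_energy_cell_le (h : IsMeanFieldModel P H M g m Cb f Q Cc) {β : ℝ}
    (hβ : 0 < β) {N : ℕ} (hN : 1 ≤ N) (h0 : cellMeasure ν m Q x r N ≠ 0) {ε : ℝ}
    (hosc : ∀ y, ‖y‖ ≤ |M| → dist y x ≤ r →
      |siteCompensator g f β y - siteCompensator g f β x| ≤ ε) :
    meanLog (energy H β N) (cellMeasure ν m Q x r N) P
      ≤ meanLog (compensated P H β N) (cellMeasure ν m Q x r N) P
        + (N * (siteCompensator g f β x + ε) + (β * Cb + β ^ 2 * Cc / 2)) := by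
  obtain ⟨B, V, hU⟩ := h.isBoundedGaussian_compensated hβ hN
  have hE := h.isBoundedGaussian_energy hβ hN (h.cov_self_le hN)
  refine hE.meanLog_mono hU h0 le_rfl
    (ae_restrict_of_forall_mem (h.measurableSet_cell hN) fun σ hσ ω => ?_)
  have h1 := (abs_le.1 (h.abs_compensator_sub_le hβ hN σ)).2
  have h2 := (abs_le.1 (hosc _ (h.norm_orderParameter_le hN σ) hσ)).2
  have h3 := mul_le_mul_of_nonneg_left h2 (Nat.cast_nonneg (α := ℝ) N)
  simp only [compensated]
  linarith

/-- Among finitely many cells covering the configurations, one carries the quenched average up to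
an error of order `√N`. -/
theorem exists_meanLog_le_cell (h : IsMeanFieldModel P H M g m Cb f Q Cc) (hν : ν ≠ 0) {β : ℝ}
    (hβ : 0 < β) {ι : Type*} [Fintype ι] {y : ι → (Fin k → ℝ) × (Fin k → ℝ)}
    (hcover : ∀ z, ‖z‖ ≤ |M| → ∃ i, dist z (y i) ≤ r) {N : ℕ} (hN : 1 ≤ N) :
    ∃ i, cellMeasure ν m Q (y i) r N ≠ 0 ∧
      meanLog (energy H β N) (Measure.pi fun _ : Fin N => ν) P
        ≤ meanLog (energy H β N) (cellMeasure ν m Q (y i) r N) P + Real.log (Fintype.card ι)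
          + Fintype.card ι * (2 * Real.exp (β ^ 2 * (maxAbsOnCube f M + |Cc|) / 2)) * √(N : ℝ) := by
  have hN' : (0 : ℝ) < N := by exact_mod_cast hN
  have hE := h.isBoundedGaussian_energy hβ hN (h.cov_self_le hN)
  have hs : 0 < √(N : ℝ) := Real.sqrt_pos.2 hN'
  -- Variances are of order `N`, so `l = 1 / √N` keeps the exponent bounded and the factor `1 / l`
  -- equals `√N`.
  obtain ⟨i, hi, hle⟩ := hE.exists_meanLog_le_restrict (Measure.pi_const_ne_zero hν N)
    (A := fun i => cell m Q (y i) r N)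
    (fun σ => hcover _ (h.norm_orderParameter_le hN σ)) (l := (√(N : ℝ))⁻¹) (by positivity)
  refine ⟨i, hi, hle.trans ?_⟩
  rw [div_inv_eq_mul, ← mul_assoc]
  have hexp : β ^ 2 * (N * (maxAbsOnCube f M + Cc / N)) * (√(N : ℝ))⁻¹ ^ 2
      ≤ β ^ 2 * (maxAbsOnCube f M + |Cc|) := by
    rw [inv_pow, Real.sq_sqrt hN'.le]
    have e : β ^ 2 * (N * (maxAbsOnCube f M + Cc / N)) * (N : ℝ)⁻¹
        = β ^ 2 * (maxAbsOnCube f M + Cc / N) := by field_simp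
    rw [e]
    have : Cc / N ≤ |Cc| := by
      refine (div_le_div_of_nonneg_right (le_abs_self Cc) hN'.le).trans
        (div_le_self (abs_nonneg _) ?_)
      exact_mod_cast hN
    gcongr
  unfold cellMeasure
  gcongr

/-- Quenched averages per site are eventually almost increasing. -/
theorem eventually_meanLog_sub_le (h : IsMeanFieldModel P H M g m Cb f Q Cc) (hν : ν ≠ 0) {β : ℝ}
    (hβ : 0 < β) {ε : ℝ} (hε : 0 < ε) :
    ∀ᶠ N₀ : ℕ in atTop, ∀ᶠ N : ℕ in atTop,
      meanLog (energy H β N₀) (Measure.pi fun _ : Fin N₀ => ν) P / N₀ - 4 * ε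
        ≤ meanLog (energy H β N) (Measure.pi fun _ : Fin N => ν) P / N := by
  have hcpt : IsCompact (Metric.closedBall (0 : (Fin k → ℝ) × (Fin k → ℝ)) |M|) :=
    isCompact_closedBall _ _
  obtain ⟨δ, hδ, hosc⟩ := Metric.uniformContinuousOn_iff.1
    (hcpt.uniformContinuousOn_of_continuous (h.continuous_siteCompensator β).continuousOn) ε hε
  -- Appending a remainder doubles the radius of a cell, and `2ρ` still has to be below `δ`.
  set ρ := δ / 3 with hρ
  have hρ0 : 0 < ρ := by positivity
  obtain ⟨t, htsub, htfin, htcov⟩ := hcpt.finite_cover_balls hρ0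
  have : Fintype t := htfin.fintype
  have hosc' : ∀ x ∈ t, ∀ r ≤ 2 * ρ, ∀ y, ‖y‖ ≤ |M| → dist y x ≤ r →
      |siteCompensator g f β y - siteCompensator g f β x| ≤ ε := fun x hx r hr y hy hyx =>
    (hosc y (mem_closedBall_zero_iff.2 hy) x (htsub hx) (by linarith)).le
  have hcover : ∀ z, ‖z‖ ≤ |M| → ∃ i : t, dist z (i : (Fin k → ℝ) × (Fin k → ℝ)) ≤ ρ :=
      fun z hz => by
    have := htcov (mem_closedBall_zero_iff.2 hz)
    simp only [Set.mem_iUnion, Metric.mem_ball] at this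
    obtain ⟨i, hi, hd⟩ := this
    exact ⟨⟨i, hi⟩, hd.le⟩
  set D := 3 * β ^ 2 * Cc / 2 with hD
  set C₁ := β * Cb + β ^ 2 * Cc / 2 with hC₁
  set c := C₁ + Real.log (Fintype.card t) + D with hc
  set d := (Fintype.card t : ℝ) * (2 * Real.exp (β ^ 2 * (maxAbsOnCube f M + |Cc|) / 2)) with hd
  set a : ℕ → ℝ := fun N => meanLog (energy H β N) (Measure.pi fun _ : Fin N => ν) P with ha
  have hsmall : ∀ᶠ N₀ : ℕ in atTop, (|c| + d * √(N₀ : ℝ)) / N₀ < ε :=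
    (tendsto_add_mul_sqrt_div_atTop |c| d).eventually_lt_const hε
  filter_upwards [hsmall, eventually_ge_atTop 1] with N₀ hN₀ h1
  have p₀ : (0 : ℝ) < N₀ := by exact_mod_cast h1
  obtain ⟨⟨x, hx⟩, hx0, hax⟩ := h.exists_meanLog_le_cell hν hβ hcover h1
  dsimp only at hx0 hax
  have hup := h.meanLog_energy_cell_le hβ h1 hx0 (hosc' x hx ρ (by linarith))
  set φ := siteCompensator g f β x with hφ
  set F := meanLog (compensated P H β N₀) (cellMeasure ν m Q x ρ N₀) P with hF
  -- The smallness of `(|c| + d √N₀) / N₀` pays in advance for the selection of the cell, the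
  -- bounded compensator error and the cost `D` of gluing one block.
  have hF0 : a N₀ ≤ F + N₀ * (φ + ε) + N₀ * ε - D := by
    have := (div_lt_iff₀ p₀).1 hN₀
    have h2 : a N₀ ≤ _ := hax
    linarith [le_abs_self c]
  -- A bound for the remainder block that depends on `N₀` only; together with the other terms of `W`
  -- it becomes negligible against `N ε`.
  set R := ∑ r ∈ Finset.range (N₀ + 1),
    |meanLog (compensated P H β r) (Measure.pi fun _ : Fin r => ν) P| with hR
  set W := |a N₀| + N₀ * |φ| + R + |C₁| with hW
  have e1 : ∀ᶠ N : ℕ in atTop, N₀ * (2 * |M|) ≤ (N : ℝ) * ρ :=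
    (tendsto_natCast_atTop_atTop.atTop_mul_const hρ0).eventually_ge_atTop _
  have e2 : ∀ᶠ N : ℕ in atTop, W ≤ (N : ℝ) * ε :=
    (tendsto_natCast_atTop_atTop.atTop_mul_const hε).eventually_ge_atTop _
  filter_upwards [e1, e2, eventually_ge_atTop (N₀ + 1)] with N hN1 hN2 hN3
  have pN : (0 : ℝ) < N := by exact_mod_cast (by omega : 0 < N)
  -- Dividing `N - 1` instead of `N` puts the remainder in `1, …, N₀`, because concatenation is
  -- available only for nonempty blocks.
  obtain ⟨q, r, hr1, hr2, rfl⟩ : ∃ q r, 1 ≤ r ∧ r ≤ N₀ ∧ N = (q + 1) * N₀ + r := by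
    have hq : 1 ≤ (N - 1) / N₀ := (Nat.one_le_div_iff h1).2 (by omega)
    refine ⟨(N - 1) / N₀ - 1, (N - 1) % N₀ + 1, by omega, Nat.mod_lt _ h1, ?_⟩
    rw [Nat.sub_add_cancel hq]
    have := Nat.div_add_mod' (N - 1) N₀
    omega
  have hr2' : (r : ℝ) ≤ N₀ := by exact_mod_cast hr2
  obtain ⟨hx1, hmul⟩ := h.meanLog_cell_mul_add hν hβ h1 hr1 hx0 q
    (mem_closedBall_zero_iff.1 (htsub hx)) hρ0.le
    ((mul_le_mul_of_nonneg_right hr2' (by positivity)).trans hN1)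
  have hlow := h.meanLog_compensated_cell_le hβ (by omega) hx1 (hosc' x hx (2 * ρ) le_rfl)
  rw [← hφ, ← hC₁] at hlow
  rw [← hF, ← hD] at hmul
  have hRr : -R ≤ meanLog (compensated P H β r) (Measure.pi fun _ : Fin r => ν) P := by
    have := Finset.single_le_sum (f := fun r => |meanLog (compensated P H β r)
      (Measure.pi fun _ : Fin r => ν) P|) (fun i _ => abs_nonneg _)
      (Finset.mem_range.2 (by omega : r < N₀ + 1))
    linarith [neg_abs_le (meanLog (compensated P H β r) (Measure.pi fun _ : Fin r => ν) P)]
  have hs1 : -(N₀ * |φ|) ≤ r * φ := by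
    have := mul_le_mul_of_nonneg_right hr2' (abs_nonneg φ)
    have h2 := mul_le_mul_of_nonneg_left (neg_abs_le φ) (Nat.cast_nonneg (α := ℝ) r)
    linarith
  have hs2 : r * (a N₀ / N₀) ≤ |a N₀| := by
    rw [mul_div_assoc', div_le_iff₀ p₀]
    have := mul_le_mul_of_nonneg_right hr2' (abs_nonneg (a N₀))
    have h2 := mul_le_mul_of_nonneg_left (le_abs_self (a N₀)) (Nat.cast_nonneg (α := ℝ) r)
    linarith
  have hs3 : N₀ * (a N₀ / N₀) = a N₀ := mul_div_cancel₀ _ p₀.ne'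
  have hq0 : (0 : ℝ) ≤ q + 1 := by positivity
  have hF1 := mul_le_mul_of_nonneg_left hF0 hq0
  have hrε : 0 ≤ (r : ℝ) * ε := by positivity
  rw [le_div_iff₀ pN]
  push_cast at hN2 hlow ⊢
  have hs4 : (q + 1 : ℝ) * (N₀ * (a N₀ / N₀)) = (q + 1) * a N₀ := by rw [hs3]
  have hfin : (a N₀ / N₀ - 4 * ε) * ((q + 1) * N₀ + r)
      = (q + 1) * (N₀ * (a N₀ / N₀)) + r * (a N₀ / N₀)
        -- The four `ε` come from the oscillation on the small cell, the costs at scale `N₀`, the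
        -- oscillation on the doubled cell, and `W`.
        - 4 * (((q + 1) * N₀ + r) * ε) := by ring
  refine le_trans (le_of_eq hfin) ?_
  rw [hs4]
  linarith [le_abs_self C₁]

/-- The quenched averages per site converge. -/
theorem exists_tendsto_meanLog (h : IsMeanFieldModel P H M g m Cb f Q Cc) (hν : ν ≠ 0) {β : ℝ}
    (hβ : 0 < β) :
    ∃ l, Tendsto (fun N : ℕ => meanLog (energy H β N) (Measure.pi fun _ : Fin N => ν) P / N)
      atTop (𝓝 l) := by
  have : NeZero ν := ⟨hν⟩
  refine exists_tendsto_of_eventually_sub_le (K := Real.log (ν.real Set.univ)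
    + β * (maxAbsOnCube g M + |Cb|) + β ^ 2 * (maxAbsOnCube f M + |Cc|) / 2) ?_ fun ε hε => ?_
  · filter_upwards [eventually_ge_atTop 1] with N hN
    have hN' : (1 : ℝ) ≤ N := by exact_mod_cast hN
    have hN0 : (0 : ℝ) < N := by linarith
    have hE := h.isBoundedGaussian_energy hβ hN (h.cov_self_le hN)
    have h1 := hE.meanLog_le (Measure.pi_const_ne_zero hν N)
    have h2 : (Measure.pi fun _ : Fin N => ν).real Set.univ = ν.real Set.univ ^ N := by
      simp [measureReal_def, Measure.pi_univ]
    rw [h2, Real.log_pow] at h1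
    rw [div_le_iff₀ hN0]
    refine h1.trans ?_
    have h3 : Cb ≤ |Cb| * N := (le_abs_self Cb).trans (le_mul_of_one_le_right (abs_nonneg _) hN')
    have h4 : Cc ≤ |Cc| * N := (le_abs_self Cc).trans (le_mul_of_one_le_right (abs_nonneg _) hN')
    have h5 := mul_le_mul_of_nonneg_left h3 hβ.le
    have h6 := mul_le_mul_of_nonneg_left h4 (sq_nonneg β)
    have h7 : N * (maxAbsOnCube f M + Cc / N) = N * maxAbsOnCube f M + Cc := by field_simp
    rw [h7]
    linarith
  · filter_upwards [h.eventually_meanLog_sub_le hν hβ (ε := ε / 4) (by positivity)] with N₀ h1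
    filter_upwards [h1] with N h2
    linarith

end IsMeanFieldModel

end SpinGlass

/-! ### Concentration and almost sure convergence of the free energy -/

namespace SpinGlass

variable {n : ℕ} {S : Set (EuclideanSpace ℝ (Fin n))} {Ω : Type*} {ν : Measure S}
  [IsFiniteMeasure ν] {H : (N : ℕ) → Config S N → Ω → ℝ}

variable [MeasurableSpace Ω] {P : Measure Ω}

theorem freeEnergy_sub_quenchedFreeEnergy (β : ℝ) (N : ℕ) (ω : Ω) :
    freeEnergy ν H β N ω - quenchedFreeEnergy P ν H β N
      = -(1 / ((N : ℝ) * β))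
        * (Real.log (expIntegral (energy H β N) (Measure.pi fun _ : Fin N => ν) ω)
          - meanLog (energy H β N) (Measure.pi fun _ : Fin N => ν) P) := by
  rw [mul_sub]; rfl

variable [IsProbabilityMeasure P]

/-- Gaussian concentration of the free energy, with the variances of `H_N` bounded by `N L`. -/
theorem measureReal_freeEnergy_sub_le (hν : ν ≠ 0) {β : ℝ} (hβ : 0 < β) {N : ℕ} (hN : 1 ≤ N)
    {B L : ℝ} (hL : 0 ≤ L) (hX : IsBoundedGaussian (energy H β N) P B (β ^ 2 * (N * L)))
    {u : ℝ} (hu : 0 < u) :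
    P.real {ω | u ≤ |freeEnergy ν H β N ω - quenchedFreeEnergy P ν H β N|}
      ≤ gaussianTail N L u := by
  have hN' : (0 : ℝ) < N := by exact_mod_cast hN
  have hsub := hX.hasSubgaussianMGF_log (Measure.pi_const_ne_zero hν N)
  set Y : Ω → ℝ := fun ω =>
    Real.log (expIntegral (energy H β N) (Measure.pi fun _ : Fin N => ν) ω)
      - meanLog (energy H β N) (Measure.pi fun _ : Fin N => ν) P with hY
  have habs : ∀ ω, |freeEnergy ν H β N ω - quenchedFreeEnergy P ν H β N|
      = |Y ω| / (N * β) := fun ω => by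
    rw [freeEnergy_sub_quenchedFreeEnergy, abs_mul, abs_neg, abs_of_pos (by positivity),
      one_div, inv_mul_eq_div]
  simp only [habs]
  unfold gaussianTail
  split_ifs with hL0
  -- With variance proxy zero the fluctuation vanishes almost surely, which justifies the value `0`
  -- of the tail bound.
  · rw [hL0, mul_zero, mul_zero, Real.toNNReal_zero] at hsub
    have hae := hsub.ae_eq_zero_of_hasSubgaussianMGF_zero
    refine le_of_eq ((measureReal_eq_zero_iff).2 (measure_mono_null (fun ω hω => ?_) hae))
    simp only [Set.mem_ofPred_eq] at hω
    intro h0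
    have h0' : Y ω = 0 := h0
    rw [h0', abs_zero, zero_div] at hω
    linarith
  · have hLpos : 0 < L := lt_of_le_of_ne hL (Ne.symm hL0)
    -- A deviation `u` of the free energy is a deviation `N β u` of `log Z_N`, whose proxy is `β² N
    -- L`; the temperature cancels.
    have hexp : -(N * β * u) ^ 2 / (2 * ((β ^ 2 * (N * L)).toNNReal : ℝ))
        = -((N : ℝ) * u ^ 2 / (2 * L)) := by
      rw [Real.coe_toNNReal _ (by positivity)]
      field_simp
    have h1 := hsub.measure_ge_le (ε := N * β * u) (by positivity)
    have h2 := hsub.neg.measure_ge_le (ε := N * β * u) (by positivity)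
    rw [hexp] at h1 h2
    have hle : P.real {ω | u ≤ |Y ω| / (N * β)}
        ≤ P.real ({ω | N * β * u ≤ Y ω} ∪ {ω | N * β * u ≤ (-Y) ω}) := by
      refine measureReal_mono (fun ω hω => ?_) (measure_ne_top _ _)
      simp only [Set.mem_ofPred_eq] at hω
      rw [le_div_iff₀ (by positivity), mul_comm] at hω
      exact le_abs.1 hω
    refine hle.trans ((measureReal_union_le _ _).trans ?_)
    linarith

/-- The proxy `L + Cc / N` varies with `N`; domination by a fixed proxy gives a geometric, hence
summable, sequence of bounds. -/
theorem gaussianTail_le {N : ℕ} {L L' u : ℝ} (hL : 0 ≤ L) (h : L ≤ L') :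
    gaussianTail N L u ≤ 2 * Real.exp (N * -(u ^ 2 / (2 * L'))) := by
  unfold gaussianTail
  split_ifs with h0
  · positivity
  · have hpos : 0 < L := lt_of_le_of_ne hL (Ne.symm h0)
    rw [mul_neg, mul_div_assoc]
    gcongr

namespace IsMeanFieldModel

variable {k : ℕ} {M : ℝ}
  {g : (Fin k → ℝ) → ℝ} {m : Fin k → (N : ℕ) → Config S N → ℝ} {Cb : ℝ}
  {f : (Fin k → ℝ) → ℝ} {Q : Fin k → (N : ℕ) → Config S N → Config S N → ℝ} {Cc : ℝ}

theorem measureReal_freeEnergy_sub_le_of_covariance_le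
    (h : IsMeanFieldModel P H M g m Cb f Q Cc) (hν : ν ≠ 0) {β : ℝ} (hβ : 0 < β) {N : ℕ}
    (hN : 1 ≤ N) {L : ℝ} (hL : ∀ σ, covariance (H N σ) (H N σ) P ≤ N * L) {u : ℝ} (hu : 0 < u) :
    P.real {ω | u ≤ |freeEnergy ν H β N ω - quenchedFreeEnergy P ν H β N|}
      ≤ gaussianTail N L u :=
  measureReal_freeEnergy_sub_le hν hβ hN (h.nonneg_of_covariance_le hν hN hL)
    (h.isBoundedGaussian_energy hβ hN hL) hu

/-- Borel–Cantelli applied to the exponential tail bounds, for one fixed threshold; no independence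
between sizes is required. -/
theorem ae_eventually_abs_freeEnergy_sub_lt (h : IsMeanFieldModel P H M g m Cb f Q Cc)
    (hν : ν ≠ 0) {β : ℝ} (hβ : 0 < β) {u : ℝ} (hu : 0 < u) :
    ∀ᵐ ω ∂P, ∀ᶠ N : ℕ in atTop,
      |freeEnergy ν H β N ω - quenchedFreeEnergy P ν H β N| < u := by
  -- This dominates every proxy with `N ≥ 1`; the summand `1` keeps it positive, so that the series
  -- has ratio below one.
  set L' := |maxAbsOnCube f M| + |Cc| + 1 with hL'
  have hbound : ∀ N : ℕ, P.real {ω | u ≤ |freeEnergy ν H β N ω - quenchedFreeEnergy P ν H β N|}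
      ≤ 2 * Real.exp (N * -(u ^ 2 / (2 * L'))) := fun N => by
    -- The model says nothing about size zero, but there the claimed bound is `2`.
    rcases Nat.eq_zero_or_pos N with rfl | hN
    · simp only [CharP.cast_eq_zero, zero_mul, Real.exp_zero]
      linarith [measureReal_le_one (μ := P)
        (s := {ω | u ≤ |freeEnergy ν H β 0 ω - quenchedFreeEnergy P ν H β 0|})]
    · refine (h.measureReal_freeEnergy_sub_le_of_covariance_le hν hβ hN (h.cov_self_le hN)
        hu).trans (gaussianTail_le (h.nonneg_of_covariance_le hν hN (h.cov_self_le hN)) ?_)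
      have h1 : (1 : ℝ) ≤ N := by exact_mod_cast hN
      have h2 : Cc / N ≤ |Cc| :=
        (div_le_div_of_nonneg_right (le_abs_self Cc) (by linarith)).trans
          (div_le_self (abs_nonneg _) h1)
      linarith [le_abs_self (maxAbsOnCube f M)]
  have hsum : Summable fun N : ℕ => 2 * Real.exp (N * -(u ^ 2 / (2 * L'))) :=
    (Real.summable_exp_nat_mul_iff.2 (neg_neg_of_pos (by positivity))).mul_left 2
  have hfin : ∑' N : ℕ, P {ω | u ≤ |freeEnergy ν H β N ω - quenchedFreeEnergy P ν H β N|} ≠ ⊤ :=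
    ne_top_of_le_ne_top hsum.tsum_ofReal_ne_top (ENNReal.tsum_le_tsum fun N => by
      rw [← ofReal_measureReal]
      exact ENNReal.ofReal_le_ofReal (hbound N))
  filter_upwards [ae_eventually_notMem hfin] with ω hω
  filter_upwards [hω] with N hN
  exact not_le.1 hN

theorem ae_tendsto_freeEnergy (h : IsMeanFieldModel P H M g m Cb f Q Cc)
    (hν : ν ≠ 0) {β : ℝ} (hβ : 0 < β) {l : ℝ}
    (hl : Tendsto (fun N : ℕ => quenchedFreeEnergy P ν H β N) atTop (𝓝 l)) :
    ∀ᵐ ω ∂P, Tendsto (fun N : ℕ => freeEnergy ν H β N ω) atTop (𝓝 l) := by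
  have hall : ∀ᵐ ω ∂P, ∀ j : ℕ, ∀ᶠ N : ℕ in atTop,
      |freeEnergy ν H β N ω - quenchedFreeEnergy P ν H β N| < 1 / ((j : ℝ) + 1) :=
    ae_all_iff.2 fun j => h.ae_eventually_abs_freeEnergy_sub_lt hν hβ (by positivity)
  filter_upwards [hall] with ω hω
  have h0 : Tendsto (fun N : ℕ => freeEnergy ν H β N ω - quenchedFreeEnergy P ν H β N) atTop
      (𝓝 0) := by
    refine Metric.tendsto_nhds.2 fun ε hε => ?_
    obtain ⟨j, hj⟩ := exists_nat_one_div_lt hε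
    filter_upwards [hω j] with N hN
    rw [Real.dist_eq, sub_zero]
    exact hN.trans hj
  simpa using h0.add hl

theorem exists_tendsto_quenchedFreeEnergy (h : IsMeanFieldModel P H M g m Cb f Q Cc)
    (hν : ν ≠ 0) {β : ℝ} (hβ : 0 < β) :
    ∃ l, Tendsto (fun N : ℕ => quenchedFreeEnergy P ν H β N) atTop (𝓝 l) := by
  obtain ⟨l, hl⟩ := h.exists_tendsto_meanLog hν hβ
  refine ⟨_, (hl.const_mul (-(1 / β))).congr fun N => ?_⟩
  have e : quenchedFreeEnergy P ν H β N = -(1 / ((N : ℝ) * β))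
      * meanLog (energy H β N) (Measure.pi fun _ : Fin N => ν) P := rfl
  rw [e]
  ring

end IsMeanFieldModel

end SpinGlass

/-! ### The main theorem -/

theorem theorem1
    -- spins: a set `S ⊆ ℝⁿ` with a finite nonzero a priori measure
    {n : ℕ} (S : Set (EuclideanSpace ℝ (Fin n)))
    (ν : Measure S) [IsFiniteMeasure ν] (hν : ν ≠ 0)
    -- disorder: a probability space carrying the Gaussian Hamiltonians of all sizes
    {Ω : Type*} [MeasurableSpace Ω] (P : Measure Ω) [IsProbabilityMeasure P]
    (H : (N : ℕ) → SpinGlass.Config S N → Ω → ℝ)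
    (hHmeas : ∀ N : ℕ, 1 ≤ N →
      Measurable (fun p : SpinGlass.Config S N × Ω => H N p.1 p.2))
    (hHgauss : ∀ N : ℕ, 1 ≤ N → IsGaussianProcess (H N) P)
    {k : ℕ} (M : ℝ)
    -- the mean
    (g : (Fin k → ℝ) → ℝ) (hg : ContDiff ℝ 1 g)
    (m : Fin k → (N : ℕ) → SpinGlass.Config S N → ℝ)
    (hmmeas : ∀ i, ∀ N : ℕ, 1 ≤ N → Measurable (m i N))
    (hmbdd : ∀ i, ∀ N : ℕ, 1 ≤ N → ∀ σ, |m i N σ| ≤ M)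
    (hmadd : ∀ i, SpinGlass.IsSizeAdditive (m i))
    (Cb : ℝ)
    (hmean : ∀ N : ℕ, 1 ≤ N → ∀ σ : SpinGlass.Config S N,
      |(∫ ω, H N σ ω ∂P) / N - g (fun i => m i N σ)| ≤ Cb / N)
    -- the covariance
    (f : (Fin k → ℝ) → ℝ) (hf : ContDiff ℝ 1 f) (hfconv : ConvexOn ℝ Set.univ f)
    (Q : Fin k → (N : ℕ) → SpinGlass.Config S N → SpinGlass.Config S N → ℝ)
    (hQmeas : ∀ i, ∀ N : ℕ, 1 ≤ N →
      Measurable (fun p : SpinGlass.Config S N × SpinGlass.Config S N => Q i N p.1 p.2))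
    (hQbdd : ∀ i, ∀ N : ℕ, 1 ≤ N → ∀ σ, |Q i N σ σ| ≤ M)
    (hQadd : ∀ i, SpinGlass.IsSizeAdditive₂ (Q i))
    (Cc : ℝ)
    (hcov : ∀ N : ℕ, 1 ≤ N → ∀ σ τ : SpinGlass.Config S N,
      |covariance (H N σ) (H N τ) P / N - f (fun i => Q i N σ τ)| ≤ Cc / N) :
    ∃ fLim : ℝ → ℝ, ∀ β : ℝ, 0 < β →
      -- the partition function is almost surely finite and positive, and `E log Z_N` makes sense
      (∀ N : ℕ, 1 ≤ N →
        (∀ᵐ ω ∂P, Integrable (SpinGlass.boltzmannFactor H β N ω)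
            (Measure.pi fun _ : Fin N => ν) ∧
          0 < SpinGlass.partitionFunction ν H β N ω) ∧
        Integrable (fun ω => Real.log (SpinGlass.partitionFunction ν H β N ω)) P) ∧
      -- convergence of the quenched free energy
      Tendsto (fun N : ℕ => SpinGlass.quenchedFreeEnergy P ν H β N) atTop (𝓝 (fLim β)) ∧
      -- almost sure convergence
      (∀ᵐ ω ∂P, Tendsto (fun N : ℕ => SpinGlass.freeEnergy ν H β N ω) atTop (𝓝 (fLim β))) ∧
      -- fluctuations, the bounded correction of the covariance being taken into account
      (∀ N : ℕ, 1 ≤ N → ∀ u : ℝ, 0 < u →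
        P.real {ω | u ≤ |SpinGlass.freeEnergy ν H β N ω
            - SpinGlass.quenchedFreeEnergy P ν H β N|} ≤
          SpinGlass.gaussianTail N (SpinGlass.maxAbsOnCube f M + Cc / N) u) ∧
      -- fluctuations, whenever that correction does not push a variance above `N L`
      (∀ N : ℕ, 1 ≤ N →
        (∀ σ : SpinGlass.Config S N,
          covariance (H N σ) (H N σ) P ≤ N * SpinGlass.maxAbsOnCube f M) →
        ∀ u : ℝ, 0 < u →
        P.real {ω | u ≤ |SpinGlass.freeEnergy ν H β N ω
            - SpinGlass.quenchedFreeEnergy P ν H β N|} ≤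
          SpinGlass.gaussianTail N (SpinGlass.maxAbsOnCube f M) u) := by
  have h : SpinGlass.IsMeanFieldModel P H M g m Cb f Q Cc :=
    ⟨hHmeas, hHgauss, hg.continuous, hmmeas, hmbdd, hmadd, hmean, hf.continuous, hfconv, hQmeas,
      hQbdd, hQadd, hcov⟩
  -- The limit is chosen as a total function of `β`; its values at `β ≤ 0` are arbitrary.
  choose! fLim hlim using fun β (hβ : 0 < β) => h.exists_tendsto_quenchedFreeEnergy hν hβ
  refine ⟨fLim, fun β hβ => ⟨fun N hN => ?_, hlim β hβ, h.ae_tendsto_freeEnergy hν hβ (hlim β hβ),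
    fun N hN u hu => h.measureReal_freeEnergy_sub_le_of_covariance_le hν hβ hN
      (h.cov_self_le hN) hu,
    fun N hN hL u hu => h.measureReal_freeEnergy_sub_le_of_covariance_le hν hβ hN hL hu⟩⟩
  have hX := h.isBoundedGaussian_energy hβ hN (h.cov_self_le hN)
  have hμ := Measure.pi_const_ne_zero hν N
  refine ⟨?_, hX.integrable_log hμ⟩
  filter_upwards [hX.ae_integrable_exp (Measure.pi fun _ : Fin N => ν),
    hX.ae_expIntegral_pos hμ] with ω h1 h2
  exact ⟨h1, h2⟩
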